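/- Let $n\ge 1$ and let $\mathbb F_n=\mathbb P(\mathcal O_{\mathbb P^1}(n)\oplus\mathcal O_{\mathbb P^1})$ be the $n$-th Hirzebruch surface, with inhomogeneous coordinates $z_1$ on the base and $z_2$ in the fibre; under the change of base coordinate $z_1'=1/z_1$ the fibre coordinate becomes $z_2'=z_2/z_1^{\,n}$, and $z_2=\infty$ is the section of self-intersection $-n$. For a Hermitian metric $g=\sum g_{i\bar j}\,dz_i\otimes d\bar z_j$ with associated form $\omega=\frac{\sqrt{-1}}2\sum g_{i\bar j}\,dz_i\wedge d\bar z_j$, call $g$ (or $\omega$) Kähler if $d\omega=0$, and Hodge if it is Kähler and the class of $\omega$ lies in the image of $H^2(\,\cdot\,;\mathbb Q)\to H^2(\,\cdot\,;\mathbb R)$. Put $$R_{i\bar jk\bar l}=-\frac{\partial^2 g_{i\bar j}}{\partial z_k\partial\bar z_l}+\sum_{p,q}g^{p\bar q}\frac{\partial g_{i\bar p}}{\partial z_k}\frac{\partial g_{q\bar j}}{\partial\bar z_l},\qquad K(\xi)=\frac{2\sum R_{i\bar jk\bar l}\,\xi_i\bar\xi_j\xi_k\bar\xi_l}{\sum g_{i\bar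 j}g_{k\bar l}\,\xi_i\bar\xi_j\xi_k\bar\xi_l}$$ for non-zero tangent vectors $\xi=\sum\xi_i\,\partial/\partial z_i$, where $(g^{p\bar q})$ is the inverse matrix of $(g_{i\bar j})$. Positive holomorphic sectional curvature $K$ is called $c$-pinched, $c\in(0,1]$, if $\inf_\xi K(\xi)/\sup_\xi K(\xi)=c$, over all non-zero tangent vectors of the whole manifold. 1. For every real $s>0$ the form $$\omega_s=\tfrac{\sqrt{-1}}2\,\partial\bar\partial\bigl(\log(1+|z_1|^2)+s\log((1+|z_1|^2)^n+|z_2|^2)\bigr)$$ extends to a smooth Hermitian metric on all of $\mathbb F_n$ (unique, since the coordinate domain is dense), and this metric is Kähler. 2. If $s>0$ is rational, then $\frac1\pi\omega_s$ is Hodge. 3. If $0<s<1/n^2$, the smallest and the largest value of the holomorphic sectional curvature of $\omega_s$ exist and equal $$\min_\xi K(\xi)=\frac{4-4n^2s}{1+s+2ns},\qquad \max_\xi K(\xi)=\frac4s .$$ 4. For $s>0$, the holomorphic sectional curvature of $\omega_s$ is positive if and only if $s<1/n^2$. 5. For $s=\frac1{2n^2+n}$ the positive holomorphic sectional curvature of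 $\omega_s$ is $\frac1{(1+2n)^2}$-pinched, and so is that of the Hodge metric $\frac1\pi\omega_s$. In particular, there exists a Hodge metric on $\mathbb F_n$ whose positive holomorphic sectional curvature is $\frac1{(1+2n)^2}$-pinched. 6. This constant is optimal within the family: if $s>0$ is such that $\omega_s$ has positive holomorphic sectional curvature, and this curvature is $c$-pinched, then $c\le\frac1{(1+2n)^2}$. -/

import Mathlib

open scoped Manifold ContDiff Matrix ComplexConjugate ComplexOrder

noncomputable section

/-! ### Hermitian geometry of complex manifolds in local holomorphic coordinates -/

/-- The model space `ℂᵐ`. -/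
abbrev CSpace (m : ℕ) : Type := Fin m → ℂ

/-- The Wirtinger derivative `∂f/∂z_k = (∂f/∂x_k - i ∂f/∂y_k)/2`. -/
def wirtinger {m : ℕ} (k : Fin m) (f : CSpace m → ℂ) (x : CSpace m) : ℂ :=
  (fderiv ℝ f x (Pi.single k 1) - Complex.I * fderiv ℝ f x (Pi.single k Complex.I)) / 2

/-- The conjugate Wirtinger derivative `∂f/∂z̄_k = (∂f/∂x_k + i ∂f/∂y_k)/2`. -/
def wirtingerBar {m : ℕ} (k : Fin m) (f : CSpace m → ℂ) (x : CSpace m) : ℂ :=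
  (fderiv ℝ f x (Pi.single k 1) + Complex.I * fderiv ℝ f x (Pi.single k Complex.I)) / 2

/-- The holomorphic Jacobian matrix `(∂F_a/∂z_i)`, with row index `a` and column index `i`. -/
def holJacobian {m : ℕ} (F : CSpace m → CSpace m) (x : CSpace m) : Matrix (Fin m) (Fin m) ℂ :=
  Matrix.of fun a i => fderiv ℂ F x (Pi.single i 1) a

/-- The real `2`-form `(i/2) ∑ G_{i j̄} dz_i ∧ dz̄_j` on the vector space `ℂᵐ`. The sum is real
when `G` is Hermitian; the real part only makes the definition total. -/
def fundamentalTwoForm {m : ℕ} (G : Matrix (Fin m) (Fin m) ℂ) :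
    CSpace m [⋀^Fin 2]→L[ℝ] ℝ where
  toFun v := (Complex.I / 2 *
    ∑ i, ∑ j, G i j * (v 0 i * conj (v 1 j) - v 1 i * conj (v 0 j))).re
  map_update_add' v k x y := by
    rw [← Complex.add_re, ← mul_add, ← Finset.sum_add_distrib]
    refine congrArg (fun t : ℂ => (Complex.I / 2 * t).re) ?_
    refine Finset.sum_congr rfl fun i _ => ?_
    rw [← Finset.sum_add_distrib]
    refine Finset.sum_congr rfl fun j _ => ?_
    fin_cases k <;> simp <;> ring
  map_update_smul' v k c x := by
    rw [smul_eq_mul, ← Complex.re_ofReal_mul, mul_left_comm, Finset.mul_sum _ _ (c : ℂ)]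
    refine congrArg (fun t : ℂ => (Complex.I / 2 * t).re) ?_
    refine Finset.sum_congr rfl fun i _ => ?_
    rw [Finset.mul_sum]
    refine Finset.sum_congr rfl fun j _ => ?_
    fin_cases k <;> simp <;> ring
  map_eq_zero_of_eq' v k l h hkl := by
    have h01 : v 0 = v 1 := by
      fin_cases k <;> fin_cases l <;> first | exact absurd rfl hkl | exact h | exact h.symm
    simp [h01]
  cont := by fun_prop

section Manifold

variable {m : ℕ} {M : Type*} [TopologicalSpace M] [ChartedSpace (CSpace m) M]

/-- A smooth Hermitian metric `g = ∑ g_{i j̄} dz_i ⊗ dz̄_j` on an `m`-dimensional complex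
manifold, given by its coefficient matrices `(g_{i j̄})` in the charts of the atlas, which have to
transform as a tensor of this type under changes of coordinates. (The values of `coeff φ` outside
the target of the chart `φ` carry no information.) -/
structure HermitianMetric (m : ℕ) (M : Type*) [TopologicalSpace M] [ChartedSpace (CSpace m) M]
    [IsManifold 𝓘(ℂ, CSpace m) ω M] where
  /-- The coefficient matrix in a chart, at a point of the target of the chart. -/
  coeff : atlas (CSpace m) M → CSpace m → Matrix (Fin m) (Fin m) ℂ
  smooth : ∀ (φ : atlas (CSpace m) M) (i j : Fin m),
    ContDiffOn ℝ ∞ (fun x => coeff φ x i j) φ.1.target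
  posDef : ∀ (φ : atlas (CSpace m) M), ∀ x ∈ φ.1.target, (coeff φ x).PosDef
  compat : ∀ (φ ψ : atlas (CSpace m) M), ∀ x ∈ (φ.1.symm ≫ₕ ψ.1).source,
    coeff φ x =
      (holJacobian (φ.1.symm ≫ₕ ψ.1) x)ᵀ * coeff ψ ((φ.1.symm ≫ₕ ψ.1) x) *
        (holJacobian (φ.1.symm ≫ₕ ψ.1) x).map conj

/-- A family of real `k`-forms on `ℂᵐ`, one for each chart of the atlas, as used for the local
coordinate expressions of a real `k`-form on (an open subset of) `M`. -/
abbrev ChartForm (m : ℕ) (M : Type*) [TopologicalSpace M] [ChartedSpace (CSpace m) M]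
    (k : ℕ) : Type _ :=
  atlas (CSpace m) M → CSpace m → CSpace m [⋀^Fin k]→L[ℝ] ℝ

/-- The family `η` is the family of local expressions of a smooth real `k`-form on the open
set `U`: the expressions are smooth, and each is the pullback of every other under the change of
coordinates. -/
def ChartForm.IsSmoothFormOn {k : ℕ} (η : ChartForm m M k) (U : Set M) : Prop :=
  (∀ φ : atlas (CSpace m) M, ContDiffOn ℝ ∞ (η φ) (φ.1.target ∩ φ.1.symm ⁻¹' U)) ∧
  ∀ φ ψ : atlas (CSpace m) M, ∀ x ∈ (φ.1.symm ≫ₕ ψ.1).source ∩ φ.1.symm ⁻¹' U,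
    η φ x = (η ψ ((φ.1.symm ≫ₕ ψ.1) x)).compContinuousLinearMap
      (fderiv ℝ (φ.1.symm ≫ₕ ψ.1) x)

/-- The form is `d`-closed on the whole manifold. -/
def ChartForm.IsClosedForm {k : ℕ} (η : ChartForm m M k) : Prop :=
  ∀ φ : atlas (CSpace m) M, ∀ x ∈ φ.1.target, extDeriv (η φ) x = 0

/-- The de Rham class of the closed real `2`-form `η` is rational, that is, it lies in the image of
`H²(M; ℚ) → H²(M; ℝ)`. This is expressed through the Čech–de Rham isomorphism: there are an open
cover `(U a)`, primitives `θ a` of `η` on `U a`, and smooth functions `f a b` on `U a ∩ U b` with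
`θ b - θ a = d (f a b)` such that the resulting Čech `2`-cocycle `f b c - f a c + f a b`, which
represents the class of `η`, has rational values. -/
def ChartForm.HasRationalClass (η : ChartForm m M 2) : Prop :=
  ∃ (ι : Type) (U : ι → Set M) (θ : ι → ChartForm m M 1) (f : ι → ι → M → ℝ),
    (∀ a, IsOpen (U a)) ∧ (⋃ a, U a) = Set.univ ∧
    (∀ a, (θ a).IsSmoothFormOn (U a)) ∧
    (∀ a, ∀ φ : atlas (CSpace m) M, ∀ x ∈ φ.1.target ∩ φ.1.symm ⁻¹' (U a),
      extDeriv (θ a φ) x = η φ x) ∧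
    (∀ a b, ∀ φ : atlas (CSpace m) M, ContDiffOn ℝ ∞ (f a b ∘ φ.1.symm)
      (φ.1.target ∩ φ.1.symm ⁻¹' (U a ∩ U b))) ∧
    (∀ a b, ∀ φ : atlas (CSpace m) M, ∀ x ∈ φ.1.target ∩ φ.1.symm ⁻¹' (U a ∩ U b),
      ∀ v : Fin 1 → CSpace m,
        θ b φ x v - θ a φ x v = fderiv ℝ (f a b ∘ φ.1.symm) x (v 0)) ∧
    (∀ a b c, ∀ p ∈ U a ∩ U b ∩ U c, ∃ q : ℚ, f b c p - f a c p + f a b p = q)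

namespace HermitianMetric

variable [IsManifold 𝓘(ℂ, CSpace m) ω M] (g : HermitianMetric m M)

/-- The associated `(1,1)`-form `(i/2) ∑ g_{i j̄} dz_i ∧ dz̄_j`. -/
def fundamentalForm : ChartForm m M 2 := fun φ x => fundamentalTwoForm (g.coeff φ x)

/-- The metric is Kähler: its associated `(1,1)`-form is `d`-closed. -/
def IsKahler : Prop := g.fundamentalForm.IsClosedForm

/-- The metric is Hodge: it is Kähler and the class of its associated form is rational. -/
def IsHodge : Prop := g.IsKahler ∧ g.fundamentalForm.HasRationalClass

/-- The curvature components
`R_{i j̄ k l̄} = - ∂²g_{i j̄}/∂z_k ∂z̄_l + ∑ g^{p q̄} (∂g_{i p̄}/∂z_k) (∂g_{q j̄}/∂z̄_l)`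
in a chart, where `(g^{p q̄})` is the inverse of the matrix `(g_{i j̄})`. -/
def curvature (φ : atlas (CSpace m) M) (x : CSpace m) (i j k l : Fin m) : ℂ :=
  -wirtinger k (wirtingerBar l fun y => g.coeff φ y i j) x +
    ∑ p, ∑ q, (g.coeff φ x)⁻¹ p q * wirtinger k (fun y => g.coeff φ y i p) x *
      wirtingerBar l (fun y => g.coeff φ y q j) x

/-- The holomorphic sectional curvature of the tangent vector `ξ = ∑ ξ_i ∂/∂z_i` at the point with
coordinates `x` in the chart `φ` (numerator and denominator are real). -/
def holSectCurv (φ : atlas (CSpace m) M) (x : CSpace m) (ξ : CSpace m) : ℝ :=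
  ((2 * ∑ i, ∑ j, ∑ k, ∑ l, g.curvature φ x i j k l * ξ i * conj (ξ j) * ξ k * conj (ξ l)) /
    (∑ i, ∑ j, ∑ k, ∑ l,
      g.coeff φ x i j * g.coeff φ x k l * ξ i * conj (ξ j) * ξ k * conj (ξ l))).re

/-- The set of all values of the holomorphic sectional curvature, over all non-zero tangent vectors
across the entire manifold. -/
def holSectCurvValues : Set ℝ :=
  {κ | ∃ φ : atlas (CSpace m) M, ∃ x ∈ φ.1.target, ∃ ξ : CSpace m, ξ ≠ 0 ∧
    κ = g.holSectCurv φ x ξ}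

/-- The holomorphic sectional curvature is positive. -/
def HasPosHolSectCurv : Prop := ∀ κ ∈ g.holSectCurvValues, 0 < κ

/-- The positive holomorphic sectional curvature is `c`-pinched, `c ∈ (0, 1]`: the quotient of
its (finite) infimum and supremum is `c`. -/
def IsPinched (c : ℝ) : Prop :=
  0 < c ∧ c ≤ 1 ∧ g.HasPosHolSectCurv ∧
    ∃ a b : ℝ, IsGLB g.holSectCurvValues a ∧ IsLUB g.holSectCurvValues b ∧ a / b = c

/-- The metric `c g`, for a positive real constant `c`. -/
def scale (c : ℝ) (hc : 0 < c) : HermitianMetric m M where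
  coeff φ x := (c : ℂ) • g.coeff φ x
  smooth φ i j := contDiffOn_const.mul (g.smooth φ i j)
  posDef φ x hx := (g.posDef φ x hx).smul (by exact_mod_cast hc)
  compat φ ψ x hx := by
    rw [g.compat φ ψ x hx, Matrix.mul_smul, Matrix.smul_mul]

end HermitianMetric

end Manifold

/-! ### The Hirzebruch surfaces -/

/-- Pairs of non-zero vectors `x = (x₀, x₁)`, `y = (y₀, y₁)` in `ℂ²`: homogeneous coordinates on the
base and on the fibre. -/
abbrev HirzebruchCone : Type :=
  {p : (Fin 2 → ℂ) × (Fin 2 → ℂ) // p.1 ≠ 0 ∧ p.2 ≠ 0}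

/-- The action `(λ, μ) · (x₀, x₁; y₀, y₁) = (λ x₀, λ x₁; μ y₀, λⁿ μ y₁)` of `ℂ* × ℂ*` whose orbits
are the points of the surface. -/
def hirzebruchSetoid (n : ℕ) : Setoid HirzebruchCone where
  r p q := ∃ l u : ℂˣ, (∀ i, q.1.1 i = l * p.1.1 i) ∧
    q.1.2 0 = u * p.1.2 0 ∧ q.1.2 1 = (l : ℂ) ^ n * u * p.1.2 1
  iseqv :=
    { refl := fun p => ⟨1, 1, by simp, by simp, by simp⟩
      symm := by
        rintro p q ⟨l, u, h1, h2, h3⟩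
        refine ⟨l⁻¹, u⁻¹, fun i => ?_, ?_, ?_⟩
        · rw [h1 i]; simp
        · rw [h2]; simp
        · rw [h3]
          have hl := l.ne_zero
          have hu := u.ne_zero
          have hln : (l : ℂ) ^ n ≠ 0 := pow_ne_zero _ hl
          simp only [Units.val_inv_eq_inv_val, inv_pow]
          field_simp
      trans := by
        rintro p q r ⟨l, u, h1, h2, h3⟩ ⟨l', u', h1', h2', h3'⟩
        refine ⟨l' * l, u' * u, fun i => ?_, ?_, ?_⟩
        · rw [h1' i, h1 i]; push_cast; ring
        · rw [h2', h2]; push_cast; ring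
        · rw [h3', h3]; push_cast; ring }

/-- The `n`-th Hirzebruch surface `𝔽ₙ = ℙ(𝒪(n) ⊕ 𝒪)` over `ℙ¹`, as the quotient of
`(ℂ² ∖ 0) × (ℂ² ∖ 0)` by `ℂ* × ℂ*`: the base point is `[x₀ : x₁] ∈ ℙ¹`, and over it
`y₀` is a coordinate with values in `𝒪` and `y₁` one with values in `𝒪(n)`. -/
def HirzebruchSurface (n : ℕ) : Type := Quotient (hirzebruchSetoid n)

namespace HirzebruchSurface

variable {n : ℕ}

instance : TopologicalSpace (HirzebruchSurface n) :=
  inferInstanceAs (TopologicalSpace (Quotient (hirzebruchSetoid n)))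

/-- The class of a pair of vectors. -/
def mk (n : ℕ) (p : HirzebruchCone) : HirzebruchSurface n := Quotient.mk (hirzebruchSetoid n) p

lemma isQuotientMap_mk : Topology.IsQuotientMap (mk n) := isQuotientMap_quotient_mk'

/-- The fibre coordinates in the trivialization of `𝒪(n)` over `x_i ≠ 0`, up to a common factor. -/
def fibre (n : ℕ) (i : Fin 2) (p : (Fin 2 → ℂ) × (Fin 2 → ℂ)) : Fin 2 → ℂ :=
  ![p.1 i ^ n * p.2 0, p.2 1]

/-- The coordinate functions on the open set `x_i ≠ 0`, `y_j ≠ 0`, on the level of homogeneous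
coordinates. For `j = 0` they are `z₁ = x_{1-i} / x_i` and `z₂ = y₁ / (x_iⁿ y₀)`; for `j = 1` the
fibre coordinate is `(x_iⁿ y₀) / y₁`. -/
def preCoord (n : ℕ) (i j : Fin 2) (p : (Fin 2 → ℂ) × (Fin 2 → ℂ)) : CSpace 2 :=
  ![p.1 (i + 1) / p.1 i, fibre n i p (j + 1) / fibre n i p j]

lemma preCoord_eq {i : Fin 2} (j : Fin 2) {p q : HirzebruchCone}
    (h : (hirzebruchSetoid n).r p q) : preCoord n i j p.1 = preCoord n i j q.1 := by
  obtain ⟨l, u, h1, h2, h3⟩ := h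
  have hl := l.ne_zero
  have hu := u.ne_zero
  have hf : ∀ k, fibre n i q.1 k = ((l : ℂ) ^ n * u) * fibre n i p.1 k := by
    intro k
    fin_cases k
    · simp only [fibre, Fin.zero_eta, Matrix.cons_val_zero, h1, h2]; ring
    · simp only [fibre, Fin.mk_one, Matrix.cons_val_one, h3]; simp
  have hlu : (l : ℂ) ^ n * u ≠ 0 := mul_ne_zero (pow_ne_zero _ hl) hu
  simp only [preCoord, h1, hf]
  rw [mul_div_mul_left _ _ hl, mul_div_mul_left _ _ hlu]

/-- The coordinate functions on the open set `x_i ≠ 0`, `y_j ≠ 0`. -/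
def coord (n : ℕ) (i j : Fin 2) : HirzebruchSurface n → CSpace 2 :=
  Quotient.lift (fun p : HirzebruchCone => preCoord n i j p.1) fun _ _ h => preCoord_eq j h

/-- The open set `x_i ≠ 0`, `y_j ≠ 0`. -/
def domain (n : ℕ) (i j : Fin 2) : Set (HirzebruchSurface n) :=
  {P | Quotient.lift (s := hirzebruchSetoid n)
    (fun p : HirzebruchCone => p.1.1 i ≠ 0 ∧ p.1.2 j ≠ 0)
    (by
      rintro p q ⟨l, u, h1, h2, h3⟩
      have hl := l.ne_zero
      have hu := u.ne_zero
      simp only [eq_iff_iff, h1]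
      fin_cases j <;> simp [h2, h3]) P}

lemma mk_mem_domain {i j : Fin 2} {p : HirzebruchCone} :
    mk n p ∈ domain n i j ↔ p.1.1 i ≠ 0 ∧ p.1.2 j ≠ 0 := Iff.rfl

lemma coord_mk {i j : Fin 2} {p : HirzebruchCone} :
    coord n i j (mk n p) = preCoord n i j p.1 := rfl

/-- The pair of vectors with `x_i = 1`, `x_{1-i} = z₁`, `y_j = 1`, `y_{1-j} = z₂`. -/
def preLift (i j : Fin 2) (z : CSpace 2) : (Fin 2 → ℂ) × (Fin 2 → ℂ) :=
  (fun k => if k = i then 1 else z 0, fun k => if k = j then 1 else z 1)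

/-- The same, as a point of the cone. -/
def lift (i j : Fin 2) (z : CSpace 2) : HirzebruchCone :=
  ⟨preLift i j z, fun h => by simpa [preLift] using congrFun h i,
    fun h => by simpa [preLift] using congrFun h j⟩

lemma fibre_ne_zero {i j : Fin 2} {p : (Fin 2 → ℂ) × (Fin 2 → ℂ)} (hi : p.1 i ≠ 0)
    (hj : p.2 j ≠ 0) : fibre n i p j ≠ 0 := by
  fin_cases j
  · exact mul_ne_zero (pow_ne_zero _ hi) hj
  · exact hj

lemma isOpen_domain (i j : Fin 2) : IsOpen (domain n i j) := by
  rw [← isQuotientMap_mk.isOpen_preimage]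
  have h1 : Continuous fun p : HirzebruchCone => p.1.1 i := by fun_prop
  have h2 : Continuous fun p : HirzebruchCone => p.1.2 j := by fun_prop
  exact (isOpen_ne_fun h1 continuous_const).inter (isOpen_ne_fun h2 continuous_const)

lemma continuous_lift (i j : Fin 2) : Continuous (lift i j) := by
  refine Continuous.subtype_mk (Continuous.prodMk ?_ ?_) _
  · refine continuous_pi fun k => ?_
    by_cases h : k = i <;> simp only [h, if_true, if_false] <;> fun_prop
  · refine continuous_pi fun k => ?_
    by_cases h : k = j <;> simp only [h, if_true, if_false] <;> fun_prop

lemma continuousOn_coord (i j : Fin 2) : ContinuousOn (coord n i j) (domain n i j) := by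
  rw [isQuotientMap_mk.continuousOn_isOpen_iff (isOpen_domain i j)]
  have hx : ∀ k, Continuous fun p : HirzebruchCone => p.1.1 k := fun k => by fun_prop
  have hf : ∀ k, Continuous fun p : HirzebruchCone => fibre n i p.1 k := by
    intro k
    fin_cases k
    · change Continuous fun p : HirzebruchCone => p.1.1 i ^ n * p.1.2 0
      fun_prop
    · change Continuous fun p : HirzebruchCone => p.1.2 1
      fun_prop
  change ContinuousOn (fun p : HirzebruchCone => preCoord n i j p.1) _
  refine continuousOn_pi.2 fun k => ?_
  fin_cases k
  · exact (hx (i + 1)).continuousOn.div (hx i).continuousOn fun p hp => hp.1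
  · exact (hf (j + 1)).continuousOn.div (hf j).continuousOn fun p hp => fibre_ne_zero hp.1 hp.2

lemma lift_mem_domain (i j : Fin 2) (z : CSpace 2) : mk n (lift i j z) ∈ domain n i j := by
  rw [mk_mem_domain]
  simp [lift, preLift]

lemma coord_lift (i j : Fin 2) (z : CSpace 2) : coord n i j (mk n (lift i j z)) = z := by
  rw [coord_mk]
  funext k
  fin_cases i <;> fin_cases j <;> fin_cases k <;> simp [lift, preLift, preCoord, fibre]

lemma lift_coord (i j : Fin 2) {P : HirzebruchSurface n} (hP : P ∈ domain n i j) :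
    mk n (lift i j (coord n i j P)) = P := by
  obtain ⟨p, rfl⟩ := isQuotientMap_mk.surjective P
  obtain ⟨hi, hj⟩ := mk_mem_domain.1 hP
  refine Quotient.sound (s := hirzebruchSetoid n) ?_
  rw [coord_mk]
  have hin : p.1.1 i ^ n ≠ 0 := pow_ne_zero _ hi
  by_cases hj0 : j = 0
  · subst hj0
    refine ⟨Units.mk0 _ hi, Units.mk0 _ hj, fun k => ?_, ?_, ?_⟩
    · fin_cases i <;> fin_cases k <;> simp [lift, preLift, preCoord] <;>
        exact (mul_div_cancel₀ _ hi).symm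
    · simp [lift, preLift]
    · simp [lift, preLift, preCoord, fibre]
      field_simp
  · obtain rfl : j = 1 := by omega
    refine ⟨Units.mk0 _ hi, Units.mk0 (p.1.2 1 / p.1.1 i ^ n) (div_ne_zero hj hin), fun k => ?_,
      ?_, ?_⟩
    · fin_cases i <;> fin_cases k <;> simp [lift, preLift, preCoord] <;>
        exact (mul_div_cancel₀ _ hi).symm
    · simp [lift, preLift, preCoord, fibre]
      field_simp
    · simp [lift, preLift]
      field_simp

/-- The holomorphic chart on the open set `x_i ≠ 0`, `y_j ≠ 0`, with values in all of `ℂ²`. -/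
def chart (n : ℕ) (i j : Fin 2) : OpenPartialHomeomorph (HirzebruchSurface n) (CSpace 2) where
  toFun := coord n i j
  invFun z := mk n (lift i j z)
  source := domain n i j
  target := Set.univ
  map_source' _ _ := Set.mem_univ _
  map_target' z _ := lift_mem_domain i j z
  left_inv' _ hP := lift_coord i j hP
  right_inv' z _ := coord_lift i j z
  open_source := isOpen_domain i j
  open_target := isOpen_univ
  continuousOn_toFun := continuousOn_coord i j
  continuousOn_invFun := (isQuotientMap_mk.continuous.comp (continuous_lift i j)).continuousOn

lemma exists_mem_domain (P : HirzebruchSurface n) : ∃ ij : Fin 2 × Fin 2, P ∈ domain n ij.1 ij.2 := by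
  obtain ⟨p, rfl⟩ := isQuotientMap_mk.surjective P
  obtain ⟨i, hi⟩ := Function.ne_iff.1 p.2.1
  obtain ⟨j, hj⟩ := Function.ne_iff.1 p.2.2
  exact ⟨(i, j), mk_mem_domain.2 ⟨hi, hj⟩⟩

/-- The atlas consisting of the four standard charts. -/
instance : ChartedSpace (CSpace 2) (HirzebruchSurface n) where
  atlas := Set.range fun ij : Fin 2 × Fin 2 => chart n ij.1 ij.2
  chartAt P := chart n (exists_mem_domain P).choose.1 (exists_mem_domain P).choose.2
  mem_chart_source P := (exists_mem_domain P).choose_spec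
  chart_mem_atlas P := ⟨(exists_mem_domain P).choose, rfl⟩

/-- The changes of coordinates are holomorphic. -/
instance : IsManifold 𝓘(ℂ, CSpace 2) ω (HirzebruchSurface n) := by
  refine isManifold_of_contDiffOn _ _ _ ?_
  rintro _ _ ⟨⟨i, j⟩, rfl⟩ ⟨⟨i', j'⟩, rfl⟩
  have hx : ∀ k, ContDiff ℂ ω fun z : CSpace 2 => (preLift i j z).1 k := by
    intro k
    by_cases h : k = i <;> simp only [preLift, h, if_true, if_false] <;> fun_prop
  have hy : ∀ k, ContDiff ℂ ω fun z : CSpace 2 => (preLift i j z).2 k := by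
    intro k
    by_cases h : k = j <;> simp only [preLift, h, if_true, if_false] <;> fun_prop
  have hf : ∀ k, ContDiff ℂ ω fun z : CSpace 2 => fibre n i' (preLift i j z) k := by
    intro k
    fin_cases k
    · exact ((hx i').pow n).mul (hy 0)
    · exact hy 1
  have key : ContDiffOn ℂ ω (fun z : CSpace 2 => preCoord n i' j' (preLift i j z))
      {z | (preLift i j z).1 i' ≠ 0 ∧ (preLift i j z).2 j' ≠ 0} := by
    refine contDiffOn_pi.2 fun k => ?_
    fin_cases k
    · exact (hx (i' + 1)).contDiffOn.div (hx i').contDiffOn fun z hz => hz.1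
    · exact (hf (j' + 1)).contDiffOn.div (hf j').contDiffOn
        fun z hz => fibre_ne_zero hz.1 hz.2
  refine key.mono fun z hz => ?_
  exact (mk_mem_domain (n := n) (p := lift i j z)).1 hz.1.2

/-- The chart with coordinates `z₁ = x₁ / x₀` and `z₂ = y₁ / (x₀ⁿ y₀)`. -/
def mainChart (n : ℕ) : atlas (CSpace 2) (HirzebruchSurface n) := ⟨chart n 0 0, (0, 0), rfl⟩

end HirzebruchSurface

/-! ### Hitchin's metrics -/

/-- The local potential `log (1 + |z₁|²) + s log ((1 + |z₁|²)ⁿ + |z₂|²)`. -/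
def hitchinPotential (n : ℕ) (s : ℝ) (z : CSpace 2) : ℝ :=
  Real.log (1 + ‖z 0‖ ^ 2) + s * Real.log ((1 + ‖z 0‖ ^ 2) ^ n + ‖z 1‖ ^ 2)

/-- The Hermitian metric `g` on `𝔽ₙ` is Hitchin's metric with parameter `s`: in the coordinates
`(z₁, z₂)` its associated form is `(i/2) ∂∂̄` of the potential, that is, its coefficients are
`g_{i j̄} = ∂²/∂z_i ∂z̄_j` of the potential. As the domain of these coordinates is dense, this
determines the metric on all of `𝔽ₙ`. -/
def IsHitchinMetric (n : ℕ) (s : ℝ) (g : HermitianMetric 2 (HirzebruchSurface n)) : Prop :=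
  ∀ (z : CSpace 2) (i j : Fin 2), g.coeff (HirzebruchSurface.mainChart n) z i j =
    wirtinger i (wirtingerBar j fun w => (hitchinPotential n s w : ℂ)) z

end

/-! In homogeneous coordinates the potential is log |x|² + s log(|x|²ⁿ|y₀|² + |y₁|²). Passing to
another chart changes it by terms log |k|² with `k` holomorphic without zeros. These are
pluriharmonic, so the complex Hessians glue to one tensor (`levi_chartPot_compat`). It is positive
by completing a square (`posDef_hitchinMatrix`) and Kähler because its form is locally exact
(`extDeriv_dcForm`). Points with z₁z₂ ≠ 0 are dense in every chart and lie in the main chart, so the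
metric is determined by its coefficients there (`IsHitchinMetric.eq_hitchinMetric`).

For the curvature, unitary maps of the base coordinates preserve the potential up to pluriharmonic
terms and move any point into the fibre over z₁ = 0 (`exists_matHolSectCurv_centre`). There the
metric is diagonal and K depends only on three real numbers: t = |y₀|²/(|y₀|² + |y₁|²), which lies
in [0, 1], u = |ξ₁|², and the fibre part b of the squared length of ξ (`hitchinCurv`,
`matHolSectCurv_centre`). The difference between K and the claimed minimum is a positive multiple of
a square plus a remainder proportional to t. This remainder is non-negative when sn² ≤ 1
(`hitchinCurv_sub`, `discriminant_nonneg`), and both terms vanish for suitable vectors at t = 0, on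
the section z₂ = ∞. The difference between 4/s and K has no b² term and non-negative coefficients
(`hitchinCurv_le`), and vertical vectors give equality. The value claimed as minimum is attained for
every s > 0, so positivity forces sn² < 1. The quotient of the two extrema is 1/(1+2n)² minus a
square that vanishes exactly at s = 1/(2n²+n) (`pinching_quotient`), which gives both the pinching
and its optimality.

For the Hodge property, let k be the transition functions of the line bundles that x and y come
from. If A is a branch of arg k, then (i/4)(∂̄ - ∂) log |k|² = dA/2 (`dcForm_log_norm_sq`). After
division by π, local primitives of the form therefore differ by differentials of -(A + sB)/2π, with
A and B branches of the arguments of the two kinds of transition functions. Arguments satisfy the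
cocycle identity up to 2πℤ, so the Čech cocycle takes values in ℤ + sℤ, which is rational for
rational s. -/

noncomputable section

open Filter Topology HirzebruchSurface

/-! ### Calculus of Wirtinger derivatives. -/

section Wirtinger

variable {m : ℕ}

/-- The real-linear form `v ↦ ∑ (a_k v_k + b_k v̄_k)`. -/
def wirtingerForm (a b : CSpace m) : CSpace m →L[ℝ] ℂ :=
  ∑ k, (a k • (ContinuousLinearMap.proj (R := ℝ) (φ := fun _ : Fin m => ℂ) k) +
    b k • (Complex.conjCLE : ℂ →L[ℝ] ℂ) ∘L
      (ContinuousLinearMap.proj (R := ℝ) (φ := fun _ : Fin m => ℂ) k))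

lemma wirtingerForm_apply (a b v : CSpace m) :
    wirtingerForm a b v = ∑ k, (a k * v k + b k * conj (v k)) := by
  simp [wirtingerForm]

/-- The differential of `f` at `x` is `∑ (a_k dz_k + b_k dz̄_k)`. -/
def HasWirtingerAt (f : CSpace m → ℂ) (a b : CSpace m) (x : CSpace m) : Prop :=
  HasFDerivAt f (wirtingerForm a b) x

lemma HasFDerivAt.hasWirtingerAt {f : CSpace m → ℂ} {f' : CSpace m →L[ℝ] ℂ} {a b x : CSpace m}
    (h : HasFDerivAt f f' x) (h' : ∀ v, f' v = ∑ k, (a k * v k + b k * conj (v k))) :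
    HasWirtingerAt f a b x :=
  h.congr_fderiv (by ext v; rw [h', wirtingerForm_apply])

namespace HasWirtingerAt

variable {f g : CSpace m → ℂ} {a b a' b' x : CSpace m}

lemma fderiv_apply (h : HasWirtingerAt f a b x) (v : CSpace m) :
    fderiv ℝ f x v = ∑ k, (a k * v k + b k * conj (v k)) := by
  rw [HasFDerivAt.fderiv h, wirtingerForm_apply]

lemma wirtinger_eq (h : HasWirtingerAt f a b x) (k : Fin m) : wirtinger k f x = a k := by
  simp only [wirtinger, h.fderiv_apply]
  rw [Finset.sum_eq_single k, Finset.sum_eq_single k]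
  · simp
    linear_combination (a k - b k) * (-1 / 2) * Complex.I_sq
  all_goals simp +contextual

lemma wirtingerBar_eq (h : HasWirtingerAt f a b x) (k : Fin m) : wirtingerBar k f x = b k := by
  simp only [wirtingerBar, h.fderiv_apply]
  rw [Finset.sum_eq_single k, Finset.sum_eq_single k]
  · simp
    linear_combination (a k - b k) * (1 / 2) * Complex.I_sq
  all_goals simp +contextual

lemma congr_coeff (h : HasWirtingerAt f a b x) (ha : ∀ k, a k = a' k) (hb : ∀ k, b k = b' k) :
    HasWirtingerAt f a' b' x := by
  rwa [← funext ha, ← funext hb]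

lemma congr_of_eventuallyEq (h : HasWirtingerAt f a b x) (hg : g =ᶠ[𝓝 x] f) :
    HasWirtingerAt g a b x :=
  HasFDerivAt.congr_of_eventuallyEq h hg

lemma const (c : ℂ) : HasWirtingerAt (fun _ : CSpace m => c) 0 0 x :=
  (hasFDerivAt_const c x).hasWirtingerAt (by simp)

lemma coord (k : Fin m) : HasWirtingerAt (fun z : CSpace m => z k) (Pi.single k 1) 0 x :=
  (ContinuousLinearMap.proj (R := ℝ) (φ := fun _ : Fin m => ℂ) k).hasFDerivAt.hasWirtingerAt
    (by simp [Pi.single_apply])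

lemma add (hf : HasWirtingerAt f a b x) (hg : HasWirtingerAt g a' b' x) :
    HasWirtingerAt (fun z => f z + g z) (a + a') (b + b') x :=
  (HasFDerivAt.add hf hg).hasWirtingerAt fun v => by
    simp only [add_apply, wirtingerForm_apply, ← Finset.sum_add_distrib]
    exact Finset.sum_congr rfl fun k _ => by simp only [Pi.add_apply]; ring

lemma mul (hf : HasWirtingerAt f a b x) (hg : HasWirtingerAt g a' b' x) :
    HasWirtingerAt (fun z => f z * g z) (f x • a' + g x • a) (f x • b' + g x • b) x :=
  (HasFDerivAt.mul hf hg).hasWirtingerAt fun v => by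
    simp only [add_apply, smul_apply, wirtingerForm_apply,
      smul_eq_mul, Finset.mul_sum, ← Finset.sum_add_distrib]
    exact Finset.sum_congr rfl fun k _ => by
      simp only [Pi.add_apply, Pi.smul_apply, smul_eq_mul]; ring

lemma const_mul (c : ℂ) (hf : HasWirtingerAt f a b x) :
    HasWirtingerAt (fun z => c * f z) (c • a) (c • b) x := by
  simpa using (const c).mul hf

lemma sum {ι : Type*} {s : Finset ι} {F : ι → CSpace m → ℂ} {A B : ι → CSpace m}
    (h : ∀ i ∈ s, HasWirtingerAt (F i) (A i) (B i) x) :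
    HasWirtingerAt (fun z => ∑ i ∈ s, F i z) (∑ i ∈ s, A i) (∑ i ∈ s, B i) x := by
  classical
  induction s using Finset.induction_on with
  | empty => simpa using const (x := x) 0
  | insert i s hi ih =>
    simp only [Finset.sum_insert hi]
    exact (h i (by simp)).add (ih fun j hj => h j (by simp [hj]))

/-- The chain rule for an outer holomorphic function of one variable. -/
lemma comp_hasDerivAt {φ : ℂ → ℂ} {c : ℂ} (hφ : HasDerivAt φ c (f x))
    (hf : HasWirtingerAt f a b x) : HasWirtingerAt (fun z => φ (f z)) (c • a) (c • b) x := by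
  have h := (hφ.hasFDerivAt.restrictScalars ℝ).comp x hf
  refine HasFDerivAt.hasWirtingerAt h fun v => ?_
  simp only [ContinuousLinearMap.comp_apply, wirtingerForm_apply]
  simp only [ContinuousLinearMap.coe_restrictScalars', ContinuousLinearMap.toSpanSingleton_apply,
    smul_eq_mul, Finset.sum_mul]
  exact Finset.sum_congr rfl fun k _ => by simp only [Pi.smul_apply, smul_eq_mul]; ring

lemma inv (hf : HasWirtingerAt f a b x) (h0 : f x ≠ 0) :
    HasWirtingerAt (fun z => (f z)⁻¹) (-(f x ^ 2)⁻¹ • a) (-(f x ^ 2)⁻¹ • b) x :=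
  comp_hasDerivAt (hasDerivAt_inv h0) hf

lemma pow (hf : HasWirtingerAt f a b x) (n : ℕ) :
    HasWirtingerAt (fun z => f z ^ n) ((n * f x ^ (n - 1)) • a) ((n * f x ^ (n - 1)) • b) x :=
  comp_hasDerivAt (hasDerivAt_pow n (f x)) hf

lemma conj_comp (hf : HasWirtingerAt f a b x) :
    HasWirtingerAt (fun z => conj (f z)) (fun k => conj (b k)) (fun k => conj (a k)) x := by
  have h := (Complex.conjCLE : ℂ →L[ℝ] ℂ).hasFDerivAt.comp x hf
  refine HasFDerivAt.hasWirtingerAt h fun v => ?_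
  simp only [ContinuousLinearMap.comp_apply, wirtingerForm_apply]
  simp only [ContinuousLinearEquiv.coe_coe, Complex.conjCLE_apply, map_sum, map_add, map_mul,
    Complex.conj_conj]
  exact Finset.sum_congr rfl fun k _ => by ring

/-- The logarithm of a positive real function. -/
lemma log_ofReal {u : CSpace m → ℝ} (hu : HasWirtingerAt (fun z => (u z : ℂ)) a b x)
    (h0 : 0 < u x) :
    HasWirtingerAt (fun z => (Real.log (u z) : ℂ)) ((u x : ℂ)⁻¹ • a) ((u x : ℂ)⁻¹ • b) x := by
  have h := comp_hasDerivAt (f := fun z => (u z : ℂ))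
    (Complex.hasDerivAt_log (Complex.ofReal_mem_slitPlane.2 h0)) hu
  -- The real logarithm agrees with the complex one only where `u` is non-negative; by continuity
  -- this holds near `x`.
  refine h.congr_of_eventuallyEq ?_
  have hc : ContinuousAt u x := by
    have := Complex.continuous_re.continuousAt.comp (HasFDerivAt.continuousAt hu)
    simpa [Function.comp_def] using this
  filter_upwards [hc.eventually (lt_mem_nhds h0)] with z hz
  exact Complex.ofReal_log hz.le

/-- The chain rule for an inner holomorphic map. -/
lemma comp_holomorphic {l : ℕ} {f : CSpace l → ℂ} {a b : CSpace l} {τ : CSpace m → CSpace l}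
    {τ' : CSpace m →L[ℂ] CSpace l} (hτ : HasFDerivAt τ τ' x) (hf : HasWirtingerAt f a b (τ x)) :
    HasWirtingerAt (fun z => f (τ z)) (fun i => ∑ c, a c * τ' (Pi.single i 1) c)
      (fun i => ∑ c, b c * conj (τ' (Pi.single i 1) c)) x := by
  refine (HasFDerivAt.comp x hf (hτ.restrictScalars ℝ)).hasWirtingerAt fun v => ?_
  have hv : ∀ c, τ' v c = ∑ i, v i * τ' (Pi.single i 1) c := fun c => by
    conv_lhs => rw [pi_eq_sum_univ' v, map_sum, Finset.sum_apply]
    exact Finset.sum_congr rfl fun i _ => by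
      rw [map_smul, Pi.smul_apply, smul_eq_mul]
  simp only [ContinuousLinearMap.comp_apply, wirtingerForm_apply,
    ContinuousLinearMap.coe_restrictScalars', hv, map_sum, map_mul, Finset.sum_add_distrib,
    Finset.mul_sum, Finset.sum_mul]
  congr 1 <;> rw [Finset.sum_comm] <;>
    exact Finset.sum_congr rfl fun i _ => Finset.sum_congr rfl fun c _ => by ring

end HasWirtingerAt

/-- A real-linear map is the sum of a complex-linear and a conjugate-linear one, whose coefficients
can be read off from the values on the real basis `Pi.single k 1`, `Pi.single k Complex.I`. -/
lemma DifferentiableAt.hasWirtingerAt {f : CSpace m → ℂ} {x : CSpace m}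
    (h : DifferentiableAt ℝ f x) :
    HasWirtingerAt f (fun k => wirtinger k f x) (fun k => wirtingerBar k f x) x := by
  refine h.hasFDerivAt.hasWirtingerAt fun v => ?_
  have hv : v = ∑ k, ((v k).re • (Pi.single k 1 : CSpace m) + (v k).im • (Pi.single k Complex.I : CSpace m)) := by
    ext j
    simp [Finset.sum_apply, Pi.single_apply, Finset.sum_add_distrib, Complex.re_add_im]
  conv_lhs => rw [hv, map_sum]
  refine Finset.sum_congr rfl fun k _ => ?_
  rw [map_add, map_smul, map_smul]
  have h1 : conj (v k) = (v k).re - (v k).im * Complex.I := by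
    apply Complex.ext <;> simp
  rw [h1]
  conv_rhs => rw [← Complex.re_add_im (v k)]
  simp only [wirtinger, wirtingerBar, Complex.real_smul, Complex.add_re, Complex.ofReal_re,
    Complex.mul_re, Complex.I_re, Complex.ofReal_im, Complex.I_im, Complex.add_im, Complex.mul_im]
  push_cast
  linear_combination
    (fderiv ℝ f x (Pi.single k Complex.I)) * (v k).im * Complex.I_sq

/-- A holomorphic function has vanishing conjugate Wirtinger derivatives. -/
lemma HasFDerivAt.hasWirtingerAt_complex {f : CSpace m → ℂ} {f' : CSpace m →L[ℂ] ℂ}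
    {x : CSpace m} (h : HasFDerivAt f f' x) :
    HasWirtingerAt f (fun k => f' (Pi.single k 1)) 0 x := by
  refine (h.restrictScalars ℝ).hasWirtingerAt fun v => ?_
  have hv : v = ∑ k, v k • (Pi.single k 1 : CSpace m) := by
    ext j
    simp [Finset.sum_apply, Pi.single_apply]
  conv_lhs => rw [hv]
  simp [mul_comm]

end Wirtinger

/-! ### The complex Hessian and holomorphic changes of coordinates. -/

section Levi

variable {m : ℕ}

lemma HasWirtingerAt.of_contDiffAt {f : CSpace m → ℂ} {x : CSpace m} (h : ContDiffAt ℝ ∞ f x) :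
    HasWirtingerAt f (fun k => wirtinger k f x) (fun k => wirtingerBar k f x) x :=
  (h.differentiableAt (by simp)).hasWirtingerAt

lemma contDiffAt_wirtinger {f : CSpace m → ℂ} {x : CSpace m} (h : ContDiffAt ℝ ∞ f x)
    (k : Fin m) : ContDiffAt ℝ ∞ (wirtinger k f) x := by
  have h' : ContDiffAt ℝ ∞ (fderiv ℝ f) x := h.fderiv_right (by simp)
  unfold wirtinger
  fun_prop

lemma contDiffAt_wirtingerBar {f : CSpace m → ℂ} {x : CSpace m} (h : ContDiffAt ℝ ∞ f x)
    (k : Fin m) : ContDiffAt ℝ ∞ (wirtingerBar k f) x := by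
  have h' : ContDiffAt ℝ ∞ (fderiv ℝ f) x := h.fderiv_right (by simp)
  unfold wirtingerBar
  fun_prop

lemma Filter.EventuallyEq.wirtinger_eq {f g : CSpace m → ℂ} {x : CSpace m} (h : f =ᶠ[𝓝 x] g)
    (k : Fin m) : wirtinger k f x = wirtinger k g x := by
  simp only [wirtinger, h.fderiv_eq]

lemma Filter.EventuallyEq.wirtingerBar {f g : CSpace m → ℂ} {x : CSpace m} (h : f =ᶠ[𝓝 x] g)
    (k : Fin m) : wirtingerBar k f =ᶠ[𝓝 x] wirtingerBar k g := by
  filter_upwards [h.fderiv (𝕜 := ℝ)] with y hy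
  simp only [_root_.wirtingerBar, hy]

/-- The complex Hessian `(∂²f/∂z_i∂z̄_j)`. -/
def levi (f : CSpace m → ℝ) (x : CSpace m) : Matrix (Fin m) (Fin m) ℂ :=
  Matrix.of fun i j => wirtinger i (wirtingerBar j fun w => (f w : ℂ)) x

lemma levi_apply (f : CSpace m → ℝ) (x : CSpace m) (i j : Fin m) :
    levi f x i j = wirtinger i (wirtingerBar j fun w => (f w : ℂ)) x := rfl

lemma ContDiffAt.ofReal_comp {E : Type*} [NormedAddCommGroup E] [NormedSpace ℝ E] {f : E → ℝ}
    {x : E} {n : WithTop ℕ∞} (h : ContDiffAt ℝ n f x) :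
    ContDiffAt ℝ n (fun y => (f y : ℂ)) x :=
  Complex.ofRealCLM.contDiff.contDiffAt.comp x h

lemma contDiffAt_levi {f : CSpace m → ℝ} {x : CSpace m} (h : ContDiffAt ℝ ∞ f x) (i j : Fin m) :
    ContDiffAt ℝ ∞ (fun y => levi f y i j) x :=
  contDiffAt_wirtinger (contDiffAt_wirtingerBar h.ofReal_comp j) i

lemma levi_congr {f g : CSpace m → ℝ} {x : CSpace m} (h : f =ᶠ[𝓝 x] g) : levi f x = levi g x := by
  ext i j
  have h' : (fun y => (f y : ℂ)) =ᶠ[𝓝 x] fun y => (g y : ℂ) := h.fun_comp (fun t : ℝ => (t : ℂ))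
  exact (h'.wirtingerBar j).wirtinger_eq i

/-- Smoothness of order ∞ at a point only gives, for each finite order, a neighbourhood depending on
that order. Hence the finite `N`. -/
lemma ContDiffAt.eventually_smooth {E F : Type*} [NormedAddCommGroup E] [NormedSpace ℝ E]
    [NormedAddCommGroup F] [NormedSpace ℝ F] {f : E → F} {x : E} {N : ℕ}
    (h : ContDiffAt ℝ ∞ f x) : ∀ᶠ y in 𝓝 x, ContDiffAt ℝ N f y :=
  (h.of_le (by exact_mod_cast le_top)).eventually (by simp)

lemma levi_add {f g : CSpace m → ℝ} {x : CSpace m} (hf : ContDiffAt ℝ ∞ f x)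
    (hg : ContDiffAt ℝ ∞ g x) : levi (fun y => f y + g y) x = levi f x + levi g x := by
  ext i j
  have h1 : (wirtingerBar j fun w => ((f w + g w : ℝ) : ℂ)) =ᶠ[𝓝 x]
      fun y => wirtingerBar j (fun w => (f w : ℂ)) y + wirtingerBar j (fun w => (g w : ℂ)) y := by
    filter_upwards [hf.eventually_smooth (N := 1), hg.eventually_smooth (N := 1)] with y hy hy'
    have h := ((hy.ofReal_comp.differentiableAt (by simp)).hasWirtingerAt).add
      ((hy'.ofReal_comp.differentiableAt (by simp)).hasWirtingerAt)
    simpa using h.wirtingerBar_eq j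
  rw [levi_apply, h1.wirtinger_eq, (HasWirtingerAt.of_contDiffAt
    (contDiffAt_wirtingerBar hf.ofReal_comp j)).add (HasWirtingerAt.of_contDiffAt
    (contDiffAt_wirtingerBar hg.ofReal_comp j)) |>.wirtinger_eq]
  rfl

/-- No differentiability is required: scaling by a field element commutes with `fderiv` even at
points where `fderiv` takes its default value 0. -/
lemma wirtinger_const_mul (c : ℂ) (f : CSpace m → ℂ) (x : CSpace m) (k : Fin m) :
    wirtinger k (fun y => c * f y) x = c * wirtinger k f x := by
  have : fderiv ℝ (fun y => c * f y) x = c • fderiv ℝ f x :=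
    congrFun (fderiv_const_smul_field (𝕜 := ℝ) (f := f) c) x
  simp only [wirtinger, this, smul_apply, smul_eq_mul]
  ring

lemma wirtingerBar_const_mul (c : ℂ) (f : CSpace m → ℂ) (x : CSpace m) (k : Fin m) :
    wirtingerBar k (fun y => c * f y) x = c * wirtingerBar k f x := by
  have : fderiv ℝ (fun y => c * f y) x = c • fderiv ℝ f x :=
    congrFun (fderiv_const_smul_field (𝕜 := ℝ) (f := f) c) x
  simp only [wirtingerBar, this, smul_apply, smul_eq_mul]
  ring

lemma levi_const_mul (c : ℝ) (f : CSpace m → ℝ) (x : CSpace m) :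
    levi (fun y => c * f y) x = (c : ℂ) • levi f x := by
  ext i j
  simp only [levi_apply, Matrix.smul_apply, smul_eq_mul, Complex.ofReal_mul]
  rw [← wirtinger_const_mul]
  congr 1
  ext y
  exact wirtingerBar_const_mul _ _ _ _

lemma holJacobian_apply {τ : CSpace m → CSpace m} {x : CSpace m} (a i : Fin m) :
    holJacobian τ x a i = fderiv ℂ τ x (Pi.single i 1) a := rfl

/-- The Jacobian entries of a holomorphic map are holomorphic. -/
lemma contDiffAt_holJacobian {τ : CSpace m → CSpace m} {x : CSpace m} (h : ContDiffAt ℂ ω τ x)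
    (a i : Fin m) : ContDiffAt ℂ ω (fun y => holJacobian τ y a i) x := by
  have h' : ContDiffAt ℂ ω (fderiv ℂ τ) x := h.fderiv_right (by simp)
  exact contDiffAt_pi.1 (h'.clm_apply contDiffAt_const) a

lemma HasWirtingerAt.of_holomorphic {f : CSpace m → ℂ} {x : CSpace m} (h : ContDiffAt ℂ ω f x) :
    HasWirtingerAt f (fun k => fderiv ℂ f x (Pi.single k 1)) 0 x :=
  (h.differentiableAt (by simp)).hasFDerivAt.hasWirtingerAt_complex

lemma wirtingerBar_comp_holomorphic {f : CSpace m → ℂ} {τ : CSpace m → CSpace m} {x : CSpace m}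
    (hτ : DifferentiableAt ℂ τ x) (hf : DifferentiableAt ℝ f (τ x)) (j : Fin m) :
    wirtingerBar j (fun y => f (τ y)) x =
      ∑ b, wirtingerBar b f (τ x) * conj (holJacobian τ x b j) :=
  (hf.hasWirtingerAt.comp_holomorphic hτ.hasFDerivAt).wirtingerBar_eq j

lemma wirtinger_comp_holomorphic {f : CSpace m → ℂ} {τ : CSpace m → CSpace m} {x : CSpace m}
    (hτ : DifferentiableAt ℂ τ x) (hf : DifferentiableAt ℝ f (τ x)) (j : Fin m) :
    wirtinger j (fun y => f (τ y)) x = ∑ b, wirtinger b f (τ x) * holJacobian τ x b j :=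
  (hf.hasWirtingerAt.comp_holomorphic hτ.hasFDerivAt).wirtinger_eq j

/-- No second derivatives of `τ` appear: the chain rule for ∂̄ produces conjugates of Jacobian
entries, and these are antiholomorphic, hence constants for ∂. -/
lemma levi_comp_holomorphic {f : CSpace m → ℝ} {τ : CSpace m → CSpace m} {x : CSpace m}
    (hτ : ContDiffAt ℂ ω τ x) (hf : ContDiffAt ℝ ∞ f (τ x)) :
    levi (fun y => f (τ y)) x =
      (holJacobian τ x)ᵀ * levi f (τ x) * (holJacobian τ x).map conj := by
  ext i j
  have h1 : (wirtingerBar j fun w => (f (τ w) : ℂ)) =ᶠ[𝓝 x]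
      fun y => ∑ b, wirtingerBar b (fun w => (f w : ℂ)) (τ y) * conj (holJacobian τ y b j) := by
    filter_upwards [hτ.continuousAt.eventually (hf.eventually_smooth (N := 1)),
      hτ.eventually (by simp)] with y hy hy'
    exact wirtingerBar_comp_holomorphic (f := fun w => (f w : ℂ))
      (hy'.differentiableAt (by simp)) (hy.ofReal_comp.differentiableAt (by simp)) j
  have h2 := HasWirtingerAt.sum (s := Finset.univ) (x := x) fun (b : Fin m) _ =>
    ((HasWirtingerAt.of_contDiffAt (contDiffAt_wirtingerBar hf.ofReal_comp b)).comp_holomorphic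
      (hτ.differentiableAt (by simp)).hasFDerivAt).mul
      (HasWirtingerAt.of_holomorphic (contDiffAt_holJacobian hτ b j)).conj_comp
  rw [levi_apply, h1.wirtinger_eq, h2.wirtinger_eq]
  simp only [Finset.sum_apply, Matrix.mul_apply, Matrix.transpose_apply, Matrix.map_apply]
  refine Finset.sum_congr rfl fun b _ => ?_
  simp only [Pi.add_apply, Pi.smul_apply, smul_eq_mul, Pi.zero_apply, map_zero, mul_zero, zero_add]
  rw [mul_comm]
  congr 1
  exact Finset.sum_congr rfl fun a _ => mul_comm _ _

lemma ContDiffAt.log_norm_sq {k : CSpace m → ℂ} {x : CSpace m} (hk : ContDiffAt ℂ ω k x)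
    (h0 : k x ≠ 0) : ContDiffAt ℝ ∞ (fun y => Real.log (‖k y‖ ^ 2)) x := by
  have h : ContDiffAt ℝ ∞ k x := (hk.restrict_scalars ℝ).of_le le_top
  exact ((h.norm_sq ℝ)).log (by simpa using h0)

/-- `log |k|²` is pluriharmonic for a holomorphic function `k` without zeros. -/
lemma levi_log_norm_sq {k : CSpace m → ℂ} {x : CSpace m} (hk : ContDiffAt ℂ ω k x)
    (h0 : k x ≠ 0) : levi (fun y => Real.log (‖k y‖ ^ 2)) x = 0 := by
  ext i j
  -- Since log |k|² is locally log k plus its conjugate, its ∂̄-derivative is the conjugate of the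
  -- holomorphic function k⁻¹ ∂k/∂z_j, which ∂ annihilates.
  have h1 : (wirtingerBar j fun w => (Real.log (‖k w‖ ^ 2) : ℂ)) =ᶠ[𝓝 x]
      fun y => conj (fderiv ℂ k y (Pi.single j 1) * (k y)⁻¹) := by
    filter_upwards [hk.continuousAt.eventually (isOpen_ne.mem_nhds h0),
      hk.eventually (by simp)] with y hy hy'
    have hw := HasWirtingerAt.of_holomorphic hy'
    have hsq : HasWirtingerAt (fun z => ((‖k z‖ ^ 2 : ℝ) : ℂ)) _ _ y :=
      (hw.mul hw.conj_comp).congr_of_eventuallyEq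
        (Eventually.of_forall fun z => by simp [Complex.mul_conj'])
    rw [(hsq.log_ofReal (by positivity)).wirtingerBar_eq]
    have : (‖k y‖ ^ 2 : ℂ) = k y * conj (k y) := by rw [Complex.mul_conj']
    have hc : conj (k y) ≠ 0 := by simpa using hy
    simp
    rw [this]
    field_simp
  have h2 : ContDiffAt ℂ ω (fun y => fderiv ℂ k y (Pi.single j 1) * (k y)⁻¹) x :=
    ((hk.fderiv_right (m := ω) (by simp)).clm_apply contDiffAt_const).mul (hk.inv h0)
  rw [levi_apply, h1.wirtinger_eq, (HasWirtingerAt.of_holomorphic h2).conj_comp.wirtinger_eq]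
  simp

end Levi

/-! ### The primitive `dcForm` of the form (i/2)∂∂̄f. -/

section ComplexHessianForm

variable {m : ℕ}

lemma minSmoothness_two_le_infty : minSmoothness ℝ 2 ≤ (∞ : WithTop ℕ∞) := by
  rw [minSmoothness_of_isRCLikeNormedField]
  exact WithTop.coe_le_coe.2 (le_top : (2 : ℕ∞) ≤ ⊤)

/-- The complex Hessian is the (1,1)-part of the real one. This expresses it through real second
derivatives, the only ones that `extDeriv` sees. -/
lemma levi_bilinear {f : CSpace m → ℝ} {x : CSpace m} (hf : ContDiffAt ℝ ∞ f x)
    (v w : CSpace m) :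
    ∑ i, ∑ j, levi f x i j * (v i * conj (w j)) =
      ((fderiv ℝ (fderiv ℝ f) x v w + fderiv ℝ (fderiv ℝ f) x (Complex.I • v) (Complex.I • w) : ℝ) +
        Complex.I * (fderiv ℝ (fderiv ℝ f) x v (Complex.I • w) -
          fderiv ℝ (fderiv ℝ f) x (Complex.I • v) w : ℝ)) / 4 := by
  set F : CSpace m → ℂ := fun y => (f y : ℂ) with hF
  -- `G` is the conjugate-linear part of dF evaluated at `w`; taking the complex-linear part of dG
  -- at `v` then gives the complex Hessian.
  set G : CSpace m → ℂ := fun y =>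
    ((fderiv ℝ f y w : ℝ) + Complex.I * (fderiv ℝ f y (Complex.I • w) : ℝ)) / 2 with hG
  have hGF : G =ᶠ[𝓝 x] fun y => ∑ j, conj (w j) * wirtingerBar j F y := by
    filter_upwards [hf.eventually_smooth (N := 1)] with y hy
    have hd := hy.differentiableAt (by simp)
    have h1 : ∀ v, ((fderiv ℝ f y v : ℝ) : ℂ) = fderiv ℝ F y v := fun v => by
      have := (Complex.ofRealCLM.hasFDerivAt.comp y hd.hasFDerivAt).fderiv
      rw [hF, show (fun y => (f y : ℂ)) = Complex.ofRealCLM ∘ f from rfl, this]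
      rfl
    have h2 : HasWirtingerAt F _ _ y :=
      (hy.ofReal_comp.differentiableAt (by simp)).hasWirtingerAt
    simp only [hG, h1, h2.fderiv_apply, Finset.mul_sum, ← Finset.sum_add_distrib, Finset.sum_div]
    refine Finset.sum_congr rfl fun j _ => ?_
    simp only [Pi.smul_apply, smul_eq_mul, map_mul, Complex.conj_I]
    linear_combination (wirtinger j F y * w j - wirtingerBar j F y * conj (w j)) / 2 * Complex.I_sq
  have hGx : ∀ v, fderiv ℝ G x v = ((fderiv ℝ (fderiv ℝ f) x v w : ℝ) +
      Complex.I * (fderiv ℝ (fderiv ℝ f) x v (Complex.I • w) : ℝ)) / 2 := by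
    have h := ((hf.fderiv_right (m := ∞) (by simp)).differentiableAt (by simp)).hasFDerivAt
    have h1 : ∀ u, HasFDerivAt (fun y => ((fderiv ℝ f y u : ℝ) : ℂ)) _ x := fun u =>
      Complex.ofRealCLM.hasFDerivAt.comp x (h.clm_apply (hasFDerivAt_const u x))
    have h2 := ((h1 w).add ((h1 (Complex.I • w)).const_mul Complex.I)).mul_const (2⁻¹ : ℂ)
    intro v
    have h3 : G = fun y => ((fderiv ℝ f y w : ℝ) +
      Complex.I * (fderiv ℝ f y (Complex.I • w) : ℝ)) * (2⁻¹ : ℂ) := by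
      funext y; simp only [hG, div_eq_mul_inv]
    rw [h3]
    erw [h2.fderiv]
    simp
    ring
  have hS := HasWirtingerAt.sum (s := Finset.univ) (x := x) fun (j : Fin m) _ =>
    (HasWirtingerAt.of_contDiffAt (contDiffAt_wirtingerBar
      (hf.ofReal_comp : ContDiffAt ℝ ∞ F x) j)).const_mul (conj (w j))
  have hS := hS.congr_of_eventuallyEq hGF
  have key : ∑ i, ∑ j, levi f x i j * (v i * conj (w j)) =
      (fderiv ℝ G x v - Complex.I * fderiv ℝ G x (Complex.I • v)) / 2 := by
    simp only [hS.fderiv_apply, Finset.mul_sum, ← Finset.sum_sub_distrib, Finset.sum_div]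
    refine Finset.sum_congr rfl fun i _ => ?_
    simp only [Pi.smul_apply, smul_eq_mul, map_mul, Complex.conj_I, Finset.sum_apply]
    have : ∑ j, levi f x i j * (v i * conj (w j)) =
        (∑ j, conj (w j) * wirtinger i (wirtingerBar j F) x) * v i := by
      rw [Finset.sum_mul]
      exact Finset.sum_congr rfl fun j _ => by rw [levi_apply]; ring
    rw [this]
    linear_combination (-(∑ j, conj (w j) * wirtinger i (wirtingerBar j F) x) * v i +
      (∑ j, conj (w j) * wirtingerBar i (wirtingerBar j F) x) * conj (v i)) / (-2) * Complex.I_sq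
  rw [key, hGx, hGx]
  push_cast
  linear_combination (-1 / 4 : ℂ) * (fderiv ℝ (fderiv ℝ f) x (Complex.I • v) (Complex.I • w) : ℂ) * Complex.I_sq

/-- The real `1`-form `(i/4) (∂̄ - ∂) f`, that is, `v ↦ - df(i v) / 4`. -/
def dcForm (f : CSpace m → ℝ) (x : CSpace m) : CSpace m [⋀^Fin 1]→L[ℝ] ℝ :=
  ContinuousAlternatingMap.ofSubsingleton ℝ (CSpace m) ℝ (0 : Fin 1)
    ((-(1 / 4) : ℝ) • (fderiv ℝ f x ∘L
      ((Complex.I • ContinuousLinearMap.id ℂ (CSpace m)).restrictScalars ℝ)))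

lemma dcForm_apply (f : CSpace m → ℝ) (x : CSpace m) (v : Fin 1 → CSpace m) :
    dcForm f x v = -(1 / 4) * fderiv ℝ f x (Complex.I • v 0) := rfl

lemma contDiffAt_dcForm {f : CSpace m → ℝ} {x : CSpace m} (hf : ContDiffAt ℝ ∞ f x) :
    ContDiffAt ℝ ∞ (dcForm f) x := by
  have h : ContDiffAt ℝ ∞ (fderiv ℝ f) x := hf.fderiv_right (by simp)
  have h2 : ContDiffAt ℝ ∞ (fun y => ((-(1 / 4) : ℝ) • (fderiv ℝ f y ∘L
      ((Complex.I • ContinuousLinearMap.id ℂ (CSpace m)).restrictScalars ℝ)))) x :=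
    (h.clm_comp contDiffAt_const).const_smul _
  exact (ContinuousAlternatingMap.ofSubsingletonLIE (𝕜 := ℝ) (E := CSpace m) (F := ℝ)
    (ι := Fin 1) 0).contDiff.contDiffAt.comp x h2

lemma fundamentalTwoForm_apply (G : Matrix (Fin m) (Fin m) ℂ) (v : Fin 2 → CSpace m) :
    fundamentalTwoForm G v = (Complex.I / 2 *
      ∑ i, ∑ j, G i j * (v 0 i * conj (v 1 j) - v 1 i * conj (v 0 j))).re := rfl

/-- `d ((i/4) (∂̄ - ∂) f) = (i/2) ∂∂̄ f`. -/
lemma extDeriv_dcForm {f : CSpace m → ℝ} {x : CSpace m} (hf : ContDiffAt ℝ ∞ f x) :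
    extDeriv (dcForm f) x = fundamentalTwoForm (levi f x) := by
  ext v
  have hd := (contDiffAt_dcForm hf).differentiableAt (by simp)
  have h := ((hf.fderiv_right (m := ∞) (by simp)).differentiableAt (by simp)).hasFDerivAt
  have happ : ∀ (u : CSpace m) (w : Fin 1 → CSpace m), fderiv ℝ (fun y => dcForm f y w) x u =
      -(1 / 4) * fderiv ℝ (fderiv ℝ f) x u (Complex.I • w 0) := fun u w => by
    have h1 := (h.clm_apply (hasFDerivAt_const (Complex.I • w 0) x)).const_mul (-(1 / 4) : ℝ)
    simp only [dcForm_apply]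
    rw [h1.fderiv]
    simp
  have hsymm : IsSymmSndFDerivAt ℝ f x := hf.isSymmSndFDerivAt minSmoothness_two_le_infty
  rw [extDeriv_apply hd, fundamentalTwoForm_apply]
  have hsub : ∑ i, ∑ j, levi f x i j * (v 0 i * conj (v 1 j) - v 1 i * conj (v 0 j)) =
      (∑ i, ∑ j, levi f x i j * (v 0 i * conj (v 1 j))) -
        ∑ i, ∑ j, levi f x i j * (v 1 i * conj (v 0 j)) := by
    simp only [mul_sub, Finset.sum_sub_distrib]
  rw [hsub, levi_bilinear hf, levi_bilinear hf]
  simp [Fin.sum_univ_two, happ, Fin.removeNth]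
  -- The terms of the complex Hessian with the factor i in the first slot are moved to the second,
  -- where `dcForm` has it.
  rw [hsymm.eq (Complex.I • v 0), hsymm.eq (Complex.I • v 1)]
  ring

lemma dcForm_congr {f g : CSpace m → ℝ} {x : CSpace m} (h : f =ᶠ[𝓝 x] g) :
    dcForm f x = dcForm g x := by
  simp only [dcForm, h.fderiv_eq]

/-- The differential of a holomorphic map commutes with multiplication by i, the only ingredient of
`dcForm` besides df. -/
lemma dcForm_comp_holomorphic {f : CSpace m → ℝ} {τ : CSpace m → CSpace m} {x : CSpace m}
    (hτ : DifferentiableAt ℂ τ x) (hf : DifferentiableAt ℝ f (τ x)) :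
    dcForm (fun y => f (τ y)) x =
      (dcForm f (τ x)).compContinuousLinearMap (fderiv ℝ τ x) := by
  ext v
  have h1 : fderiv ℝ τ x = (fderiv ℂ τ x).restrictScalars ℝ := hτ.fderiv_restrictScalars ℝ
  have h2 : fderiv ℝ (fun y => f (τ y)) x = fderiv ℝ f (τ x) ∘L fderiv ℝ τ x :=
    fderiv_comp x hf (hτ.restrictScalars ℝ)
  rw [ContinuousAlternatingMap.compContinuousLinearMap_apply, dcForm_apply, dcForm_apply, h2, h1]
  simp

/-- If `A` is a smooth branch of `arg k` for a holomorphic function `k` without zeros, then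
`dcForm (log |k|²) = dA / 2`. -/
lemma dcForm_log_norm_sq {k : CSpace m → ℂ} {A : CSpace m → ℝ} {x : CSpace m}
    (hk : DifferentiableAt ℂ k x) (h0 : k x ≠ 0) (hA : DifferentiableAt ℝ A x)
    (hkA : ∀ᶠ y in 𝓝 x, k y = ‖k y‖ * Complex.exp (Complex.I * A y)) (v : Fin 1 → CSpace m) :
    dcForm (fun y => Real.log (‖k y‖ ^ 2)) x v = 1 / 2 * fderiv ℝ A x (v 0) := by
  set L : CSpace m → ℝ := fun y => Real.log (‖k y‖ ^ 2) with hL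
  have hLd : DifferentiableAt ℝ L x :=
    DifferentiableAt.log ((hk.restrictScalars ℝ).norm_sq ℝ) (by simpa using h0)
  -- With k = exp(L/2 + iA), the form dL/2 + i dA equals dk/k and is complex-linear. Comparing real
  -- parts of its values at iv and i times its value at v gives dL(iv)/2 = -dA(v).
  have hexp : k =ᶠ[𝓝 x] fun y => Complex.exp ((L y : ℂ) * (1 / 2 : ℂ) + Complex.I * A y) := by
    filter_upwards [hkA, hk.continuousAt.eventually (isOpen_ne.mem_nhds h0)] with y hy hy0
    have hpos : 0 < ‖k y‖ := norm_pos_iff.2 hy0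
    have h1 : (L y : ℂ) * (1 / 2 : ℂ) = (Real.log ‖k y‖ : ℝ) := by
      rw [hL]; simp only [Real.log_pow]; push_cast; ring
    rw [Complex.exp_add, h1, ← Complex.ofReal_exp, Real.exp_log hpos, ← hy]
  have hder := ((((Complex.ofRealCLM.hasFDerivAt.comp x hLd.hasFDerivAt).mul_const
    (1 / 2 : ℂ)).add ((Complex.ofRealCLM.hasFDerivAt.comp x hA.hasFDerivAt).const_mul
    Complex.I)).cexp).congr_of_eventuallyEq hexp
  have heq := hder.unique (hk.hasFDerivAt.restrictScalars ℝ)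
  have hval : ∀ w, k x * ((fderiv ℝ L x w : ℂ) * (1 / 2 : ℂ) + Complex.I * (fderiv ℝ A x w : ℂ)) =
      fderiv ℂ k x w := fun w => by
    have h1 := DFunLike.congr_fun heq w
    have h2 := hexp.eq_of_nhds
    simp at h1 h2
    rw [← h1, h2]
    ring
  have h1 := hval (Complex.I • v 0)
  rw [(fderiv ℂ k x).map_smul, ← hval, smul_eq_mul] at h1
  have h2 : ((fderiv ℝ L x (Complex.I • v 0) : ℂ) * (1 / 2 : ℂ) +
      Complex.I * (fderiv ℝ A x (Complex.I • v 0) : ℂ)) = Complex.I *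
      ((fderiv ℝ L x (v 0) : ℂ) * (1 / 2 : ℂ) + Complex.I * (fderiv ℝ A x (v 0) : ℂ)) := by
    apply mul_left_cancel₀ h0
    rw [h1]; ring
  have h3 := congrArg Complex.re h2
  simp at h3
  rw [dcForm_apply]
  linarith

end ComplexHessianForm

/-! ### The curvature in matrix form and its tensoriality. -/

section CurvatureForm

variable {m : ℕ}

/-- The derivative `∑ ξ_k ∂f/∂z_k`. -/
def delDir (ξ : CSpace m) (f : CSpace m → ℂ) (x : CSpace m) : ℂ := ∑ k, ξ k * wirtinger k f x

/-- The derivative `∑ ξ̄_k ∂f/∂z̄_k`. -/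
def delBarDir (ξ : CSpace m) (f : CSpace m → ℂ) (x : CSpace m) : ℂ :=
  ∑ k, conj (ξ k) * wirtingerBar k f x

lemma HasWirtingerAt.delDir_eq {f : CSpace m → ℂ} {a b x : CSpace m} (h : HasWirtingerAt f a b x)
    (ξ : CSpace m) : delDir ξ f x = ∑ k, ξ k * a k := by
  simp only [delDir, h.wirtinger_eq]

lemma HasWirtingerAt.delBarDir_eq {f : CSpace m → ℂ} {a b x : CSpace m}
    (h : HasWirtingerAt f a b x) (ξ : CSpace m) :
    delBarDir ξ f x = ∑ k, conj (ξ k) * b k := by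
  simp only [delBarDir, h.wirtingerBar_eq]

lemma Filter.EventuallyEq.delDir_eq {f g : CSpace m → ℂ} {x : CSpace m} (h : f =ᶠ[𝓝 x] g)
    (ξ : CSpace m) : delDir ξ f x = delDir ξ g x := by
  simp only [delDir, h.wirtinger_eq]

lemma Filter.EventuallyEq.delBarDir {f g : CSpace m → ℂ} {x : CSpace m} (h : f =ᶠ[𝓝 x] g)
    (ξ : CSpace m) : delBarDir ξ f =ᶠ[𝓝 x] delBarDir ξ g := by
  filter_upwards [h.fderiv (𝕜 := ℝ)] with y hy
  simp only [_root_.delBarDir, _root_.wirtingerBar, hy]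

lemma contDiffAt_delBarDir {f : CSpace m → ℂ} {x : CSpace m} (h : ContDiffAt ℝ ∞ f x)
    (ξ : CSpace m) : ContDiffAt ℝ ∞ (delBarDir ξ f) x := by
  unfold delBarDir
  exact ContDiffAt.sum fun k _ => contDiffAt_const.mul (contDiffAt_wirtingerBar h k)

lemma delDir_comp_holomorphic {f : CSpace m → ℂ} {τ : CSpace m → CSpace m} {x : CSpace m}
    (hτ : DifferentiableAt ℂ τ x) (hf : DifferentiableAt ℝ f (τ x)) (ξ : CSpace m) :
    delDir ξ (fun y => f (τ y)) x = delDir (holJacobian τ x *ᵥ ξ) f (τ x) := by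
  simp only [delDir, wirtinger_comp_holomorphic hτ hf, Matrix.mulVec, dotProduct, Finset.mul_sum,
    Finset.sum_mul]
  rw [Finset.sum_comm]
  exact Finset.sum_congr rfl fun a _ => Finset.sum_congr rfl fun b _ => by ring

lemma delBarDir_comp_holomorphic {f : CSpace m → ℂ} {τ : CSpace m → CSpace m} {x : CSpace m}
    (hτ : DifferentiableAt ℂ τ x) (hf : DifferentiableAt ℝ f (τ x)) (ξ : CSpace m) :
    delBarDir ξ (fun y => f (τ y)) x = delBarDir (holJacobian τ x *ᵥ ξ) f (τ x) := by
  simp only [delBarDir, wirtingerBar_comp_holomorphic hτ hf, Matrix.mulVec, dotProduct,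
    Finset.mul_sum, Finset.sum_mul, map_sum, map_mul]
  rw [Finset.sum_comm]
  exact Finset.sum_congr rfl fun a _ => Finset.sum_congr rfl fun b _ => by ring

/-- The direction Jξ varies with the point, but holomorphically; its conjugate, which enters through
∂̄, is not seen by ∂. -/
lemma delDir_delBarDir_comp_holomorphic {f : CSpace m → ℂ} {τ : CSpace m → CSpace m}
    {x : CSpace m} (hτ : ContDiffAt ℂ ω τ x) (hf : ContDiffAt ℝ ∞ f (τ x)) (ξ : CSpace m) :
    delDir ξ (delBarDir ξ fun y => f (τ y)) x =
      delDir (holJacobian τ x *ᵥ ξ) (delBarDir (holJacobian τ x *ᵥ ξ) f) (τ x) := by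
  have h1 : (delBarDir ξ fun y => f (τ y)) =ᶠ[𝓝 x]
      fun y => ∑ d, conj ((holJacobian τ y *ᵥ ξ) d) * wirtingerBar d f (τ y) := by
    filter_upwards [hτ.continuousAt.eventually (hf.eventually_smooth (N := 1)),
      hτ.eventually (by simp)] with y hy hy'
    exact delBarDir_comp_holomorphic (hy'.differentiableAt (by simp))
      (hy.differentiableAt (by simp)) ξ
  have hη : ∀ d, ContDiffAt ℂ ω (fun y => (holJacobian τ y *ᵥ ξ) d) x := fun d => by
    simp only [Matrix.mulVec, dotProduct]
    exact ContDiffAt.sum fun k _ => (contDiffAt_holJacobian hτ d k).mul contDiffAt_const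
  have h2 := HasWirtingerAt.sum (s := Finset.univ) (x := x) fun (d : Fin m) _ =>
    (HasWirtingerAt.of_holomorphic (hη d)).conj_comp.mul
      ((HasWirtingerAt.of_contDiffAt (contDiffAt_wirtingerBar hf d)).comp_holomorphic
        (hτ.differentiableAt (by simp)).hasFDerivAt)
  have h3 := HasWirtingerAt.sum (s := Finset.univ) (x := τ x) fun (d : Fin m) _ =>
    (HasWirtingerAt.of_contDiffAt (contDiffAt_wirtingerBar hf d)).const_mul
      (conj ((holJacobian τ x *ᵥ ξ) d))
  have h4 : delBarDir (holJacobian τ x *ᵥ ξ) f = fun y =>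
    ∑ d, conj ((holJacobian τ x *ᵥ ξ) d) * wirtingerBar d f y := rfl
  rw [h1.delDir_eq, h2.delDir_eq, h4, h3.delDir_eq]
  simp only [Finset.sum_apply, Pi.add_apply, Pi.smul_apply, smul_eq_mul, Pi.zero_apply, map_zero,
    mul_zero, add_zero, Matrix.mulVec, dotProduct, Finset.mul_sum, Finset.sum_mul,
    holJacobian_apply]
  simp only [map_sum, Finset.sum_mul]
  rw [Finset.sum_comm]
  conv_rhs => rw [Finset.sum_comm]
  refine Finset.sum_congr rfl fun d _ => ?_
  rw [Finset.sum_comm]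
  refine Finset.sum_congr rfl fun a _ => Finset.sum_congr rfl fun b _ => ?_
  simp only [Finset.mul_sum]
  exact Finset.sum_congr rfl fun c _ => by ring

/-- Entrywise `delDir`. -/
def matDel (ξ : CSpace m) (F : CSpace m → Matrix (Fin m) (Fin m) ℂ) (x : CSpace m) :
    Matrix (Fin m) (Fin m) ℂ := Matrix.of fun i j => delDir ξ (fun y => F y i j) x

/-- Entrywise `delBarDir`. -/
def matDelBar (ξ : CSpace m) (F : CSpace m → Matrix (Fin m) (Fin m) ℂ) (x : CSpace m) :
    Matrix (Fin m) (Fin m) ℂ := Matrix.of fun i j => delBarDir ξ (fun y => F y i j) x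

/-- All entries of the matrix-valued function are smooth at the point. -/
def MatSmoothAt (F : CSpace m → Matrix (Fin m) (Fin m) ℂ) (x : CSpace m) : Prop :=
  ∀ i j, ContDiffAt ℝ ∞ (fun y => F y i j) x

variable {A B F G H : CSpace m → Matrix (Fin m) (Fin m) ℂ} {x ξ : CSpace m}

lemma matDel_mul (hA : MatSmoothAt A x) (hB : MatSmoothAt B x) :
    matDel ξ (fun y => A y * B y) x = matDel ξ A x * B x + A x * matDel ξ B x := by
  ext i j
  have h := HasWirtingerAt.sum (s := Finset.univ) (x := x) fun (k : Fin m) _ =>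
    (HasWirtingerAt.of_contDiffAt (hA i k)).mul (HasWirtingerAt.of_contDiffAt (hB k j))
  have h' : matDel ξ (fun y => A y * B y) x i j = delDir ξ (fun y => ∑ k, A y i k * B y k j) x := rfl
  rw [h', h.delDir_eq]
  simp only [Matrix.add_apply, Matrix.mul_apply, matDel, Matrix.of_apply, delDir, Finset.sum_apply,
    Pi.add_apply, Pi.smul_apply, smul_eq_mul, Finset.mul_sum, Finset.sum_mul, mul_add,
    Finset.sum_add_distrib]
  rw [add_comm]
  congr 1 <;> rw [Finset.sum_comm] <;>
    exact Finset.sum_congr rfl fun a _ => Finset.sum_congr rfl fun b _ => by ring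

/-- Plain differentiability is assumed because the rule has to hold at all points near the base
point, where smoothness of order ∞ is not at hand. -/
lemma matDelBar_mul (hA : ∀ i j, DifferentiableAt ℝ (fun y => A y i j) x)
    (hB : ∀ i j, DifferentiableAt ℝ (fun y => B y i j) x) :
    matDelBar ξ (fun y => A y * B y) x = matDelBar ξ A x * B x + A x * matDelBar ξ B x := by
  ext i j
  have h := HasWirtingerAt.sum (s := Finset.univ) (x := x) fun (k : Fin m) _ =>
    (hA i k).hasWirtingerAt.mul (hB k j).hasWirtingerAt
  have h' : matDelBar ξ (fun y => A y * B y) x i j =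
    delBarDir ξ (fun y => ∑ k, A y i k * B y k j) x := rfl
  rw [h', h.delBarDir_eq]
  simp only [Matrix.add_apply, Matrix.mul_apply, matDelBar, Matrix.of_apply, delBarDir,
    Finset.sum_apply, Pi.add_apply, Pi.smul_apply, smul_eq_mul, Finset.mul_sum, Finset.sum_mul,
    mul_add, Finset.sum_add_distrib]
  rw [add_comm]
  congr 1 <;> rw [Finset.sum_comm] <;>
    exact Finset.sum_congr rfl fun a _ => Finset.sum_congr rfl fun b _ => by ring

lemma matDel_add (hA : MatSmoothAt A x) (hB : MatSmoothAt B x) :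
    matDel ξ (fun y => A y + B y) x = matDel ξ A x + matDel ξ B x := by
  ext i j
  have h := (HasWirtingerAt.of_contDiffAt (hA i j)).add (HasWirtingerAt.of_contDiffAt (hB i j))
  have h' : matDel ξ (fun y => A y + B y) x i j = delDir ξ (fun y => A y i j + B y i j) x := rfl
  rw [h', h.delDir_eq]
  simp only [Matrix.add_apply, matDel, Matrix.of_apply, delDir, Pi.add_apply, mul_add,
    Finset.sum_add_distrib]

lemma MatSmoothAt.mul (hA : MatSmoothAt A x) (hB : MatSmoothAt B x) :
    MatSmoothAt (fun y => A y * B y) x := fun i j => by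
  simp only [Matrix.mul_apply]
  exact ContDiffAt.sum fun k _ => (hA i k).mul (hB k j)

lemma MatSmoothAt.matDelBar (hA : MatSmoothAt A x) : MatSmoothAt (matDelBar ξ A) x :=
  fun i j => contDiffAt_delBarDir (hA i j) ξ

lemma MatSmoothAt.eventually_differentiable (hA : MatSmoothAt A x) :
    ∀ᶠ y in 𝓝 x, ∀ i j, DifferentiableAt ℝ (fun y => A y i j) y := by
  refine eventually_all.2 fun i => eventually_all.2 fun j => ?_
  filter_upwards [(hA i j).eventually_smooth (N := 1)] with y hy
  exact hy.differentiableAt (by simp)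

lemma matDel_congr (h : F =ᶠ[𝓝 x] G) : matDel ξ F x = matDel ξ G x := by
  ext i j
  exact (h.fun_comp fun M => M i j).delDir_eq ξ

lemma matDelBar_congr (h : F =ᶠ[𝓝 x] G) : matDelBar ξ F =ᶠ[𝓝 x] matDelBar ξ G := by
  have h' : ∀ᶠ y in 𝓝 x, ∀ i j, delBarDir ξ (fun y => F y i j) y =
      delBarDir ξ (fun y => G y i j) y :=
    eventually_all.2 fun i => eventually_all.2 fun j => (h.fun_comp fun M => M i j).delBarDir ξ
  filter_upwards [h'] with y hy
  ext i j
  exact hy i j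

/-- The curvature contracted with `ξ` in the third and `ξ̄` in the fourth index. -/
def curvatureForm (G : CSpace m → Matrix (Fin m) (Fin m) ℂ) (x ξ : CSpace m) :
    Matrix (Fin m) (Fin m) ℂ :=
  -matDel ξ (matDelBar ξ G) x + matDel ξ G x * (G x)⁻¹ * matDelBar ξ G x

lemma curvatureForm_congr (h : F =ᶠ[𝓝 x] G) : curvatureForm F x ξ = curvatureForm G x ξ := by
  rw [curvatureForm, curvatureForm, matDel_congr h, matDel_congr (matDelBar_congr h), h.eq_of_nhds,
    (matDelBar_congr h).eq_of_nhds]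

/-- The curvature is a tensor under holomorphic changes of coordinates. -/
lemma curvatureForm_pullback {τ : CSpace m → CSpace m} (hτ : ContDiffAt ℂ ω τ x)
    (hH : MatSmoothAt H (τ x)) (hdet : IsUnit (H (τ x)).det) (hJ : IsUnit (holJacobian τ x).det) :
    curvatureForm (fun y => (holJacobian τ y)ᵀ * H (τ y) * (holJacobian τ y).map conj) x ξ =
      (holJacobian τ x)ᵀ * curvatureForm H (τ x) (holJacobian τ x *ᵥ ξ) *
        (holJacobian τ x).map conj := by
  set P : CSpace m → Matrix (Fin m) (Fin m) ℂ := fun y => (holJacobian τ y)ᵀ with hP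
  set N : CSpace m → Matrix (Fin m) (Fin m) ℂ := fun y => (holJacobian τ y).map conj with hN
  set Q : CSpace m → Matrix (Fin m) (Fin m) ℂ := fun y => H (τ y) with hQ
  set η := holJacobian τ x *ᵥ ξ with hη
  have hτr : ContDiffAt ℝ ∞ τ x := (hτ.restrict_scalars ℝ).of_le le_top
  have hhol : ∀ a i, ContDiffAt ℂ ω (fun y => holJacobian τ y a i) x := contDiffAt_holJacobian hτ
  have hPs : MatSmoothAt P x := fun i j => ((hhol j i).restrict_scalars ℝ).of_le le_top
  have hNs : MatSmoothAt N x := fun i j =>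
    (Complex.conjCLE : ℂ →L[ℝ] ℂ).contDiff.contDiffAt.comp x
      (((hhol i j).restrict_scalars ℝ).of_le le_top)
  have hQs : MatSmoothAt Q x := fun i j => (hH i j).comp x hτr
  -- The transposed Jacobian `P` is holomorphic and the conjugate Jacobian `N` antiholomorphic. So
  -- ∂̄P, ∂N and ∂∂̄N vanish, and only ∂P and ∂̄N survive from derivatives of the Jacobian.
  have hPbar : ∀ᶠ y in 𝓝 x, matDelBar ξ P y = 0 := by
    have : ∀ᶠ y in 𝓝 x, ∀ a i, ContDiffAt ℂ ω (fun y => holJacobian τ y a i) y :=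
      eventually_all.2 fun a => eventually_all.2 fun i => (hhol a i).eventually (by simp)
    filter_upwards [this] with y hy
    ext i j
    have h := (HasWirtingerAt.of_holomorphic (hy j i)).delBarDir_eq ξ
    exact h.trans (by simp)
  have hNdel : matDel ξ N x = 0 := by
    ext i j
    have h := (HasWirtingerAt.of_holomorphic (hhol i j)).conj_comp.delDir_eq ξ
    exact h.trans (by simp)
  have hNN : MatSmoothAt (matDelBar ξ N) x := hNs.matDelBar
  have hNNdel : matDel ξ (matDelBar ξ N) x = 0 := by
    ext i j
    have h1 : (fun y => matDelBar ξ N y i j) =ᶠ[𝓝 x] fun y =>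
        conj (∑ k, ξ k * fderiv ℂ (fun y => holJacobian τ y i j) y (Pi.single k 1)) := by
      filter_upwards [(hhol i j).eventually (by simp)] with y hy
      have h := (HasWirtingerAt.of_holomorphic hy).conj_comp.delBarDir_eq ξ
      rw [map_sum]
      simp only [map_mul]
      exact h
    have h2 : ContDiffAt ℂ ω (fun y => ∑ k, ξ k *
        fderiv ℂ (fun y => holJacobian τ y i j) y (Pi.single k 1)) x :=
      ContDiffAt.sum fun k _ => contDiffAt_const.mul
        (((hhol i j).fderiv_right (m := ω) (by simp)).clm_apply contDiffAt_const)
    have h3 := (HasWirtingerAt.of_holomorphic h2).conj_comp.delDir_eq ξ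
    exact (h1.delDir_eq ξ).trans (h3.trans (by simp))
  have hQdel : matDel ξ Q x = matDel η H (τ x) := by
    ext i j
    exact delDir_comp_holomorphic (hτ.differentiableAt (by simp))
      ((hH i j).differentiableAt (by simp)) ξ
  have hQbar : matDelBar ξ Q x = matDelBar η H (τ x) := by
    ext i j
    exact delBarDir_comp_holomorphic (hτ.differentiableAt (by simp))
      ((hH i j).differentiableAt (by simp)) ξ
  have hQQ : matDel ξ (matDelBar ξ Q) x = matDel η (matDelBar η H) (τ x) := by
    ext i j
    exact delDir_delBarDir_comp_holomorphic hτ (hH i j) ξ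
  have hbar : matDelBar ξ (fun y => P y * Q y * N y) =ᶠ[𝓝 x]
      fun y => P y * matDelBar ξ Q y * N y + P y * Q y * matDelBar ξ N y := by
    filter_upwards [hPbar, hPs.eventually_differentiable, hQs.eventually_differentiable,
      hNs.eventually_differentiable, (hPs.mul hQs).eventually_differentiable] with y h0 h1 h2 h3 h4
    rw [matDelBar_mul h4 h3, matDelBar_mul h1 h2, h0, Matrix.zero_mul, zero_add]
  have hPQ := hPs.mul hQs
  have hdel : matDel ξ (fun y => P y * Q y * N y) x =
      (matDel ξ P x * Q x + P x * matDel ξ Q x) * N x := by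
    rw [matDel_mul hPQ hNs, hNdel, Matrix.mul_zero, add_zero, matDel_mul hPs hQs]
  have hdd : matDel ξ (matDelBar ξ fun y => P y * Q y * N y) x =
      (matDel ξ P x * matDelBar ξ Q x + P x * matDel ξ (matDelBar ξ Q) x) * N x +
        (matDel ξ P x * Q x + P x * matDel ξ Q x) * matDelBar ξ N x := by
    rw [matDel_congr hbar, matDel_add ((hPs.mul hQs.matDelBar).mul hNs) (hPQ.mul hNN),
      matDel_mul (hPs.mul hQs.matDelBar) hNs, matDel_mul hPQ hNN, matDel_mul hPs hQs,
      matDel_mul hPs hQs.matDelBar, hNdel, hNNdel]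
    simp only [Matrix.mul_zero, add_zero]
  have hPu : IsUnit (P x).det := by rw [hP]; simpa using hJ
  have hNu : IsUnit (N x).det := by
    have : (N x).det = conj (holJacobian τ x).det := (RingHom.map_det (starRingEnd ℂ) _).symm
    rw [this]
    exact hJ.map _
  have hinv : (P x * Q x * N x)⁻¹ = (N x)⁻¹ * ((Q x)⁻¹ * (P x)⁻¹) := by
    rw [Matrix.mul_inv_rev, Matrix.mul_inv_rev]
  have e1 : (P x)⁻¹ * P x = 1 := Matrix.nonsing_inv_mul _ hPu
  have e2 : N x * (N x)⁻¹ = 1 := Matrix.mul_nonsing_inv _ hNu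
  have e3 : Q x * (Q x)⁻¹ = 1 := Matrix.mul_nonsing_inv _ hdet
  have e4 : (Q x)⁻¹ * Q x = 1 := Matrix.nonsing_inv_mul _ hdet
  -- Apart from the sandwiched product of first derivatives of `Q`, the three terms here contain ∂P
  -- or ∂̄N and are exactly those of `hdd`; they cancel against the second-derivative part of the
  -- curvature.
  have hmid : (matDel ξ P x * Q x + P x * matDel ξ Q x) * N x *
      ((N x)⁻¹ * ((Q x)⁻¹ * (P x)⁻¹)) * (P x * matDelBar ξ Q x * N x + P x * Q x * matDelBar ξ N x) =
      matDel ξ P x * matDelBar ξ Q x * N x + matDel ξ P x * Q x * matDelBar ξ N x +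
      P x * (matDel ξ Q x * (Q x)⁻¹ * matDelBar ξ Q x) * N x +
      P x * matDel ξ Q x * matDelBar ξ N x := by
    calc _ = (matDel ξ P x * Q x + P x * matDel ξ Q x) * (N x * (N x)⁻¹) * (Q x)⁻¹ *
        ((P x)⁻¹ * P x) * (matDelBar ξ Q x * N x + Q x * matDelBar ξ N x) := by noncomm_ring
      _ = matDel ξ P x * (Q x * (Q x)⁻¹) * (matDelBar ξ Q x * N x + Q x * matDelBar ξ N x) +
        P x * (matDel ξ Q x * (Q x)⁻¹ * matDelBar ξ Q x) * N x +
        P x * matDel ξ Q x * ((Q x)⁻¹ * Q x) * matDelBar ξ N x := by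
          rw [e1, e2]; noncomm_ring
      _ = _ := by rw [e3, e4]; noncomm_ring
  rw [curvatureForm, hdd, hdel, hbar.eq_of_nhds, hinv, hmid, curvatureForm, ← hQdel, ← hQbar,
    ← hQQ]
  noncomm_ring

end CurvatureForm

section HitchinModel

/-! The coefficients of Hitchin's metrics in the two types of standard charts. The parameter `e`
is `0` for the fibre coordinate `z₂` and `1` for the fibre coordinate `1 / z₂`. -/

/-- `1 + |z₁|²`. -/
def baseH (z : CSpace 2) : ℂ := 1 + z 0 * conj (z 0)

/-- `|y₀|²`: the constant `1` for `e = 0` and `|z₂|²` for `e = 1`. -/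
def fibP (e : ℂ) (z : CSpace 2) : ℂ := (1 - e) + e * (z 1 * conj (z 1))

/-- `|y₁|²`: the function `|z₂|²` for `e = 0` and the constant `1` for `e = 1`. -/
def fibQ (e : ℂ) (z : CSpace 2) : ℂ := e + (1 - e) * (z 1 * conj (z 1))

/-- `(1 + |z₁|²)ⁿ |y₀|² + |y₁|²`. -/
def fibD (n : ℕ) (e : ℂ) (z : CSpace 2) : ℂ := baseH z ^ n * fibP e z + fibQ e z

/-- The `∂/∂(z₂ z̄₂)` derivative of `fibD`. -/
def fibL (n : ℕ) (e : ℂ) (z : CSpace 2) : ℂ := baseH z ^ n * e + (1 - e)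

variable {n : ℕ} {e s : ℂ} {y : CSpace 2}

lemma hasWirtingerAt_coord_zero : HasWirtingerAt (fun z : CSpace 2 => z 0) ![1, 0] ![0, 0] y :=
  (HasWirtingerAt.coord 0).congr_coeff (fun j => by fin_cases j <;> simp)
    (fun j => by fin_cases j <;> simp)

lemma hasWirtingerAt_coord_one : HasWirtingerAt (fun z : CSpace 2 => z 1) ![0, 1] ![0, 0] y :=
  (HasWirtingerAt.coord 1).congr_coeff (fun j => by fin_cases j <;> simp)
    (fun j => by fin_cases j <;> simp)

lemma hasWirtingerAt_mul_conj (k : Fin 2) :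
    HasWirtingerAt (fun z => z k * conj (z k)) (Pi.single k (conj (y k))) (Pi.single k (y k)) y :=
  ((HasWirtingerAt.coord k).mul (HasWirtingerAt.coord k).conj_comp).congr_coeff
    (fun j => by fin_cases k <;> fin_cases j <;> simp)
    (fun j => by fin_cases k <;> fin_cases j <;> simp)

lemma hasWirtingerAt_baseH : HasWirtingerAt baseH ![conj (y 0), 0] ![y 0, 0] y :=
  ((HasWirtingerAt.const 1).add (hasWirtingerAt_mul_conj 0)).congr_coeff
    (fun j => by fin_cases j <;> simp) (fun j => by fin_cases j <;> simp)

lemma hasWirtingerAt_fibP : HasWirtingerAt (fibP e) ![0, e * conj (y 1)] ![0, e * y 1] y :=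
  ((HasWirtingerAt.const (1 - e)).add ((hasWirtingerAt_mul_conj 1).const_mul e)).congr_coeff
    (fun j => by fin_cases j <;> simp) (fun j => by fin_cases j <;> simp)

lemma hasWirtingerAt_fibQ :
    HasWirtingerAt (fibQ e) ![0, (1 - e) * conj (y 1)] ![0, (1 - e) * y 1] y :=
  ((HasWirtingerAt.const e).add ((hasWirtingerAt_mul_conj 1).const_mul (1 - e))).congr_coeff
    (fun j => by fin_cases j <;> simp) (fun j => by fin_cases j <;> simp)

lemma baseH_eq_ofReal (z : CSpace 2) : baseH z = ((1 + ‖z 0‖ ^ 2 : ℝ) : ℂ) := by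
  rw [baseH, Complex.mul_conj']; push_cast; ring

lemma baseH_ne_zero (z : CSpace 2) : baseH z ≠ 0 := by
  rw [baseH_eq_ofReal]
  exact_mod_cast (by positivity : (0 : ℝ) < 1 + ‖z 0‖ ^ 2).ne'

lemma hasWirtingerAt_baseH_inv :
    HasWirtingerAt (fun z => (baseH z)⁻¹) ![-(conj (y 0) * (baseH y)⁻¹ ^ 2), 0]
      ![-(y 0 * (baseH y)⁻¹ ^ 2), 0] y :=
  (hasWirtingerAt_baseH.inv (baseH_ne_zero y)).congr_coeff
    (fun j => by fin_cases j <;> simp [mul_comm]) (fun j => by fin_cases j <;> simp [mul_comm])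

lemma hasWirtingerAt_baseH_pow (n : ℕ) :
    HasWirtingerAt (fun z => baseH z ^ n) ![n * baseH y ^ n * conj (y 0) * (baseH y)⁻¹, 0]
      ![n * baseH y ^ n * y 0 * (baseH y)⁻¹, 0] y := by
  have h0 := baseH_ne_zero y
  -- This removes the truncated exponent n - 1. All later formulas are then polynomial in hⁿ and
  -- h⁻¹, which can be treated as independent symbols.
  have h : (n : ℂ) * baseH y ^ (n - 1) = n * baseH y ^ n * (baseH y)⁻¹ := by
    rcases n with _ | n
    · simp
    · rw [Nat.add_sub_cancel, pow_succ]; field_simp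
  refine (hasWirtingerAt_baseH.pow n).congr_coeff (fun j => ?_) (fun j => ?_) <;>
    fin_cases j <;> simp [h] <;> ring

lemma hasWirtingerAt_fibD :
    HasWirtingerAt (fibD n e)
      ![n * baseH y ^ n * conj (y 0) * (baseH y)⁻¹ * fibP e y, fibL n e y * conj (y 1)]
      ![n * baseH y ^ n * y 0 * (baseH y)⁻¹ * fibP e y, fibL n e y * y 1] y :=
  (((hasWirtingerAt_baseH_pow n).mul hasWirtingerAt_fibP).add hasWirtingerAt_fibQ).congr_coeff
    (fun j => by fin_cases j <;> simp [fibL] <;> ring)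
    (fun j => by fin_cases j <;> simp [fibL] <;> ring)

lemma hasWirtingerAt_fibL :
    HasWirtingerAt (fibL n e)
      ![n * baseH y ^ n * conj (y 0) * (baseH y)⁻¹ * e, 0]
      ![n * baseH y ^ n * y 0 * (baseH y)⁻¹ * e, 0] y :=
  (((hasWirtingerAt_baseH_pow n).mul (HasWirtingerAt.const e)).add
    (HasWirtingerAt.const (1 - e))).congr_coeff
    (fun j => by fin_cases j <;> simp <;> ring)
    (fun j => by fin_cases j <;> simp <;> ring)

lemma hasWirtingerAt_fibD_inv (hD : fibD n e y ≠ 0) :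
    HasWirtingerAt (fun z => (fibD n e z)⁻¹)
      ![-(n * baseH y ^ n * conj (y 0) * (baseH y)⁻¹ * fibP e y * (fibD n e y)⁻¹ ^ 2),
        -(fibL n e y * conj (y 1) * (fibD n e y)⁻¹ ^ 2)]
      ![-(n * baseH y ^ n * y 0 * (baseH y)⁻¹ * fibP e y * (fibD n e y)⁻¹ ^ 2),
        -(fibL n e y * y 1 * (fibD n e y)⁻¹ ^ 2)] y :=
  (hasWirtingerAt_fibD.inv hD).congr_coeff
    (fun j => by fin_cases j <;> simp <;> ring) (fun j => by fin_cases j <;> simp <;> ring)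

/-- The coefficients of the metric in a standard chart. -/
def hitchinMatrix (n : ℕ) (s e : ℂ) (z : CSpace 2) : Matrix (Fin 2) (Fin 2) ℂ :=
  !![(baseH z)⁻¹ ^ 2 + s * n * (baseH z ^ n * fibP e z * (baseH z)⁻¹ ^ 2 * (fibD n e z)⁻¹) +
      s * n ^ 2 * (baseH z ^ n * (z 1 * conj (z 1)) * (z 0 * conj (z 0)) * (baseH z)⁻¹ ^ 2 *
        (fibD n e z)⁻¹ ^ 2),
    -(s * n * (1 - 2 * e)) *
      (baseH z ^ n * conj (z 0) * z 1 * (baseH z)⁻¹ * (fibD n e z)⁻¹ ^ 2);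
    -(s * n * (1 - 2 * e)) *
      (baseH z ^ n * z 0 * conj (z 1) * (baseH z)⁻¹ * (fibD n e z)⁻¹ ^ 2),
    s * (baseH z ^ n * (fibD n e z)⁻¹ ^ 2)]

/-- The derivatives of `∂f/∂z̄_j` for the potential `f`. -/
lemma hasWirtingerAt_potentialBar (he : e * e = e) (hD : fibD n e y ≠ 0) (j : Fin 2) :
    HasWirtingerAt (fun z => (![z 0 * (baseH z)⁻¹ +
        s * (n * baseH z ^ n * z 0 * (baseH z)⁻¹ * fibP e z * (fibD n e z)⁻¹),
        s * (fibL n e z * z 1 * (fibD n e z)⁻¹)] : CSpace 2) j)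
      (fun i => hitchinMatrix n s e y i j) (fun i => wirtingerBar i (fun z => (![z 0 * (baseH z)⁻¹ +
        s * (n * baseH z ^ n * z 0 * (baseH z)⁻¹ * fibP e z * (fibD n e z)⁻¹),
        s * (fibL n e z * z 1 * (fibD n e z)⁻¹)] : CSpace 2) j) y) y := by
  have hu : (baseH y)⁻¹ * (1 + y 0 * conj (y 0)) = 1 := inv_mul_cancel₀ (baseH_ne_zero y)
  have hv : (fibD n e y)⁻¹ * (baseH y ^ n * fibP e y + fibQ e y) = 1 := inv_mul_cancel₀ hD
  -- The next three relations, together with `hu` and `hv`, suffice for all entries. With e kept as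
  -- an idempotent symbol, one computation covers both types of chart.
  have hPL : e * (baseH y ^ n * fibP e y + fibQ e y) - fibP e y * fibL n e y = 2 * e - 1 := by
    simp only [fibP, fibQ, fibL]; ring
  have hPQ : fibP e y * fibQ e y = y 1 * conj (y 1) := by
    simp only [fibP, fibQ]
    linear_combination (-(1 - y 1 * conj (y 1)) ^ 2) * he
  have hLM : fibL n e y * (baseH y ^ n * fibP e y + fibQ e y - y 1 * conj (y 1) * fibL n e y) =
      baseH y ^ n := by
    simp only [fibP, fibQ, fibL]
    linear_combination (-(1 - baseH y ^ n) ^ 2) * he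
  revert j
  refine Fin.forall_fin_two.2 ⟨?_, ?_⟩
  · have h1 := (hasWirtingerAt_coord_zero.mul hasWirtingerAt_baseH_inv).add
      ((((((hasWirtingerAt_baseH_pow n).const_mul n).mul hasWirtingerAt_coord_zero).mul
        hasWirtingerAt_baseH_inv).mul (hasWirtingerAt_fibP (e := e))).mul
        (hasWirtingerAt_fibD_inv hD) |>.const_mul s)
    -- Only the ∂-derivatives are entries of the metric; the ∂̄-derivatives are left unevaluated.
    refine h1.congr_coeff (Fin.forall_fin_two.2 ?_) (fun i => (h1.wirtingerBar_eq i).symm)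
    constructor
    · simp only [Pi.add_apply, Pi.smul_apply, smul_eq_mul, Matrix.cons_val_zero,
        hitchinMatrix, Matrix.of_apply]
      generalize (baseH y)⁻¹ = u at *
      generalize (fibD n e y)⁻¹ = v at *
      generalize baseH y ^ n = E at *
      generalize fibP e y = P at *
      generalize fibQ e y = Q at *
      linear_combination (-u - s * n * P * E * v * u) * hu +
        (-s * n ^ 2 * P * E * y 0 * conj (y 0) * u ^ 2 * v) * hv +
        (s * n ^ 2 * E * y 0 * conj (y 0) * u ^ 2 * v ^ 2) * hPQ
    · simp only [Pi.add_apply, Pi.smul_apply, smul_eq_mul, Matrix.cons_val_zero,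
        Matrix.cons_val_one, hitchinMatrix, Matrix.of_apply]
      generalize (baseH y)⁻¹ = u at *
      generalize (fibD n e y)⁻¹ = v at *
      generalize baseH y ^ n = E at *
      generalize fibP e y = P at *
      generalize fibQ e y = Q at *
      linear_combination (-s * n * E * y 0 * u * e * conj (y 1) * v) * hv +
        (s * n * E * y 0 * u * conj (y 1) * v ^ 2) * hPL
  · have h1 := ((hasWirtingerAt_fibL (n := n) (e := e)).mul hasWirtingerAt_coord_one).mul
      (hasWirtingerAt_fibD_inv hD) |>.const_mul s
    refine h1.congr_coeff (Fin.forall_fin_two.2 ?_) (fun i => (h1.wirtingerBar_eq i).symm)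
    constructor
    · simp only [Pi.add_apply, Pi.smul_apply, smul_eq_mul, Matrix.cons_val_zero,
        Matrix.cons_val_one, hitchinMatrix, Matrix.of_apply]
      generalize (baseH y)⁻¹ = u at *
      generalize (fibD n e y)⁻¹ = v at *
      generalize baseH y ^ n = E at *
      generalize fibP e y = P at *
      generalize fibQ e y = Q at *
      linear_combination (-s * n * E * conj (y 0) * u * e * y 1 * v) * hv +
        (s * n * E * conj (y 0) * u * y 1 * v ^ 2) * hPL
    · simp only [Pi.add_apply, Pi.smul_apply, smul_eq_mul, Matrix.cons_val_zero,
        Matrix.cons_val_one, hitchinMatrix, Matrix.of_apply]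
      generalize (baseH y)⁻¹ = u at *
      generalize (fibD n e y)⁻¹ = v at *
      generalize baseH y ^ n = E at *
      generalize fibP e y = P at *
      generalize fibQ e y = Q at *
      linear_combination (-s * fibL n e y * v) * hv + s * v ^ 2 * hLM

end HitchinModel

/-! ### First derivatives of the metric coefficients. -/

section HitchinCurvature

variable {n : ℕ} {e s : ℂ} {y x : CSpace 2}

/-- The quotient of `∂g₁₁/∂z̄₁` by `z₁`. -/
def hitchinDerivBase (n : ℕ) (s e : ℂ) (z : CSpace 2) : ℂ :=
  -2 * (baseH z)⁻¹ ^ 3 + s * n * baseH z ^ n * fibP e z * (baseH z)⁻¹ ^ 3 * (fibD n e z)⁻¹ *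
      (n - 2 - n * baseH z ^ n * fibP e z * (fibD n e z)⁻¹) +
    s * n ^ 2 * (z 1 * conj (z 1)) * (baseH z ^ n * (baseH z)⁻¹ ^ 2 * (fibD n e z)⁻¹ ^ 2 +
      z 0 * conj (z 0) * ((n - 2) * baseH z ^ n * (baseH z)⁻¹ ^ 3 * (fibD n e z)⁻¹ ^ 2 -
        2 * n * (baseH z ^ n) ^ 2 * fibP e z * (baseH z)⁻¹ ^ 3 * (fibD n e z)⁻¹ ^ 3))

/-- The factor of `|z₁|² z₂` in `∂g₁₁/∂z̄₂`. -/
def hitchinDerivFibre (n : ℕ) (s e : ℂ) (z : CSpace 2) : ℂ :=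
  s * n ^ 2 * baseH z ^ n * (baseH z)⁻¹ ^ 2 * (fibD n e z)⁻¹ ^ 2 *
    (1 - 2 * (z 1 * conj (z 1)) * fibL n e z * (fibD n e z)⁻¹)

/-- The factor of `z̄₁² z₂` in `∂g₁₂/∂z₁`. -/
def hitchinDerivMixed (n : ℕ) (s e : ℂ) (z : CSpace 2) : ℂ :=
  -(s * n * (1 - 2 * e)) * ((n - 1) * baseH z ^ n * (baseH z)⁻¹ ^ 2 * (fibD n e z)⁻¹ ^ 2 -
    2 * n * (baseH z ^ n) ^ 2 * fibP e z * (baseH z)⁻¹ ^ 2 * (fibD n e z)⁻¹ ^ 3)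

/-- First derivatives are needed at all points, since they are differentiated again. They are sorted
into explicit terms and multiples of z₁ or its conjugate: over z₁ = 0 the differential of z₁K is K
dz₁, so the complicated cofactors K need never be differentiated. The other three entries are
treated alike. -/
lemma hasWirtingerAt_hitchinMatrix_zero_zero (hD : fibD n e y ≠ 0) :
    HasWirtingerAt (fun z => hitchinMatrix n s e z 0 0)
      ![conj (y 0) * hitchinDerivBase n s e y,
        -(s * n * (1 - 2 * e)) * (baseH y ^ n * conj (y 1) * (baseH y)⁻¹ ^ 2 *
          (fibD n e y)⁻¹ ^ 2) + conj (y 0) * (y 0 * conj (y 1) * hitchinDerivFibre n s e y)]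
      ![y 0 * hitchinDerivBase n s e y,
        -(s * n * (1 - 2 * e)) * (baseH y ^ n * y 1 * (baseH y)⁻¹ ^ 2 *
          (fibD n e y)⁻¹ ^ 2) + y 0 * (conj (y 0) * y 1 * hitchinDerivFibre n s e y)] y := by
  have hv : (fibD n e y)⁻¹ * (baseH y ^ n * fibP e y + fibQ e y) = 1 := inv_mul_cancel₀ hD
  have hPL : e * (baseH y ^ n * fibP e y + fibQ e y) - fibP e y * fibL n e y = 2 * e - 1 := by
    simp only [fibP, fibQ, fibL]; ring
  have hE := hasWirtingerAt_baseH_pow (y := y) n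
  have hu := hasWirtingerAt_baseH_inv (y := y)
  have hV := hasWirtingerAt_fibD_inv hD
  have hP := hasWirtingerAt_fibP (e := e) (y := y)
  have h0 := hasWirtingerAt_coord_zero (y := y)
  have h1 := hasWirtingerAt_coord_one (y := y)
  have h := ((hu.pow 2).add ((((hE.mul hP).mul (hu.pow 2)).mul hV).const_mul (s * n))).add
    (((((hE.mul (h1.mul h1.conj_comp)).mul (h0.mul h0.conj_comp)).mul (hu.pow 2)).mul
      (hV.pow 2)).const_mul (s * n ^ 2))
  refine h.congr_coeff (Fin.forall_fin_two.2 ⟨?_, ?_⟩) (Fin.forall_fin_two.2 ⟨?_, ?_⟩) <;>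
  · simp only [Pi.add_apply, Pi.smul_apply, smul_eq_mul, Matrix.cons_val_zero,
      Matrix.cons_val_one, hitchinDerivBase, hitchinDerivFibre, map_one, map_zero, mul_zero,
      add_zero, zero_add, mul_one, pow_one, Nat.cast_ofNat, Nat.add_one_sub_one]
    generalize (baseH y)⁻¹ = u at *
    generalize (fibD n e y)⁻¹ = v at *
    generalize baseH y ^ n = E at *
    generalize fibP e y = P at *
    generalize fibQ e y = Q at *
    first
    | ring1
    | linear_combination (-s * n * E * u ^ 2 * e * conj (y 1) * v) * hv +
        (s * n * E * u ^ 2 * conj (y 1) * v ^ 2) * hPL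
    | linear_combination (-s * n * E * u ^ 2 * e * y 1 * v) * hv +
        (s * n * E * u ^ 2 * y 1 * v ^ 2) * hPL

lemma hasWirtingerAt_hitchinMatrix_zero_one (hD : fibD n e y ≠ 0) :
    HasWirtingerAt (fun z => hitchinMatrix n s e z 0 1)
      ![conj (y 0) ^ 2 * y 1 * hitchinDerivMixed n s e y,
        -(s * n * (1 - 2 * e)) * conj (y 0) * (baseH y ^ n * (baseH y)⁻¹ *
          ((fibD n e y)⁻¹ ^ 2 - 2 * (y 1 * conj (y 1)) * fibL n e y * (fibD n e y)⁻¹ ^ 3))]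
      ![-(s * n * (1 - 2 * e)) * (y 1 * baseH y ^ n * (baseH y)⁻¹ * (fibD n e y)⁻¹ ^ 2) +
          y 0 * (conj (y 0) * y 1 * hitchinDerivMixed n s e y),
        conj (y 0) * (2 * (s * n * (1 - 2 * e)) * baseH y ^ n * y 1 ^ 2 * (baseH y)⁻¹ *
          fibL n e y * (fibD n e y)⁻¹ ^ 3)] y := by
  have hE := hasWirtingerAt_baseH_pow (y := y) n
  have hu := hasWirtingerAt_baseH_inv (y := y)
  have hV := hasWirtingerAt_fibD_inv hD
  have h0 := hasWirtingerAt_coord_zero (y := y)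
  have h1 := hasWirtingerAt_coord_one (y := y)
  have h := ((((hE.mul h0.conj_comp).mul h1).mul hu).mul (hV.pow 2)).const_mul
    (-(s * n * (1 - 2 * e)))
  refine h.congr_coeff (Fin.forall_fin_two.2 ⟨?_, ?_⟩) (Fin.forall_fin_two.2 ⟨?_, ?_⟩) <;>
  · simp only [Pi.add_apply, Pi.smul_apply, smul_eq_mul, Matrix.cons_val_zero,
      Matrix.cons_val_one, hitchinDerivMixed, map_one, map_zero, mul_zero,
      add_zero, zero_add, mul_one, pow_one, Nat.cast_ofNat, Nat.add_one_sub_one]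
    ring

lemma hasWirtingerAt_hitchinMatrix_one_zero (hD : fibD n e y ≠ 0) :
    HasWirtingerAt (fun z => hitchinMatrix n s e z 1 0)
      ![-(s * n * (1 - 2 * e)) * (conj (y 1) * baseH y ^ n * (baseH y)⁻¹ * (fibD n e y)⁻¹ ^ 2) +
          conj (y 0) * (y 0 * conj (y 1) * hitchinDerivMixed n s e y),
        y 0 * (2 * (s * n * (1 - 2 * e)) * baseH y ^ n * conj (y 1) ^ 2 * (baseH y)⁻¹ *
          fibL n e y * (fibD n e y)⁻¹ ^ 3)]
      ![y 0 * (y 0 * conj (y 1) * hitchinDerivMixed n s e y),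
        y 0 * (-(s * n * (1 - 2 * e)) * (baseH y ^ n * (baseH y)⁻¹ *
          ((fibD n e y)⁻¹ ^ 2 - 2 * (y 1 * conj (y 1)) * fibL n e y * (fibD n e y)⁻¹ ^ 3)))] y := by
  have hE := hasWirtingerAt_baseH_pow (y := y) n
  have hu := hasWirtingerAt_baseH_inv (y := y)
  have hV := hasWirtingerAt_fibD_inv hD
  have h0 := hasWirtingerAt_coord_zero (y := y)
  have h1 := hasWirtingerAt_coord_one (y := y)
  have h := ((((hE.mul h0).mul h1.conj_comp).mul hu).mul (hV.pow 2)).const_mul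
    (-(s * n * (1 - 2 * e)))
  refine h.congr_coeff (Fin.forall_fin_two.2 ⟨?_, ?_⟩) (Fin.forall_fin_two.2 ⟨?_, ?_⟩) <;>
  · simp only [Pi.add_apply, Pi.smul_apply, smul_eq_mul, Matrix.cons_val_zero,
      Matrix.cons_val_one, hitchinDerivMixed, map_one, map_zero, mul_zero,
      add_zero, zero_add, mul_one, pow_one, Nat.cast_ofNat, Nat.add_one_sub_one]
    ring

lemma hasWirtingerAt_hitchinMatrix_one_one (hD : fibD n e y ≠ 0) :
    HasWirtingerAt (fun z => hitchinMatrix n s e z 1 1)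
      ![conj (y 0) * (s * n * (baseH y ^ n * (baseH y)⁻¹ * (fibD n e y)⁻¹ ^ 2 -
          2 * (baseH y ^ n) ^ 2 * fibP e y * (baseH y)⁻¹ * (fibD n e y)⁻¹ ^ 3)),
        -2 * s * (baseH y ^ n * fibL n e y * conj (y 1) * (fibD n e y)⁻¹ ^ 3)]
      ![y 0 * (s * n * (baseH y ^ n * (baseH y)⁻¹ * (fibD n e y)⁻¹ ^ 2 -
          2 * (baseH y ^ n) ^ 2 * fibP e y * (baseH y)⁻¹ * (fibD n e y)⁻¹ ^ 3)),
        -2 * s * (baseH y ^ n * fibL n e y * y 1 * (fibD n e y)⁻¹ ^ 3)] y := by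
  have hE := hasWirtingerAt_baseH_pow (y := y) n
  have hV := hasWirtingerAt_fibD_inv hD
  have h := ((hE.mul (hV.pow 2)).const_mul s)
  refine h.congr_coeff (Fin.forall_fin_two.2 ⟨?_, ?_⟩) (Fin.forall_fin_two.2 ⟨?_, ?_⟩) <;>
  · simp only [Pi.add_apply, Pi.smul_apply, smul_eq_mul, Matrix.cons_val_zero,
      Matrix.cons_val_one, mul_zero, add_zero, pow_one, Nat.cast_ofNat, Nat.add_one_sub_one]
    ring

/-- A product `z₁ K` at a point of the fibre over `z₁ = 0`. -/
lemma hasWirtingerAt_coord_zero_mul {K : CSpace 2 → ℂ} (hK : DifferentiableAt ℝ K x)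
    (hx : x 0 = 0) : HasWirtingerAt (fun z => z 0 * K z) ![K x, 0] ![0, 0] x :=
  (hasWirtingerAt_coord_zero.mul hK.hasWirtingerAt).congr_coeff
    (Fin.forall_fin_two.2 ⟨by simp [hx], by simp [hx]⟩)
    (Fin.forall_fin_two.2 ⟨by simp [hx], by simp [hx]⟩)

lemma hasWirtingerAt_conj_coord_zero_mul {K : CSpace 2 → ℂ} (hK : DifferentiableAt ℝ K x)
    (hx : x 0 = 0) : HasWirtingerAt (fun z => conj (z 0) * K z) ![0, 0] ![K x, 0] x :=
  (hasWirtingerAt_coord_zero.conj_comp.mul hK.hasWirtingerAt).congr_coeff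
    (Fin.forall_fin_two.2 ⟨by simp [hx], by simp [hx]⟩)
    (Fin.forall_fin_two.2 ⟨by simp [hx], by simp [hx]⟩)

end HitchinCurvature

/-! ### Second derivatives of the coefficients over z₁ = 0. -/

section HitchinCurvature

variable {n : ℕ} {e s : ℂ} {y x : CSpace 2}

lemma differentiableAt_baseH : DifferentiableAt ℝ baseH x :=
  HasFDerivAt.differentiableAt hasWirtingerAt_baseH

lemma differentiableAt_fibP : DifferentiableAt ℝ (fibP e) x :=
  HasFDerivAt.differentiableAt hasWirtingerAt_fibP

lemma differentiableAt_fibD : DifferentiableAt ℝ (fibD n e) x :=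
  HasFDerivAt.differentiableAt hasWirtingerAt_fibD

lemma differentiableAt_fibL : DifferentiableAt ℝ (fibL n e) x :=
  HasFDerivAt.differentiableAt hasWirtingerAt_fibL

lemma differentiableAt_conj_coord (k : Fin 2) :
    DifferentiableAt ℝ (fun z : CSpace 2 => conj (z k)) x :=
  HasFDerivAt.differentiableAt (HasWirtingerAt.coord k).conj_comp

lemma differentiableAt_hitchinDerivBase (hD : fibD n e x ≠ 0) :
    DifferentiableAt ℝ (hitchinDerivBase n s e) x := by
  have h1 := differentiableAt_baseH (x := x)
  have h2 := differentiableAt_fibP (e := e) (x := x)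
  have h3 := differentiableAt_fibD (n := n) (e := e) (x := x)
  have h4 := differentiableAt_conj_coord (x := x)
  have h5 := baseH_ne_zero x
  unfold hitchinDerivBase
  fun_prop (disch := assumption)

lemma differentiableAt_hitchinDerivFibre (hD : fibD n e x ≠ 0) :
    DifferentiableAt ℝ (hitchinDerivFibre n s e) x := by
  have h1 := differentiableAt_baseH (x := x)
  have h2 := differentiableAt_fibL (n := n) (e := e) (x := x)
  have h3 := differentiableAt_fibD (n := n) (e := e) (x := x)
  have h4 := differentiableAt_conj_coord (x := x)
  have h5 := baseH_ne_zero x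
  unfold hitchinDerivFibre
  fun_prop (disch := assumption)

lemma differentiableAt_hitchinDerivMixed (hD : fibD n e x ≠ 0) :
    DifferentiableAt ℝ (hitchinDerivMixed n s e) x := by
  have h1 := differentiableAt_baseH (x := x)
  have h2 := differentiableAt_fibP (e := e) (x := x)
  have h3 := differentiableAt_fibD (n := n) (e := e) (x := x)
  have h5 := baseH_ne_zero x
  unfold hitchinDerivMixed
  fun_prop (disch := assumption)

lemma delDir_delBarDir_two {f : CSpace 2 → ℂ} {b0 b1 : CSpace 2 → ℂ} {c0 c1 c0' c1' : CSpace 2}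
    (h : ∀ y, ∃ a, HasWirtingerAt f a ![b0 y, b1 y] y) (h0 : HasWirtingerAt b0 c0 c0' x)
    (h1 : HasWirtingerAt b1 c1 c1' x) (ξ : CSpace 2) :
    delDir ξ (delBarDir ξ f) x = conj (ξ 0) * (ξ 0 * c0 0 + ξ 1 * c0 1) +
      conj (ξ 1) * (ξ 0 * c1 0 + ξ 1 * c1 1) := by
  have hb : delBarDir ξ f = fun y => conj (ξ 0) * b0 y + conj (ξ 1) * b1 y := by
    funext y
    obtain ⟨a, ha⟩ := h y
    rw [ha.delBarDir_eq]
    simp [Fin.sum_univ_two]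
  rw [hb, ((h0.const_mul (conj (ξ 0))).add (h1.const_mul (conj (ξ 1)))).delDir_eq]
  simp [Fin.sum_univ_two]
  ring

lemma baseH_centre (hx : x 0 = 0) : baseH x = 1 := by simp [baseH, hx]

lemma fibL_centre (hx : x 0 = 0) : fibL n e x = 1 := by simp [fibL, baseH_centre hx]

lemma hasWirtingerAt_baseH_pow_centre (hx : x 0 = 0) : HasWirtingerAt (fun z => baseH z ^ n) ![0, 0] ![0, 0] x := by
  simpa [hx] using hasWirtingerAt_baseH_pow (y := x) n

lemma hasWirtingerAt_baseH_inv_centre (hx : x 0 = 0) :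
    HasWirtingerAt (fun z => (baseH z)⁻¹) ![0, 0] ![0, 0] x := by
  simpa [hx] using hasWirtingerAt_baseH_inv (y := x)

lemma hasWirtingerAt_fibL_centre (hx : x 0 = 0) : HasWirtingerAt (fibL n e) ![0, 0] ![0, 0] x := by
  simpa [hx] using hasWirtingerAt_fibL (n := n) (e := e) (y := x)

lemma hasWirtingerAt_fibD_inv_centre (hx : x 0 = 0) (hD : fibD n e x ≠ 0) :
    HasWirtingerAt (fun z => (fibD n e z)⁻¹) ![0, -(conj (x 1) * (fibD n e x)⁻¹ ^ 2)]
      ![0, -(x 1 * (fibD n e x)⁻¹ ^ 2)] x := by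
  simpa [hx, fibL_centre hx] using hasWirtingerAt_fibD_inv hD

lemma delDir_delBarDir_hitchinMatrix_zero_zero (hx : x 0 = 0) (hD : ∀ y, fibD n e y ≠ 0) (ξ : CSpace 2) :
    delDir ξ (delBarDir ξ fun z => hitchinMatrix n s e z 0 0) x =
      conj (ξ 0) * ξ 0 * hitchinDerivBase n s e x - conj (ξ 1) * ξ 1 * (s * n * (1 - 2 * e)) *
        ((fibD n e x)⁻¹ ^ 2 - 2 * (x 1 * conj (x 1)) * (fibD n e x)⁻¹ ^ 3) := by
  have hK := differentiableAt_hitchinDerivFibre (s := s) (hD x)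
  have h4 := differentiableAt_conj_coord (x := x)
  rw [delDir_delBarDir_two (fun y => ⟨_, hasWirtingerAt_hitchinMatrix_zero_zero (hD y)⟩)
    (hasWirtingerAt_coord_zero_mul (differentiableAt_hitchinDerivBase (hD x)) hx)
    ((((((hasWirtingerAt_baseH_pow_centre hx).mul hasWirtingerAt_coord_one).mul
      ((hasWirtingerAt_baseH_inv_centre hx).pow 2)).mul
      ((hasWirtingerAt_fibD_inv_centre hx (hD x)).pow 2)).const_mul
        (-(s * n * (1 - 2 * e)))).add (hasWirtingerAt_coord_zero_mul (by fun_prop) hx))]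
  simp [hx, baseH_centre hx]
  ring

lemma delDir_delBarDir_hitchinMatrix_zero_one (hx : x 0 = 0) (hD : ∀ y, fibD n e y ≠ 0) (ξ : CSpace 2) :
    delDir ξ (delBarDir ξ fun z => hitchinMatrix n s e z 0 1) x =
      -(conj (ξ 0) * ξ 1 * (s * n * (1 - 2 * e)) *
        ((fibD n e x)⁻¹ ^ 2 - 2 * (x 1 * conj (x 1)) * (fibD n e x)⁻¹ ^ 3)) := by
  have hK := differentiableAt_hitchinDerivMixed (s := s) (hD x)
  have h1 := differentiableAt_baseH (x := x)
  have h2 := differentiableAt_fibL (n := n) (e := e) (x := x)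
  have h3 := differentiableAt_fibD (n := n) (e := e) (x := x)
  have h4 := differentiableAt_conj_coord (x := x)
  have h5 := baseH_ne_zero x
  have h6 := hD x
  rw [delDir_delBarDir_two (fun y => ⟨_, hasWirtingerAt_hitchinMatrix_zero_one (hD y)⟩)
    ((((((hasWirtingerAt_coord_one).mul (hasWirtingerAt_baseH_pow_centre hx)).mul
      (hasWirtingerAt_baseH_inv_centre hx)).mul
      ((hasWirtingerAt_fibD_inv_centre hx (hD x)).pow 2)).const_mul
        (-(s * n * (1 - 2 * e)))).add (hasWirtingerAt_coord_zero_mul (by fun_prop) hx))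
    (hasWirtingerAt_conj_coord_zero_mul (by fun_prop (disch := assumption)) hx)]
  simp [hx, baseH_centre hx]
  ring

lemma delDir_delBarDir_hitchinMatrix_one_zero (hx : x 0 = 0) (hD : ∀ y, fibD n e y ≠ 0) (ξ : CSpace 2) :
    delDir ξ (delBarDir ξ fun z => hitchinMatrix n s e z 1 0) x =
      -(conj (ξ 1) * ξ 0 * (s * n * (1 - 2 * e)) *
        ((fibD n e x)⁻¹ ^ 2 - 2 * (x 1 * conj (x 1)) * (fibD n e x)⁻¹ ^ 3)) := by
  have hK := differentiableAt_hitchinDerivMixed (s := s) (hD x)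
  have h1 := differentiableAt_baseH (x := x)
  have h2 := differentiableAt_fibL (n := n) (e := e) (x := x)
  have h3 := differentiableAt_fibD (n := n) (e := e) (x := x)
  have h4 := differentiableAt_conj_coord (x := x)
  have h5 := baseH_ne_zero x
  have h6 := hD x
  rw [delDir_delBarDir_two (fun y => ⟨_, hasWirtingerAt_hitchinMatrix_one_zero (hD y)⟩)
    (hasWirtingerAt_coord_zero_mul (by fun_prop) hx)
    (hasWirtingerAt_coord_zero_mul (by fun_prop (disch := assumption)) hx)]
  simp [hx, baseH_centre hx, fibL_centre hx]
  ring

lemma delDir_delBarDir_hitchinMatrix_one_one (hx : x 0 = 0) (hD : ∀ y, fibD n e y ≠ 0) (ξ : CSpace 2) :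
    delDir ξ (delBarDir ξ fun z => hitchinMatrix n s e z 1 1) x =
      conj (ξ 0) * ξ 0 * (s * n * ((fibD n e x)⁻¹ ^ 2 - 2 * fibP e x * (fibD n e x)⁻¹ ^ 3)) -
        conj (ξ 1) * ξ 1 * (2 * s) * ((fibD n e x)⁻¹ ^ 3 -
          3 * (x 1 * conj (x 1)) * (fibD n e x)⁻¹ ^ 4) := by
  have h1 := differentiableAt_baseH (x := x)
  have h2 := differentiableAt_fibP (e := e) (x := x)
  have h3 := differentiableAt_fibD (n := n) (e := e) (x := x)
  have h5 := baseH_ne_zero x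
  have h6 := hD x
  rw [delDir_delBarDir_two (fun y => ⟨_, hasWirtingerAt_hitchinMatrix_one_one (hD y)⟩)
    (hasWirtingerAt_coord_zero_mul (by fun_prop (disch := assumption)) hx)
    (((((hasWirtingerAt_baseH_pow_centre hx).mul (hasWirtingerAt_fibL_centre hx)).mul
      hasWirtingerAt_coord_one).mul
      ((hasWirtingerAt_fibD_inv_centre hx (hD x)).pow 3)).const_mul (-2 * s))]
  simp [baseH_centre hx, fibL_centre hx]
  ring

/-- The off-diagonal entries contain z₁ or its conjugate as a factor. -/
lemma hitchinMatrix_centre (hx : x 0 = 0) :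
    hitchinMatrix n s e x = Matrix.diagonal ![1 + s * n * (fibP e x * (fibD n e x)⁻¹),
      s * (fibD n e x)⁻¹ ^ 2] := by
  ext i j
  fin_cases i <;> fin_cases j <;> simp [hitchinMatrix, hx, baseH_centre hx]

end HitchinCurvature

/-! ### The contracted curvature over z₁ = 0. -/

section HitchinCurvature

variable {n : ℕ} {e s : ℂ} {x : CSpace 2}

lemma Matrix.inv_diagonal_two {a b : ℂ} (ha : a ≠ 0) (hb : b ≠ 0) :
    (Matrix.diagonal ![a, b])⁻¹ = Matrix.diagonal ![a⁻¹, b⁻¹] := by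
  refine Matrix.inv_eq_right_inv ?_
  ext i j
  fin_cases i <;> fin_cases j <;> simp [ha, hb]

/-- The numerator of the holomorphic sectional curvature at a point over `z₁ = 0`. -/
lemma sum_curvatureForm_hitchinMatrix (hx : x 0 = 0) (he : e = 0 ∨ e = 1)
    (hD : ∀ y, fibD n e y ≠ 0) (hs : s ≠ 0) {t v : ℂ} (hv : v = (fibD n e x)⁻¹)
    (ht : t = fibP e x * v) (hg : 1 + s * n * t ≠ 0) (ξ : CSpace 2) :
    ∑ i, ∑ j, ξ i * curvatureForm (hitchinMatrix n s e) x ξ i j * conj (ξ j) =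
      (2 + 2 * s * n * t * (1 - n + n * t)) * (ξ 0 * conj (ξ 0)) ^ 2 +
        4 * (n * (-1 + 2 * t + s * n * t ^ 2) / (1 + s * n * t)) * (ξ 0 * conj (ξ 0)) *
          (s * v ^ 2 * (ξ 1 * conj (ξ 1))) + 2 * s * v ^ 4 * (ξ 1 * conj (ξ 1)) ^ 2 := by
  have hv0 : v ≠ 0 := hv ▸ inv_ne_zero (hD x)
  -- Over z₁ = 0 the denominator is 1 + |z₂|² in both types of chart.
  have hD0 : v * (1 + x 1 * conj (x 1)) = 1 := by
    rw [hv, show 1 + x 1 * conj (x 1) = fibD n e x by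
      simp only [fibD, fibP, fibQ, baseH_centre hx]; ring]
    exact inv_mul_cancel₀ (hD x)
  have hr : x 1 * conj (x 1) = v⁻¹ - 1 := by
    field_simp
    linear_combination hD0
  have hinv : (hitchinMatrix n s e x)⁻¹ =
      Matrix.diagonal ![(1 + s * n * t)⁻¹, (s * v ^ 2)⁻¹] := by
    rw [hitchinMatrix_centre hx, ← hv, ← ht]
    exact Matrix.inv_diagonal_two hg (mul_ne_zero hs (pow_ne_zero _ hv0))
  have h00 := hasWirtingerAt_hitchinMatrix_zero_zero (s := s) (hD x)
  have h01 := hasWirtingerAt_hitchinMatrix_zero_one (s := s) (hD x)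
  have h10 := hasWirtingerAt_hitchinMatrix_one_zero (s := s) (hD x)
  have h11 := hasWirtingerAt_hitchinMatrix_one_one (s := s) (hD x)
  have hK : hitchinDerivBase n s e x = -2 + s * n * t * (n - 2 - n * t) +
      s * n ^ 2 * (x 1 * conj (x 1)) * v ^ 2 := by
    simp [hitchinDerivBase, baseH_centre hx, hx, ← hv, ht]
    ring
  simp only [curvatureForm, Matrix.add_apply, Matrix.neg_apply, Matrix.mul_apply,
    Fin.sum_univ_two, matDel, matDelBar, Matrix.of_apply,
    delDir_delBarDir_hitchinMatrix_zero_zero hx hD, delDir_delBarDir_hitchinMatrix_zero_one hx hD,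
    delDir_delBarDir_hitchinMatrix_one_zero hx hD, delDir_delBarDir_hitchinMatrix_one_one hx hD,
    h00.delDir_eq, h01.delDir_eq, h10.delDir_eq, h11.delDir_eq,
    h00.delBarDir_eq, h01.delBarDir_eq, h10.delBarDir_eq, h11.delBarDir_eq, hinv, hK]
  simp only [Matrix.cons_val_zero, Matrix.cons_val_one, hx, baseH_centre hx, fibL_centre hx, ← hv,
    Matrix.diagonal_apply, map_zero, one_pow, inv_one, if_true, if_false, Fin.isValue,
    zero_ne_one, one_ne_zero]
  have hPe : fibP e x = (1 - e) + e * (x 1 * conj (x 1)) := rfl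
  generalize conj (ξ 0) = X
  generalize conj (ξ 1) = Y
  generalize conj (x 1) = c at *
  -- Here |z₂|² = 1/v - 1, while t is v for e = 0 and 1 - v for e = 1. The conjugate of z₂ is
  -- eliminated by dividing by z₂, so the point z₂ = 0, where v = 1, is treated separately.
  rcases he with rfl | rfl
  · have htv : t = v := by rw [ht, hPe]; ring
    subst htv
    rw [hPe]
    by_cases hx1 : x 1 = 0
    · have : t = 1 := by rw [hx1] at hD0; linear_combination hD0
      subst this
      rw [mul_one] at hg
      simp only [hx1, mul_one]
      field_simp
      ring
    · have hc : c = (t⁻¹ - 1) / x 1 := by field_simp at hr ⊢; exact hr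
      rw [hc]
      field_simp
      ring
  · have htv : t = 1 - v := by rw [ht, hPe, hr]; field_simp; ring
    subst htv
    rw [hPe]
    by_cases hx1 : x 1 = 0
    · have : v = 1 := by rw [hx1] at hD0; linear_combination hD0
      subst this
      simp only [hx1]
      field_simp
      ring
    · have hc : c = (v⁻¹ - 1) / x 1 := by field_simp at hr ⊢; exact hr
      rw [hc]
      field_simp
      ring

end HitchinCurvature

/-! ### The potentials in the four charts and positivity of their Hessians. -/

section ChartPotential

variable {n : ℕ} {s : ℝ} {i j : Fin 2}

/-- `|x₀|² + |x₁|²` in homogeneous coordinates. -/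
def baseNorm (p : (Fin 2 → ℂ) × (Fin 2 → ℂ)) : ℝ := ‖p.1 0‖ ^ 2 + ‖p.1 1‖ ^ 2

/-- `(|x₀|² + |x₁|²)ⁿ |y₀|² + |y₁|²` in homogeneous coordinates. -/
def fibreNorm (n : ℕ) (p : (Fin 2 → ℂ) × (Fin 2 → ℂ)) : ℝ :=
  baseNorm p ^ n * ‖p.2 0‖ ^ 2 + ‖p.2 1‖ ^ 2

/-- The potential in homogeneous coordinates. -/
def homPot (n : ℕ) (s : ℝ) (p : (Fin 2 → ℂ) × (Fin 2 → ℂ)) : ℝ :=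
  Real.log (baseNorm p) + s * Real.log (fibreNorm n p)

/-- The potential in the standard charts. -/
def chartPot (n : ℕ) (s : ℝ) (i j : Fin 2) (z : CSpace 2) : ℝ := homPot n s (preLift i j z)

/-- The value of the parameter `e` of `hitchinMatrix` in the chart with `y_j ≠ 0`. -/
def fibParam (j : Fin 2) : ℂ := if j = 0 then 0 else 1

lemma fibParam_eq (j : Fin 2) : fibParam j = 0 ∨ fibParam j = 1 := by
  unfold fibParam; split_ifs <;> simp

lemma fibParam_mul_self (j : Fin 2) : fibParam j * fibParam j = fibParam j := by
  rcases fibParam_eq j with h | h <;> simp [h]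

lemma baseNorm_pos {p : (Fin 2 → ℂ) × (Fin 2 → ℂ)} (hp : p.1 ≠ 0) : 0 < baseNorm p := by
  obtain ⟨k, hk⟩ := Function.ne_iff.1 hp
  have hk : 0 < ‖p.1 k‖ := norm_pos_iff.2 hk
  unfold baseNorm
  fin_cases k <;> simp only [Fin.zero_eta, Fin.mk_one] at hk <;> positivity

lemma fibreNorm_pos {p : (Fin 2 → ℂ) × (Fin 2 → ℂ)} (hp : p.1 ≠ 0) (hp' : p.2 ≠ 0) :
    0 < fibreNorm n p := by
  obtain ⟨k, hk⟩ := Function.ne_iff.1 hp'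
  have hk : 0 < ‖p.2 k‖ := norm_pos_iff.2 hk
  have := baseNorm_pos hp
  unfold fibreNorm
  fin_cases k <;> simp only [Fin.zero_eta, Fin.mk_one] at hk <;> positivity

lemma baseNorm_preLift (i j : Fin 2) (z : CSpace 2) :
    baseNorm (preLift i j z) = 1 + ‖z 0‖ ^ 2 := by
  fin_cases i <;> simp [baseNorm, preLift, add_comm]

lemma baseNorm_preLift_cast (i j : Fin 2) (z : CSpace 2) :
    ((baseNorm (preLift i j z) : ℝ) : ℂ) = baseH z := by
  rw [baseNorm_preLift, baseH_eq_ofReal]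

lemma fibreNorm_preLift_cast (i j : Fin 2) (z : CSpace 2) :
    ((fibreNorm n (preLift i j z) : ℝ) : ℂ) = fibD n (fibParam j) z := by
  rw [fibreNorm, fibD, ← baseNorm_preLift_cast i j]
  push_cast
  fin_cases j <;> simp [fibP, fibQ, fibParam, preLift, Complex.mul_conj']

lemma baseNorm_preLift_pos (i j : Fin 2) (z : CSpace 2) : 0 < baseNorm (preLift i j z) :=
  baseNorm_pos (lift i j z).2.1

lemma fibreNorm_preLift_pos (i j : Fin 2) (z : CSpace 2) : 0 < fibreNorm n (preLift i j z) :=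
  fibreNorm_pos (lift i j z).2.1 (lift i j z).2.2

lemma fibD_fibParam_ne_zero (j : Fin 2) (z : CSpace 2) : fibD n (fibParam j) z ≠ 0 := by
  rw [← fibreNorm_preLift_cast 0]
  exact_mod_cast (fibreNorm_preLift_pos 0 j z).ne'

lemma contDiff_preLift_fst {𝕜 : Type*} [NontriviallyNormedField 𝕜] [NormedAlgebra 𝕜 ℂ] (k : Fin 2)
    {N : WithTop ℕ∞} : ContDiff 𝕜 N fun z : CSpace 2 => (preLift i j z).1 k := by
  by_cases h : k = i <;> simp only [preLift, h, if_true, if_false] <;> fun_prop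

lemma contDiff_preLift_snd {𝕜 : Type*} [NontriviallyNormedField 𝕜] [NormedAlgebra 𝕜 ℂ] (k : Fin 2)
    {N : WithTop ℕ∞} : ContDiff 𝕜 N fun z : CSpace 2 => (preLift i j z).2 k := by
  by_cases h : k = j <;> simp only [preLift, h, if_true, if_false] <;> fun_prop

lemma contDiff_chartPot : ContDiff ℝ ∞ (chartPot n s i j) := by
  have hx : ∀ k, ContDiff ℝ ∞ fun z : CSpace 2 => ‖(preLift i j z).1 k‖ ^ 2 := fun k =>
    (contDiff_preLift_fst k).norm_sq ℝ
  have hy : ∀ k, ContDiff ℝ ∞ fun z : CSpace 2 => ‖(preLift i j z).2 k‖ ^ 2 := fun k =>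
    (contDiff_preLift_snd k).norm_sq ℝ
  have hb : ContDiff ℝ ∞ fun z => baseNorm (preLift i j z) := (hx 0).add (hx 1)
  have hf : ContDiff ℝ ∞ fun z => fibreNorm n (preLift i j z) :=
    ((hb.pow n).mul (hy 0)).add (hy 1)
  exact (hb.log fun z => (baseNorm_preLift_pos i j z).ne').add
    (contDiff_const.mul (hf.log fun z => (fibreNorm_preLift_pos i j z).ne'))

lemma wirtingerBar_chartPot (k : Fin 2) :
    wirtingerBar k (fun z => (chartPot n s i j z : ℂ)) = fun z =>
      (![z 0 * (baseH z)⁻¹ + s * (n * baseH z ^ n * z 0 * (baseH z)⁻¹ * fibP (fibParam j) z *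
          (fibD n (fibParam j) z)⁻¹),
        s * (fibL n (fibParam j) z * z 1 * (fibD n (fibParam j) z)⁻¹)] : CSpace 2) k := by
  funext z
  have hb := hasWirtingerAt_baseH.congr_of_eventuallyEq (x := z)
    (Eventually.of_forall fun z => baseNorm_preLift_cast i j z)
  have hf := (hasWirtingerAt_fibD (n := n)).congr_of_eventuallyEq (x := z)
    (Eventually.of_forall fun z => fibreNorm_preLift_cast i j z)
  have h : HasWirtingerAt (fun z => (chartPot n s i j z : ℂ)) _ _ z :=
    ((hb.log_ofReal (baseNorm_preLift_pos i j z)).add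
      ((hf.log_ofReal (fibreNorm_preLift_pos i j z)).const_mul s)).congr_of_eventuallyEq
      (Eventually.of_forall fun z => by simp [chartPot, homPot])
  rw [h.wirtingerBar_eq, baseNorm_preLift_cast, fibreNorm_preLift_cast]
  revert k
  refine Fin.forall_fin_two.2 ⟨?_, ?_⟩ <;>
  · simp only [Pi.add_apply, Pi.smul_apply, smul_eq_mul, Matrix.cons_val_zero, Matrix.cons_val_one]
    ring

/-- The right side does not involve `i`: the two base charts give the same coefficients, so
curvature computations may take `i = 0`. -/
lemma levi_chartPot (z : CSpace 2) :
    levi (chartPot n s i j) z = hitchinMatrix n s (fibParam j) z := by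
  ext a b
  rw [levi_apply, wirtingerBar_chartPot]
  exact (hasWirtingerAt_potentialBar (fibParam_mul_self j)
    (fibD_fibParam_ne_zero j z) b).wirtinger_eq a

lemma chartPot_zero_zero : chartPot n s 0 0 = hitchinPotential n s := by
  funext z
  rw [chartPot, homPot, fibreNorm, baseNorm_preLift]
  simp [hitchinPotential, preLift]

/-- `|y₀|²` in the chart with `y_j ≠ 0`, as a function of `|z₂|²`. -/
lemma fibP_eq_ofReal (i j : Fin 2) (z : CSpace 2) :
    fibP (fibParam j) z = ((‖(preLift i j z).2 0‖ ^ 2 : ℝ) : ℂ) := by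
  fin_cases j <;> simp [fibP, fibParam, preLift, Complex.mul_conj']

/-- Completing the square turns the Hermitian form into A|ξ₁|² + B|ξ₂ - q̄ξ₁|² with A, B > 0. -/
lemma posDef_hitchinMatrix (hs : 0 < s) (j : Fin 2) (z : CSpace 2) :
    (hitchinMatrix n s (fibParam j) z).PosDef := by
  set D : ℝ := fibreNorm n (preLift 0 j z) with hDdef
  set h : ℝ := 1 + ‖z 0‖ ^ 2 with hhdef
  set P : ℝ := ‖(preLift 0 j z).2 0‖ ^ 2 with hPdef
  have hDpos : 0 < D := fibreNorm_preLift_pos 0 j z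
  have hhpos : 0 < h := by positivity
  have hP0 : 0 ≤ P := by positivity
  have hD : fibD n (fibParam j) z = D := (fibreNorm_preLift_cast 0 j z).symm
  have hH : baseH z = h := baseH_eq_ofReal z
  have hP : fibP (fibParam j) z = P := fibP_eq_ofReal 0 j z
  have hq : (1 - 2 * fibParam j) ^ 2 = 1 := by
    rcases fibParam_eq j with h | h <;> rw [h] <;> ring
  have hcj : conj (fibParam j) = fibParam j := by
    rcases fibParam_eq j with h | h <;> rw [h] <;> simp
  refine Matrix.PosDef.of_dotProduct_mulVec_pos (Matrix.IsHermitian.ext ?_) fun ξ hξ => ?_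
  · refine Fin.forall_fin_two.2 ⟨Fin.forall_fin_two.2 ⟨?_, ?_⟩, Fin.forall_fin_two.2 ⟨?_, ?_⟩⟩ <;>
    · simp only [hitchinMatrix, hD, hH, hP, Matrix.of_apply, Matrix.cons_val_zero,
        Matrix.cons_val_one, map_add, map_sub, map_mul, map_neg, map_pow, map_inv₀,
        Complex.conj_ofReal, Complex.conj_natCast, Complex.conj_conj, hcj, map_one, map_ofNat,
        RCLike.star_def]
      try ring
  -- `q` is minus the upper right entry divided by the lower right entry `B`. Since (1 - 2e)² = 1,
  -- B|q|² is precisely the last summand of the upper left entry, and `A` is what remains.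
  · set q : ℂ := (1 - 2 * fibParam j) * n * conj (z 0) * z 1 * (h : ℂ)⁻¹ with hqdef
    set A : ℝ := h⁻¹ ^ 2 * (1 + s * n * h ^ n * P * D⁻¹) with hA
    set B : ℝ := s * h ^ n * D⁻¹ ^ 2 with hB
    have hApos : 0 < A := by positivity
    have hBpos : 0 < B := by positivity
    have key : star ξ ⬝ᵥ hitchinMatrix n s (fibParam j) z *ᵥ ξ =
        ((A * ‖ξ 0‖ ^ 2 + B * ‖ξ 1 - conj q * ξ 0‖ ^ 2 : ℝ) : ℂ) := by
      push_cast
      rw [← Complex.mul_conj', ← Complex.mul_conj', hA, hB]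
      push_cast
      simp only [hqdef, map_sub, map_mul, Complex.conj_conj, hcj, map_inv₀, Complex.conj_ofReal,
        Complex.conj_natCast, hitchinMatrix, hD, hH, hP, Matrix.mulVec, dotProduct,
        Fin.sum_univ_two, Matrix.of_apply, Matrix.cons_val_zero, Matrix.cons_val_one,
        Pi.star_apply, RCLike.star_def, map_one, map_ofNat]
      linear_combination (-s * (h : ℂ) ^ n * (D : ℂ)⁻¹ ^ 2 * (n : ℂ) ^ 2 * (h : ℂ)⁻¹ ^ 2 * z 0 *
        conj (z 0) * z 1 * conj (z 1) * ξ 0 * conj (ξ 0)) * hq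
    rw [key]
    refine Complex.zero_lt_real.2 ?_
    by_cases h0 : ξ 0 = 0
    · have h1 : ξ 1 ≠ 0 := fun h1 => hξ (funext (Fin.forall_fin_two.2 ⟨h0, h1⟩))
      have : 0 < ‖ξ 1‖ := norm_pos_iff.2 h1
      simp only [h0, mul_zero, sub_zero]
      positivity
    · have : 0 < ‖ξ 0‖ := norm_pos_iff.2 h0
      positivity

end ChartPotential

/-! ### Gluing, uniqueness and the Kähler property. -/

section HitchinMetric

variable {n : ℕ} {s : ℝ} {i j i' j' : Fin 2}

lemma fibre_smul {p q : (Fin 2 → ℂ) × (Fin 2 → ℂ)} {l u : ℂ} (h1 : ∀ k, q.1 k = l * p.1 k)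
    (h2 : q.2 0 = u * p.2 0) (h3 : q.2 1 = l ^ n * u * p.2 1) (i k : Fin 2) :
    fibre n i q k = l ^ n * u * fibre n i p k := by
  fin_cases k
  · simp only [fibre, Fin.zero_eta, Matrix.cons_val_zero, h1, h2]; ring
  · simp only [fibre, Fin.mk_one, Matrix.cons_val_one, h3]; simp

lemma homPot_smul {p q : (Fin 2 → ℂ) × (Fin 2 → ℂ)} {l u : ℂ} (hl : l ≠ 0) (hu : u ≠ 0)
    (h1 : ∀ k, q.1 k = l * p.1 k) (h2 : q.2 0 = u * p.2 0) (h3 : q.2 1 = l ^ n * u * p.2 1)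
    (hp : p.1 ≠ 0) (hp' : p.2 ≠ 0) :
    homPot n s q = homPot n s p + Real.log (‖l‖ ^ 2) + s * Real.log (‖l ^ n * u‖ ^ 2) := by
  have hb : baseNorm q = ‖l‖ ^ 2 * baseNorm p := by
    simp only [baseNorm, h1, norm_mul]; ring
  have hf : fibreNorm n q = ‖l ^ n * u‖ ^ 2 * fibreNorm n p := by
    simp only [fibreNorm, hb, h2, h3, norm_mul, norm_pow]; ring
  have hl' : ‖l‖ ^ 2 ≠ 0 := by simpa using hl
  have hu' : ‖l ^ n * u‖ ^ 2 ≠ 0 := by simp [hl, hu]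
  rw [homPot, homPot, hb, hf, Real.log_mul hl' (baseNorm_pos hp).ne',
    Real.log_mul hu' (fibreNorm_pos hp hp').ne']
  ring

lemma fibre_preLift (i j : Fin 2) (z : CSpace 2) : fibre n i (preLift i j z) j = 1 := by
  fin_cases j <;> simp [fibre, preLift]

/-- The chart potentials differ from the homogeneous potential by pluriharmonic functions. -/
lemma chartPot_preCoord (p : HirzebruchCone) (hi : p.1.1 i ≠ 0) (hj : p.1.2 j ≠ 0) :
    chartPot n s i j (preCoord n i j p.1) = homPot n s p.1 - Real.log (‖p.1.1 i‖ ^ 2) -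
      s * Real.log (‖fibre n i p.1 j‖ ^ 2) := by
  -- The normalised representative with x_i = y_j = 1 is compared with `p`; the scaling factors
  -- relating them are the coordinates by which one divides.
  have h : mk n (lift i j (coord n i j (mk n p))) = mk n p :=
    lift_coord i j (mk_mem_domain.2 ⟨hi, hj⟩)
  obtain ⟨l, u, h1, h2, h3⟩ := Quotient.exact (s := hirzebruchSetoid n) h
  have e1 : p.1.1 i = l := by rw [h1]; simp [HirzebruchSurface.lift, preLift]
  have e2 : fibre n i p.1 j = (l : ℂ) ^ n * u := by
    rw [fibre_smul h1 h2 h3]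
    simp only [HirzebruchSurface.lift, fibre_preLift, mul_one]
  rw [homPot_smul l.ne_zero u.ne_zero h1 h2 h3 (lift i j _).2.1 (lift i j _).2.2, e1, e2, chartPot]
  simp only [HirzebruchSurface.lift, coord_mk]
  ring

lemma contDiff_fibre_preLift {𝕜 : Type*} [NontriviallyNormedField 𝕜] [NormedAlgebra 𝕜 ℂ]
    {N : WithTop ℕ∞} (k : Fin 2) :
    ContDiff 𝕜 N fun z : CSpace 2 => fibre n i' (preLift i j z) k := by
  fin_cases k
  · exact ((contDiff_preLift_fst i').pow n).mul (contDiff_preLift_snd 0)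
  · exact contDiff_preLift_snd 1

/-- The changes of coordinates are holomorphic. -/
lemma contDiffAt_preCoord_preLift {z : CSpace 2} (hi : (preLift i j z).1 i' ≠ 0)
    (hj : (preLift i j z).2 j' ≠ 0) :
    ContDiffAt ℂ ω (fun z : CSpace 2 => preCoord n i' j' (preLift i j z)) z := by
  refine contDiffAt_pi.2 fun k => ?_
  fin_cases k
  · exact (contDiff_preLift_fst (i' + 1)).contDiffAt.div (contDiff_preLift_fst i').contDiffAt hi
  · exact (contDiff_fibre_preLift (j' + 1)).contDiffAt.div (contDiff_fibre_preLift j').contDiffAt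
      (fibre_ne_zero hi hj)

lemma eventually_preLift_ne_zero {z : CSpace 2} (hi : (preLift i j z).1 i' ≠ 0)
    (hj : (preLift i j z).2 j' ≠ 0) :
    ∀ᶠ y in 𝓝 z, (preLift i j y).1 i' ≠ 0 ∧ (preLift i j y).2 j' ≠ 0 := by
  have h1 := (contDiff_preLift_fst (i := i) (j := j) (𝕜 := ℂ) (N := 0) i').continuous.continuousAt
    |>.eventually (isOpen_ne.mem_nhds hi)
  have h2 := (contDiff_preLift_snd (i := i) (j := j) (𝕜 := ℂ) (N := 0) j').continuous.continuousAt
    |>.eventually (isOpen_ne.mem_nhds hj)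
  exact h1.and h2

/-- Up to the pluriharmonic logarithms of the transition factors, one chart potential is the
pullback of the other. -/
lemma levi_chartPot_compat {z : CSpace 2} (hi : (preLift i j z).1 i' ≠ 0)
    (hj : (preLift i j z).2 j' ≠ 0) :
    levi (chartPot n s i j) z =
      (holJacobian (fun z => preCoord n i' j' (preLift i j z)) z)ᵀ *
        levi (chartPot n s i' j') (preCoord n i' j' (preLift i j z)) *
        (holJacobian (fun z => preCoord n i' j' (preLift i j z)) z).map conj := by
  have hτ := contDiffAt_preCoord_preLift (n := n) hi hj
  have h1 : chartPot n s i j =ᶠ[𝓝 z] fun z =>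
      chartPot n s i' j' (preCoord n i' j' (preLift i j z)) +
        (Real.log (‖(preLift i j z).1 i'‖ ^ 2) +
          s * Real.log (‖fibre n i' (preLift i j z) j'‖ ^ 2)) := by
    filter_upwards [eventually_preLift_ne_zero hi hj] with y hy
    have h := chartPot_preCoord (n := n) (s := s) (HirzebruchSurface.lift i j y) hy.1 hy.2
    simp only [HirzebruchSurface.lift] at h
    rw [h, chartPot]
    ring
  have hk1 : ContDiffAt ℂ ω (fun z => (preLift i j z).1 i') z :=
    (contDiff_preLift_fst i').contDiffAt
  have hk2 : ContDiffAt ℂ ω (fun z => fibre n i' (preLift i j z) j') z :=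
    (contDiff_fibre_preLift j').contDiffAt
  have hk2' : fibre n i' (preLift i j z) j' ≠ 0 := fibre_ne_zero hi hj
  rw [levi_congr h1, levi_add, levi_add (hk1.log_norm_sq hi)
    (contDiffAt_const.mul (hk2.log_norm_sq hk2')), levi_const_mul, levi_log_norm_sq hk1 hi,
    levi_log_norm_sq hk2 hk2', levi_comp_holomorphic hτ contDiff_chartPot.contDiffAt]
  · simp
  · exact contDiff_chartPot.contDiffAt.comp z ((hτ.restrict_scalars ℝ).of_le le_top)
  · exact (hk1.log_norm_sq hi).add (contDiffAt_const.mul (hk2.log_norm_sq hk2'))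

lemma exists_chart_eq (φ : atlas (CSpace 2) (HirzebruchSurface n)) :
    ∃ ij : Fin 2 × Fin 2, chart n ij.1 ij.2 = φ.1 := φ.2

/-- The indices of a standard chart. -/
def chartIdx (φ : atlas (CSpace 2) (HirzebruchSurface n)) : Fin 2 × Fin 2 :=
  (exists_chart_eq φ).choose

lemma chart_chartIdx (φ : atlas (CSpace 2) (HirzebruchSurface n)) :
    chart n (chartIdx φ).1 (chartIdx φ).2 = φ.1 := (exists_chart_eq φ).choose_spec

lemma chart_target_eq_univ (φ : atlas (CSpace 2) (HirzebruchSurface n)) :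
    φ.1.target = Set.univ := by
  rw [← chart_chartIdx φ]; rfl

/-- The origin of a standard chart lies in the domain of no other one. Therefore the indices
recovered by choice in `chartIdx` are the expected ones. -/
lemma chart_injective (h : chart n i j = chart n i' j') : i = i' ∧ j = j' := by
  have h1 : mk n (lift i j 0) ∈ domain n i' j' := by
    have h0 : mk n (lift i j 0) ∈ (chart n i j).source := lift_mem_domain i j 0
    rw [h] at h0
    exact h0
  obtain ⟨h2, h3⟩ := mk_mem_domain.1 h1
  constructor
  · by_contra hne
    exact h2 (by simp [HirzebruchSurface.lift, preLift, Ne.symm hne])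
  · by_contra hne
    exact h3 (by simp [HirzebruchSurface.lift, preLift, Ne.symm hne])

lemma chartIdx_chart (i j : Fin 2) : chartIdx (n := n) ⟨chart n i j, (i, j), rfl⟩ = (i, j) := by
  have h := chart_chartIdx (n := n) ⟨chart n i j, (i, j), rfl⟩
  obtain ⟨h1, h2⟩ := chart_injective h
  exact Prod.ext h1 h2

lemma HermitianMetric.ext_coeff {m : ℕ} {M : Type*} [TopologicalSpace M]
    [ChartedSpace (CSpace m) M] [IsManifold 𝓘(ℂ, CSpace m) ω M] {g g' : HermitianMetric m M}
    (h : g.coeff = g'.coeff) : g = g' := by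
  cases g
  cases g'
  congr

/-- Hitchin's metric with parameter `s`. -/
def hitchinMetric (n : ℕ) (s : ℝ) (hs : 0 < s) : HermitianMetric 2 (HirzebruchSurface n) where
  coeff φ z := levi (chartPot n s (chartIdx φ).1 (chartIdx φ).2) z
  smooth φ a b := fun z _ =>
    (contDiffAt_levi contDiff_chartPot.contDiffAt a b).contDiffWithinAt
  posDef φ z _ := by
    rw [levi_chartPot]
    exact posDef_hitchinMatrix hs _ z
  compat φ ψ z hz := by
    rw [← chart_chartIdx φ, ← chart_chartIdx ψ] at hz ⊢
    have hz' := (mk_mem_domain (n := n) (p := lift (chartIdx φ).1 (chartIdx φ).2 z)).1 hz.2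
    exact levi_chartPot_compat hz'.1 hz'.2

lemma hitchinMetric_coeff (hs : 0 < s) (φ : atlas (CSpace 2) (HirzebruchSurface n))
    (z : CSpace 2) : (hitchinMetric n s hs).coeff φ z =
      levi (chartPot n s (chartIdx φ).1 (chartIdx φ).2) z := rfl

lemma isHitchinMetric_hitchinMetric (hs : 0 < s) : IsHitchinMetric n s (hitchinMetric n s hs) := by
  intro z a b
  rw [hitchinMetric_coeff, mainChart, chartIdx_chart, chartPot_zero_zero, levi_apply]

/-- The metric is determined by its coefficients in the main chart. -/
lemma IsHitchinMetric.eq_hitchinMetric (hs : 0 < s) {g : HermitianMetric 2 (HirzebruchSurface n)}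
    (hg : IsHitchinMetric n s g) : g = hitchinMetric n s hs := by
  have hmain : ∀ z, g.coeff (mainChart n) z = (hitchinMetric n s hs).coeff (mainChart n) z := by
    intro z
    ext a b
    rw [hg z a b, isHitchinMetric_hitchinMetric hs z a b]
  -- Points with both coordinates non-zero lie in every standard chart. There the transformation law
  -- from the main chart fixes the coefficients, and continuity does the rest.
  have hdense : Dense {z : CSpace 2 | ∀ k, z k ≠ 0} := by
    have := dense_pi (Set.univ : Set (Fin 2)) (s := fun _ => ({0}ᶜ : Set ℂ))
      fun _ _ => dense_compl_singleton 0
    convert this using 1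
    ext z
    simp
  have hcoeff : g.coeff = (hitchinMetric n s hs).coeff := by
    funext φ
    have hcont : ∀ g' : HermitianMetric 2 (HirzebruchSurface n), Continuous (g'.coeff φ) := by
      intro g'
      refine continuous_pi fun a => continuous_pi fun b => ?_
      have := (g'.smooth φ a b).continuousOn
      rwa [chart_target_eq_univ, continuousOn_univ] at this
    refine Continuous.ext_on hdense (hcont g) (hcont _) fun z hz => ?_
    have hsrc : z ∈ (φ.1.symm ≫ₕ (mainChart n).1).source := by
      rw [← chart_chartIdx φ]
      refine ⟨Set.mem_univ _, ?_⟩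
      refine (mk_mem_domain (n := n) (p := lift (chartIdx φ).1 (chartIdx φ).2 z)).2 ⟨?_, ?_⟩
      · simp only [HirzebruchSurface.lift, preLift]
        split_ifs
        exacts [one_ne_zero, hz 0]
      · simp only [HirzebruchSurface.lift, preLift]
        split_ifs
        exacts [one_ne_zero, hz 1]
    rw [g.compat φ (mainChart n) z hsrc, (hitchinMetric n s hs).compat φ (mainChart n) z hsrc,
      hmain]
  exact HermitianMetric.ext_coeff hcoeff

/-- Hitchin's metrics are Kähler. -/
lemma isKahler_hitchinMetric (hs : 0 < s) : (hitchinMetric n s hs).IsKahler := by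
  intro φ z _
  have h : (hitchinMetric n s hs).fundamentalForm φ =
      extDeriv (dcForm (chartPot n s (chartIdx φ).1 (chartIdx φ).2)) := by
    funext y
    rw [extDeriv_dcForm contDiff_chartPot.contDiffAt]
    rfl
  rw [h]
  exact extDeriv_extDeriv_apply (contDiffAt_dcForm contDiff_chartPot.contDiffAt)
    minSmoothness_two_le_infty

end HitchinMetric

/-! ### Reduction of the sectional curvature to the fibre over z₁ = 0. -/

section SectionalCurvature

variable {n : ℕ} {s : ℝ} {j : Fin 2} {x ξ : CSpace 2}

/-- The holomorphic sectional curvature of a Hermitian matrix function. -/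
def matHolSectCurv (G : CSpace 2 → Matrix (Fin 2) (Fin 2) ℂ) (x ξ : CSpace 2) : ℝ :=
  (2 * (∑ i, ∑ j, ξ i * curvatureForm G x ξ i j * conj (ξ j)) /
    (∑ i, ∑ j, ξ i * G x i j * conj (ξ j)) ^ 2).re

lemma delDir_delBarDir_eq {f : CSpace 2 → ℂ} (hf : ContDiffAt ℝ ∞ f x) :
    delDir ξ (delBarDir ξ f) x =
      ∑ k, ∑ l, ξ k * conj (ξ l) * wirtinger k (wirtingerBar l f) x := by
  have h := HasWirtingerAt.sum (s := Finset.univ) (x := x) fun (l : Fin 2) _ =>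
    (HasWirtingerAt.of_contDiffAt (contDiffAt_wirtingerBar hf l)).const_mul (conj (ξ l))
  have h' : delBarDir ξ f = fun y => ∑ l, conj (ξ l) * wirtingerBar l f y := rfl
  rw [h', h.delDir_eq]
  simp only [Finset.sum_apply, Finset.mul_sum, Pi.smul_apply, smul_eq_mul, mul_assoc]

lemma HermitianMetric.holSectCurv_eq {M : Type*} [TopologicalSpace M] [ChartedSpace (CSpace 2) M]
    [IsManifold 𝓘(ℂ, CSpace 2) ω M] (g : HermitianMetric 2 M) (φ : atlas (CSpace 2) M)
    (hx : x ∈ φ.1.target) (ξ : CSpace 2) :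
    g.holSectCurv φ x ξ = matHolSectCurv (g.coeff φ) x ξ := by
  have hs : MatSmoothAt (g.coeff φ) x := fun i j =>
    (g.smooth φ i j).contDiffAt (φ.1.open_target.mem_nhds hx)
  have h1 : ∀ i j, delDir ξ (fun y => matDelBar ξ (g.coeff φ) y i j) x =
      ∑ k, ∑ l, ξ k * conj (ξ l) * wirtinger k (wirtingerBar l fun y => g.coeff φ y i j) x :=
    fun i j => delDir_delBarDir_eq (hs i j)
  have hnum : ∑ i, ∑ j, ∑ k, ∑ l, g.curvature φ x i j k l * ξ i * conj (ξ j) * ξ k * conj (ξ l) =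
      ∑ i, ∑ j, ξ i * curvatureForm (g.coeff φ) x ξ i j * conj (ξ j) := by
    simp only [curvatureForm, Matrix.add_apply, Matrix.neg_apply, Matrix.mul_apply, matDel,
      Matrix.of_apply, h1]
    simp only [matDelBar, Matrix.of_apply, delDir, delBarDir, HermitianMetric.curvature,
      Fin.sum_univ_two]
    ring
  have hden : ∑ i, ∑ j, ∑ k, ∑ l,
      g.coeff φ x i j * g.coeff φ x k l * ξ i * conj (ξ j) * ξ k * conj (ξ l) =
      (∑ i, ∑ j, ξ i * g.coeff φ x i j * conj (ξ j)) ^ 2 := by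
    simp only [Fin.sum_univ_two]
    ring
  rw [HermitianMetric.holSectCurv, hnum, hden, matHolSectCurv]

lemma sum_transpose_mul_mul_conj (J A : Matrix (Fin 2) (Fin 2) ℂ) (ξ : CSpace 2) :
    ∑ i, ∑ j, ξ i * (Jᵀ * A * J.map conj) i j * conj (ξ j) =
      ∑ i, ∑ j, (J *ᵥ ξ) i * A i j * conj ((J *ᵥ ξ) j) := by
  simp only [Matrix.mul_apply, Matrix.mulVec, dotProduct, Matrix.transpose_apply, Matrix.map_apply,
    Fin.sum_univ_two, map_add, map_mul]
  ring

/-- The holomorphic sectional curvature is invariant under holomorphic coordinate changes. -/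
lemma matHolSectCurv_pullback {G H : CSpace 2 → Matrix (Fin 2) (Fin 2) ℂ}
    {τ : CSpace 2 → CSpace 2} (hτ : ContDiffAt ℂ ω τ x) (hH : MatSmoothAt H (τ x))
    (hdet : IsUnit (H (τ x)).det) (hJ : IsUnit (holJacobian τ x).det)
    (hG : G =ᶠ[𝓝 x] fun y => (holJacobian τ y)ᵀ * H (τ y) * (holJacobian τ y).map conj) :
    matHolSectCurv G x ξ = matHolSectCurv H (τ x) (holJacobian τ x *ᵥ ξ) := by
  rw [matHolSectCurv, matHolSectCurv, curvatureForm_congr hG,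
    curvatureForm_pullback hτ hH hdet hJ, hG.eq_of_nhds, sum_transpose_mul_mul_conj,
    sum_transpose_mul_mul_conj]

/-- A multiple of a unitary transformation of the homogeneous coordinates on the base. -/
def baseRotation (a : ℂ) (p : (Fin 2 → ℂ) × (Fin 2 → ℂ)) : (Fin 2 → ℂ) × (Fin 2 → ℂ) :=
  (![((√(1 + ‖a‖ ^ 2) : ℝ) : ℂ)⁻¹ * (p.1 0 + conj a * p.1 1),
    ((√(1 + ‖a‖ ^ 2) : ℝ) : ℂ)⁻¹ * (p.1 1 - a * p.1 0)], p.2)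

lemma baseNorm_baseRotation (a : ℂ) (p : (Fin 2 → ℂ) × (Fin 2 → ℂ)) :
    baseNorm (baseRotation a p) = baseNorm p := by
  have h0 : 0 < 1 + ‖a‖ ^ 2 := by positivity
  have h1 : ‖p.1 0 + conj a * p.1 1‖ ^ 2 + ‖p.1 1 - a * p.1 0‖ ^ 2 =
      (1 + ‖a‖ ^ 2) * (‖p.1 0‖ ^ 2 + ‖p.1 1‖ ^ 2) := by
    rw [← Complex.ofReal_inj]
    push_cast
    simp only [← Complex.mul_conj', map_add, map_sub, map_mul, Complex.conj_conj]
    ring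
  simp only [baseNorm, baseRotation, Matrix.cons_val_zero, Matrix.cons_val_one, norm_mul, mul_pow,
    norm_inv, Complex.norm_real, Real.norm_eq_abs, sq_abs, inv_pow, Real.sq_sqrt h0.le]
  rw [← mul_add, h1]
  field_simp

lemma homPot_baseRotation (a : ℂ) (p : (Fin 2 → ℂ) × (Fin 2 → ℂ)) :
    homPot n s (baseRotation a p) = homPot n s p := by
  simp only [homPot, fibreNorm, baseNorm_baseRotation]
  rfl

lemma sqrt_one_add_norm_sq_ne_zero (a : ℂ) : ((√(1 + ‖a‖ ^ 2) : ℝ) : ℂ)⁻¹ ≠ 0 :=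
  inv_ne_zero (Complex.ofReal_ne_zero.2 (Real.sqrt_ne_zero'.2 (by positivity)))

/-- By a rotation of the base, every point can be moved into the fibre over `z₁ = 0`. -/
lemma exists_matHolSectCurv_centre (hs : 0 < s) (j : Fin 2) (x : CSpace 2) (hξ : ξ ≠ 0) :
    ∃ x' η : CSpace 2, x' 0 = 0 ∧ η ≠ 0 ∧ matHolSectCurv (levi (chartPot n s 0 j)) x ξ =
      matHolSectCurv (levi (chartPot n s 0 j)) x' η := by
  set a := x 0 with ha
  -- The rotation takes (1, a) to a multiple of (1, 0), so with a = x 0 the image of `x` lies over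
  -- z₁ = 0.
  set p : CSpace 2 → (Fin 2 → ℂ) × (Fin 2 → ℂ) := fun z => baseRotation a (preLift 0 j z) with hp
  set τ : CSpace 2 → CSpace 2 := fun z => preCoord n 0 j (p z) with hτdef
  have hp0 : ∀ k, ContDiff ℂ ω fun z => (p z).1 k := by
    intro k
    have h0 := contDiff_preLift_fst (i := 0) (j := j) (𝕜 := ℂ) (N := ω) 0
    have h1 := contDiff_preLift_fst (i := 0) (j := j) (𝕜 := ℂ) (N := ω) 1
    fin_cases k
    · exact contDiff_const.mul (h0.add (contDiff_const.mul h1))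
    · exact contDiff_const.mul (h1.sub (contDiff_const.mul h0))
  have hpF : ∀ k, ContDiff ℂ ω fun z => fibre n 0 (p z) k := by
    intro k
    fin_cases k
    · exact ((hp0 0).pow n).mul (contDiff_preLift_snd (i := 0) 0)
    · exact contDiff_preLift_snd (i := 0) 1
  have hpj : ∀ z, (p z).2 j ≠ 0 := fun z => by simp [hp, baseRotation, preLift]
  have hpx : (p x).1 0 ≠ 0 := by
    refine mul_ne_zero (sqrt_one_add_norm_sq_ne_zero a) ?_
    have : (preLift 0 j x).1 0 + conj a * (preLift 0 j x).1 1 = baseH x := by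
      simp [preLift, baseH, ← ha, mul_comm]
    rw [this]
    exact baseH_ne_zero x
  have hpev : ∀ᶠ z in 𝓝 x, (p z).1 0 ≠ 0 :=
    (hp0 0).continuous.continuousAt.eventually (isOpen_ne.mem_nhds hpx)
  have hτ : ∀ z, (p z).1 0 ≠ 0 → ContDiffAt ℂ ω τ z := fun z hz => by
    refine contDiffAt_pi.2 fun k => ?_
    fin_cases k
    · exact (hp0 1).contDiffAt.div (hp0 0).contDiffAt hz
    · exact (hpF (j + 1)).contDiffAt.div (hpF j).contDiffAt (fibre_ne_zero hz (hpj z))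
  have hpot : ∀ z, (p z).1 0 ≠ 0 → chartPot n s 0 j z = chartPot n s 0 j (τ z) +
      (Real.log (‖(p z).1 0‖ ^ 2) + s * Real.log (‖fibre n 0 (p z) j‖ ^ 2)) := fun z hz => by
    have h := chartPot_preCoord (n := n) (s := s) (i := 0) (j := j)
      ⟨p z, fun h => hz (congrFun h 0), fun h => hpj z (congrFun h j)⟩ hz (hpj z)
    rw [hτdef]
    simp only at h ⊢
    rw [h, hp]
    simp only [homPot_baseRotation, chartPot]
    ring
  have hlevi : levi (chartPot n s 0 j) =ᶠ[𝓝 x] fun z => (holJacobian τ z)ᵀ *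
      levi (chartPot n s 0 j) (τ z) * (holJacobian τ z).map conj := by
    filter_upwards [hpev.eventually_nhds] with z hz
    have hz0 := hz.self_of_nhds
    have hk1 : ContDiffAt ℂ ω (fun z => (p z).1 0) z := (hp0 0).contDiffAt
    have hk2 : ContDiffAt ℂ ω (fun z => fibre n 0 (p z) j) z := (hpF j).contDiffAt
    have hk2' : fibre n 0 (p z) j ≠ 0 := fibre_ne_zero hz0 (hpj z)
    have h1 : chartPot n s 0 j =ᶠ[𝓝 z] fun z => chartPot n s 0 j (τ z) +
      (Real.log (‖(p z).1 0‖ ^ 2) + s * Real.log (‖fibre n 0 (p z) j‖ ^ 2)) := hz.mono hpot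
    rw [levi_congr h1, levi_add, levi_add (hk1.log_norm_sq hz0)
      (contDiffAt_const.mul (hk2.log_norm_sq hk2')), levi_const_mul, levi_log_norm_sq hk1 hz0,
      levi_log_norm_sq hk2 hk2', levi_comp_holomorphic (hτ z hz0) contDiff_chartPot.contDiffAt]
    · simp
    · exact contDiff_chartPot.contDiffAt.comp z (((hτ z hz0).restrict_scalars ℝ).of_le le_top)
    · exact (hk1.log_norm_sq hz0).add (contDiffAt_const.mul (hk2.log_norm_sq hk2'))
  have hdet : ∀ z, IsUnit (levi (chartPot n s 0 j) z).det := fun z => by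
    rw [levi_chartPot]
    exact (posDef_hitchinMatrix hs j z).det_pos.ne'.isUnit
  -- The Jacobian need not be computed: its determinant is a factor of that of the metric at `x`,
  -- which is non-zero.
  have hJ : IsUnit (holJacobian τ x).det := by
    have h := hdet x
    rw [hlevi.eq_of_nhds, Matrix.det_mul, Matrix.det_mul, Matrix.det_transpose] at h
    exact isUnit_of_mul_isUnit_left (isUnit_of_mul_isUnit_left h)
  refine ⟨τ x, holJacobian τ x *ᵥ ξ, ?_, ?_, ?_⟩
  · simp [hτdef, hp, preCoord, baseRotation, preLift, ← ha]
  · intro h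
    have : ((holJacobian τ x)⁻¹ * holJacobian τ x) *ᵥ ξ = 0 := by
      rw [← Matrix.mulVec_mulVec, h, Matrix.mulVec_zero]
    rw [Matrix.nonsing_inv_mul _ hJ, Matrix.one_mulVec] at this
    exact hξ this
  · exact matHolSectCurv_pullback (hτ x hpx)
      (fun a b => contDiffAt_levi contDiff_chartPot.contDiffAt a b) (hdet _) hJ hlevi

/-- The values of the holomorphic sectional curvature in terms of invariant quantities. -/
def hitchinCurv (n : ℕ) (s t u b : ℝ) : ℝ :=
  4 * ((1 + s * n * t * (1 - n + n * t)) * u ^ 2 +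
    2 * (n * (-1 + 2 * t + s * n * t ^ 2) / (1 + s * n * t)) * u * b + b ^ 2 / s) /
    ((1 + s * n * t) * u + b) ^ 2

/-- Both types of chart lead to one function of t, u, b, where t locates the point in the fibre,
with t = 0 on y₀ = 0, and b is the fibre contribution to the squared length of ξ. -/
lemma matHolSectCurv_centre (hs : 0 < s) (hx : x 0 = 0) (j : Fin 2) (ξ : CSpace 2) :
    matHolSectCurv (levi (chartPot n s 0 j)) x ξ =
      hitchinCurv n s (‖(preLift 0 j x).2 0‖ ^ 2 / fibreNorm n (preLift 0 j x)) (‖ξ 0‖ ^ 2)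
        (s * (fibreNorm n (preLift 0 j x))⁻¹ ^ 2 * ‖ξ 1‖ ^ 2) := by
  have hlevi : levi (chartPot n s 0 j) = hitchinMatrix n s (fibParam j) :=
    funext fun z => levi_chartPot z
  set D := fibreNorm n (preLift 0 j x) with hD
  set P := ‖(preLift 0 j x).2 0‖ ^ 2 with hP
  have hDpos : 0 < D := fibreNorm_preLift_pos 0 j x
  have hP0 : 0 ≤ P := by positivity
  have hDc : ((D⁻¹ : ℝ) : ℂ) = (fibD n (fibParam j) x)⁻¹ := by
    rw [← fibreNorm_preLift_cast 0, Complex.ofReal_inv]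
  have hPc : ((P / D : ℝ) : ℂ) = fibP (fibParam j) x * (D⁻¹ : ℝ) := by
    rw [fibP_eq_ofReal 0, div_eq_mul_inv, Complex.ofReal_mul]
  have hg : (0 : ℝ) < 1 + s * n * (P / D) := by positivity
  have hg' : (1 + s * n * ((P / D : ℝ) : ℂ)) ≠ 0 := by exact_mod_cast hg.ne'
  rw [matHolSectCurv, hlevi, sum_curvatureForm_hitchinMatrix hx (fibParam_eq j)
    (fibD_fibParam_ne_zero j) (by exact_mod_cast hs.ne') hDc hPc hg' ξ]
  have hden : ∑ i, ∑ k, ξ i * hitchinMatrix n s (fibParam j) x i k * conj (ξ k) =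
      (((1 + s * n * (P / D)) * ‖ξ 0‖ ^ 2 + s * D⁻¹ ^ 2 * ‖ξ 1‖ ^ 2 : ℝ) : ℂ) := by
    rw [hitchinMatrix_centre hx, ← hDc, ← hPc]
    simp only [Fin.sum_univ_two, Matrix.diagonal_apply, if_true, if_false, Fin.isValue,
      zero_ne_one, one_ne_zero, Matrix.cons_val_zero, Matrix.cons_val_one]
    push_cast
    rw [← Complex.mul_conj', ← Complex.mul_conj']
    ring
  rw [hden, Complex.mul_conj', Complex.mul_conj', ← Complex.ofReal_re (hitchinCurv _ _ _ _ _)]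
  congr 1
  rw [hitchinCurv]
  push_cast
  have hs' : (s : ℂ) ≠ 0 := by exact_mod_cast hs.ne'
  field_simp
  ring

end SectionalCurvature

/-! ### Extrema of the curvature and the pinching constant. -/

section CurvatureBounds

variable {n : ℕ} {s t u b : ℝ}

/-- With x = sνt and (2+x)² - (1+x)² = 3 + 2x, the difference of the sides is 3(ν+1)(1+x)² - (νt +
(2ν+1)x)(3+2x). Replacing νt by ν and using νx ≤ 1, which is where sν² ≤ 1 enters, leaves at least
(1+x)². -/
lemma discriminant_nonneg {ν s t : ℝ} (hν : 0 ≤ ν) (hs : 0 ≤ s) (h : s * ν ^ 2 ≤ 1)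
    (ht0 : 0 ≤ t) (ht : t ≤ 1) :
    (1 + s + 2 * ν * s) * ν * t * (2 + s * ν * t) ^ 2 ≤
      (3 * (ν + 1) + (1 + s + 2 * ν * s) * ν * t) * (1 + s * ν * t) ^ 2 := by
  set x := s * ν * t with hx
  have hx0 : 0 ≤ x := by positivity
  have hc : (1 + s + 2 * ν * s) * ν * t = ν * t + (2 * ν + 1) * x := by rw [hx]; ring
  have hνx : ν * x ≤ 1 := by
    have : ν * x = s * ν ^ 2 * t := by rw [hx]; ring
    rw [this]
    exact mul_le_one₀ h ht0 ht
  have hνt : ν * t ≤ ν := mul_le_of_le_one_right hν ht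
  rw [hc]
  have h1 : (ν * t + (2 * ν + 1) * x) * (3 + 2 * x) ≤ (ν + (2 * ν + 1) * x) * (3 + 2 * x) :=
    mul_le_mul_of_nonneg_right (by linarith) (by linarith)
  have h2 : ν * x * x ≤ x := mul_le_of_le_one_left hx0 hνx
  nlinarith [sq_nonneg x]

/-- Over the common denominator the difference is a quadratic form in u and b, with b² coefficient
proportional to (1+ns)²; the square is completed in b. The remainder has the factor t. At t = 0
everything vanishes for (1+ns)b = s(n+1)u, which are the minimising directions. -/
lemma hitchinCurv_sub (hs : 0 < s) (ht : 0 ≤ t) (h : 0 < (1 + s * n * t) * u + b) :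
    hitchinCurv n s t u b - (4 - 4 * (n : ℝ) ^ 2 * s) / (1 + s + 2 * n * s) =
      4 / (s * (1 + s + 2 * n * s) * ((1 + s * n * t) * u + b) ^ 2) *
        (((1 + n * s) * b - s * (n + 1) * ((1 + s * n * t) * u) +
            s * ((1 + s + 2 * n * s) * n * t) * (2 + s * n * t) * u / (1 + s * n * t)) ^ 2 +
          s ^ 2 * ((1 + s + 2 * n * s) * n * t) * u ^ 2 / (1 + s * n * t) ^ 2 *
            ((3 * (n + 1) + (1 + s + 2 * n * s) * n * t) * (1 + s * n * t) ^ 2 -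
              (1 + s + 2 * n * s) * n * t * (2 + s * n * t) ^ 2)) := by
  have hc : 1 + s + 2 * n * s ≠ 0 := by positivity
  have hg : 1 + s * n * t ≠ 0 := by positivity
  have hw := h.ne'
  rw [hitchinCurv]
  -- The three denominators are made opaque so that clearing them does not expand them.
  obtain ⟨c, hcdef⟩ : ∃ c, c = 1 + s + 2 * n * s := ⟨_, rfl⟩
  obtain ⟨g, hgdef⟩ : ∃ g, g = 1 + s * n * t := ⟨_, rfl⟩
  obtain ⟨w, hwdef⟩ : ∃ w, w = g * u + b := ⟨_, rfl⟩
  rw [← hgdef, ← hwdef] at hw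
  rw [← hcdef] at hc
  rw [← hgdef] at hg
  rw [← hgdef, ← hwdef, ← hcdef]
  field_simp
  subst hwdef hgdef hcdef
  ring

lemma le_hitchinCurv (hs : 0 < s) (h : s * (n : ℝ) ^ 2 ≤ 1) (ht0 : 0 ≤ t) (ht : t ≤ 1)
    (hub : 0 < (1 + s * n * t) * u + b) :
    (4 - 4 * (n : ℝ) ^ 2 * s) / (1 + s + 2 * n * s) ≤ hitchinCurv n s t u b := by
  rw [← sub_nonneg, hitchinCurv_sub hs ht0 hub]
  have := sub_nonneg.2 (discriminant_nonneg n.cast_nonneg hs.le h ht0 ht)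
  positivity

/-- The fibre direction has curvature exactly 4/s, so no b² term is left in the difference. The
coefficient of ub reduces to the positive number 1 + sn, up to positive factors, and that of u² is
non-negative because s ≤ 1 and 1 - n + nt ≤ 1. -/
lemma hitchinCurv_le (hn : 1 ≤ n) (hs : 0 < s) (h : s * (n : ℝ) ^ 2 ≤ 1) (ht0 : 0 ≤ t)
    (ht : t ≤ 1) (hu : 0 ≤ u) (hb : 0 ≤ b) (hub : 0 < (1 + s * n * t) * u + b) :
    hitchinCurv n s t u b ≤ 4 / s := by
  have hn' : (1 : ℝ) ≤ n := by exact_mod_cast hn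
  have hg : 0 < 1 + s * n * t := by positivity
  have hsn : s * n ≤ 1 := by nlinarith
  have hs1 : s ≤ 1 := by nlinarith
  have hid : 4 / s - hitchinCurv n s t u b = 4 / (s * ((1 + s * n * t) * u + b) ^ 2) *
      (((1 + s * n * t) ^ 2 - s * (1 + s * n * t * (1 - n + n * t))) * u ^ 2 +
        2 * ((1 + s * n * t) ^ 2 - s * n * (-1 + 2 * t + s * n * t ^ 2)) / (1 + s * n * t) *
          u * b) := by
    have hg := hg.ne'
    have hw := hub.ne'
    rw [hitchinCurv]
    obtain ⟨g, hgdef⟩ : ∃ g, g = 1 + s * n * t := ⟨_, rfl⟩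
    obtain ⟨w, hwdef⟩ : ∃ w, w = g * u + b := ⟨_, rfl⟩
    rw [← hgdef, ← hwdef] at hw
    rw [← hgdef] at hg
    rw [← hgdef, ← hwdef]
    field_simp
    subst hwdef hgdef
    ring
  rw [← sub_nonneg, hid]
  have hx : 0 ≤ s * n * t := by positivity
  have h1 : 0 ≤ (1 + s * n * t) ^ 2 - s * (1 + s * n * t * (1 - n + n * t)) := by
    have h2 : s * (1 + s * n * t * (1 - n + n * t)) ≤ s * (1 + s * n * t) := by
      refine mul_le_mul_of_nonneg_left ?_ hs.le
      have : s * n * t * (1 - n + n * t) ≤ s * n * t * 1 :=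
        mul_le_mul_of_nonneg_left (by nlinarith) hx
      linarith
    nlinarith
  have h2 : 0 ≤ (1 + s * n * t) ^ 2 - s * n * (-1 + 2 * t + s * n * t ^ 2) := by
    have : (1 + s * n * t) ^ 2 - s * n * (-1 + 2 * t + s * n * t ^ 2) = 1 + s * n := by ring
    rw [this]; positivity
  positivity

/-- Every value of the curvature is attained over `z₁ = 0`, where it is given by `hitchinCurv`. -/
lemma exists_hitchinCurv_eq (hs : 0 < s) {κ : ℝ}
    (hκ : κ ∈ (hitchinMetric n s hs).holSectCurvValues) :
    ∃ t u b : ℝ, 0 ≤ t ∧ t ≤ 1 ∧ 0 ≤ u ∧ 0 ≤ b ∧ 0 < (1 + s * n * t) * u + b ∧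
      κ = hitchinCurv n s t u b := by
  obtain ⟨φ, x, hx, ξ, hξ, rfl⟩ := hκ
  have hcoeff : (hitchinMetric n s hs).coeff φ = levi (chartPot n s 0 (chartIdx φ).2) := by
    funext z
    rw [hitchinMetric_coeff, levi_chartPot, levi_chartPot]
  rw [HermitianMetric.holSectCurv_eq _ φ hx, hcoeff]
  obtain ⟨x', η, hx', hη, h⟩ := exists_matHolSectCurv_centre (n := n) hs (chartIdx φ).2 x hξ
  rw [h, matHolSectCurv_centre hs hx']
  set j := (chartIdx φ).2
  have hD := fibreNorm_preLift_pos (n := n) 0 j x'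
  have ht0 : 0 ≤ ‖(preLift 0 j x').2 0‖ ^ 2 / fibreNorm n (preLift 0 j x') := by positivity
  refine ⟨_, _, _, ht0, ?_, by positivity, by positivity, ?_, rfl⟩
  · rw [div_le_one hD, fibreNorm]
    have : baseNorm (preLift 0 j x') = 1 := by simp [baseNorm, preLift, hx']
    rw [this, one_pow, one_mul]
    exact le_add_of_nonneg_right (by positivity)
  · by_cases h0 : η 0 = 0
    · have h1 : η 1 ≠ 0 := fun h1 => hη (by ext k; fin_cases k <;> simp [h0, h1])
      have : 0 < ‖η 1‖ := norm_pos_iff.2 h1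
      positivity
    · have : 0 < ‖η 0‖ := norm_pos_iff.2 h0
      positivity

/-- The chosen point is the origin of a chart with y₁ ≠ 0. It has y₀ = 0, hence t = 0, and lies on
the section z₂ = ∞. -/
lemma hitchinCurv_mem_holSectCurvValues (hs : 0 < s) {ξ : CSpace 2} (hξ : ξ ≠ 0) :
    hitchinCurv n s 0 (‖ξ 0‖ ^ 2) (s * ‖ξ 1‖ ^ 2) ∈ (hitchinMetric n s hs).holSectCurvValues := by
  refine ⟨⟨chart n 0 1, (0, 1), rfl⟩, 0, Set.mem_univ _, ξ, hξ, ?_⟩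
  have hcoeff : (hitchinMetric n s hs).coeff ⟨chart n 0 1, (0, 1), rfl⟩ =
      levi (chartPot n s 0 1) := by
    funext z
    rw [hitchinMetric_coeff, chartIdx_chart]
  have hD : fibreNorm n (preLift 0 1 0) = 1 := by simp [fibreNorm, preLift]
  rw [HermitianMetric.holSectCurv_eq _ _ (Set.mem_univ _), hcoeff, matHolSectCurv_centre hs rfl, hD]
  simp [preLift]

/-- No upper bound on s is imposed: this value is attained even where it is not positive, which
excludes positive curvature for sn² ≥ 1. -/
lemma min_mem_holSectCurvValues (hs : 0 < s) :
    (4 - 4 * (n : ℝ) ^ 2 * s) / (1 + s + 2 * n * s) ∈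
      (hitchinMetric n s hs).holSectCurvValues := by
  have h := hitchinCurv_mem_holSectCurvValues (n := n) hs
    -- This gives u = 1 + ns and b = s(n+1), for which the square in `hitchinCurv_sub` vanishes at t
    -- = 0.
    (ξ := ![(√(1 + n * s) : ℝ), (√(n + 1) : ℝ)]) (by
      intro h
      have := congrFun h 0
      simp only [Matrix.cons_val_zero, Pi.zero_apply, Complex.ofReal_eq_zero] at this
      exact (Real.sqrt_ne_zero'.2 (by positivity)) this)
  convert h using 1
  simp only [Matrix.cons_val_zero, Matrix.cons_val_one, Complex.norm_real, Real.norm_eq_abs, sq_abs]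
  rw [Real.sq_sqrt (by positivity), Real.sq_sqrt (by positivity)]
  symm
  rw [← sub_eq_zero, hitchinCurv_sub hs le_rfl (by positivity)]
  ring

lemma max_mem_holSectCurvValues (hs : 0 < s) :
    4 / s ∈ (hitchinMetric n s hs).holSectCurvValues := by
  have h := hitchinCurv_mem_holSectCurvValues (n := n) hs (ξ := ![0, 1])
    (fun h => one_ne_zero (congrFun h 1))
  convert h using 1
  simp [hitchinCurv]
  field_simp

lemma isLeast_holSectCurvValues (hs : 0 < s) (h : s * (n : ℝ) ^ 2 ≤ 1) :
    IsLeast (hitchinMetric n s hs).holSectCurvValues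
      ((4 - 4 * (n : ℝ) ^ 2 * s) / (1 + s + 2 * n * s)) := by
  refine ⟨min_mem_holSectCurvValues hs, fun κ hκ => ?_⟩
  obtain ⟨t, u, b, ht0, ht, -, -, hub, rfl⟩ := exists_hitchinCurv_eq hs hκ
  exact le_hitchinCurv hs h ht0 ht hub

lemma isGreatest_holSectCurvValues (hn : 1 ≤ n) (hs : 0 < s) (h : s * (n : ℝ) ^ 2 ≤ 1) :
    IsGreatest (hitchinMetric n s hs).holSectCurvValues (4 / s) := by
  refine ⟨max_mem_holSectCurvValues hs, fun κ hκ => ?_⟩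
  obtain ⟨t, u, b, ht0, ht, hu, hb, hub, rfl⟩ := exists_hitchinCurv_eq hs hκ
  exact hitchinCurv_le hn hs h ht0 ht hu hb hub

lemma hasPosHolSectCurv_hitchinMetric_iff (hs : 0 < s) :
    (hitchinMetric n s hs).HasPosHolSectCurv ↔ s * (n : ℝ) ^ 2 < 1 := by
  have hc : 0 < 1 + s + 2 * n * s := by positivity
  constructor
  · intro h
    have := h _ (min_mem_holSectCurvValues hs)
    rw [div_pos_iff_of_pos_right hc] at this
    linarith
  · intro h κ hκ
    refine lt_of_lt_of_le (div_pos ?_ hc) ((isLeast_holSectCurvValues hs h.le).2 hκ)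
    linarith

/-- The quotient is s(1 - n²s)/(1 + (1+2n)s). Separating its maximum as a constant leaves a perfect
square, whose zero is the optimal parameter s = 1/(n(1+2n)). -/
lemma pinching_quotient (hs : 0 < s) :
    (4 - 4 * (n : ℝ) ^ 2 * s) / (1 + s + 2 * n * s) / (4 / s) =
      1 / (1 + 2 * (n : ℝ)) ^ 2 - (1 - n * (1 + 2 * n) * s) ^ 2 /
        ((1 + s + 2 * n * s) * (1 + 2 * (n : ℝ)) ^ 2) := by
  have hc : 1 + s + 2 * n * s ≠ 0 := by positivity
  have hd : 1 + 2 * (n : ℝ) ≠ 0 := by positivity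
  field_simp
  ring

lemma isPinched_hitchinMetric (hn : 1 ≤ n) (hs : 0 < s) (h : s = 1 / (2 * (n : ℝ) ^ 2 + n)) :
    (hitchinMetric n s hs).IsPinched (1 / (1 + 2 * (n : ℝ)) ^ 2) := by
  have hn' : (1 : ℝ) ≤ n := by exact_mod_cast hn
  have hlt : s * (n : ℝ) ^ 2 < 1 := by
    rw [h, one_div_mul_eq_div, div_lt_one (by positivity)]
    nlinarith
  refine ⟨by positivity, ?_, (hasPosHolSectCurv_hitchinMetric_iff hs).2 hlt, _, _,
    (isLeast_holSectCurvValues hs hlt.le).isGLB, (isGreatest_holSectCurvValues hn hs hlt.le).isLUB,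
    ?_⟩
  · rw [div_le_one (by positivity)]
    exact one_le_pow₀ (by linarith)
  · have h0 : 1 - n * (1 + 2 * n) * s = 0 := by
      rw [h]
      field_simp
      ring
    rw [pinching_quotient hs, h0]
    simp

lemma pinching_le (hn : 1 ≤ n) (hs : 0 < s) {c : ℝ} (h : (hitchinMetric n s hs).IsPinched c) :
    c ≤ 1 / (1 + 2 * (n : ℝ)) ^ 2 := by
  obtain ⟨-, -, hpos, a, b, ha, hb, rfl⟩ := h
  have hlt := (hasPosHolSectCurv_hitchinMetric_iff hs).1 hpos
  rw [ha.unique (isLeast_holSectCurvValues hs hlt.le).isGLB,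
    hb.unique (isGreatest_holSectCurvValues hn hs hlt.le).isLUB, pinching_quotient hs]
  have : 0 ≤ (1 - n * (1 + 2 * n) * s) ^ 2 / ((1 + s + 2 * n * s) * (1 + 2 * (n : ℝ)) ^ 2) := by
    positivity
  linarith

end CurvatureBounds

/-! ### Behaviour of the curvature under scaling of the metric. -/

section Scaling

variable {M : Type*} [TopologicalSpace M] [ChartedSpace (CSpace 2) M]
  [IsManifold 𝓘(ℂ, CSpace 2) ω M]

/-- The quadratic term scales by c⁻¹·c·c = c, like the second derivatives. The denominator of K
scales by c², so K itself scales by c⁻¹. -/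
lemma HermitianMetric.curvature_scale (g : HermitianMetric 2 M) {c : ℝ} (hc : 0 < c)
    (φ : atlas (CSpace 2) M) {x : CSpace 2} (hx : x ∈ φ.1.target) (i j k l : Fin 2) :
    (g.scale c hc).curvature φ x i j k l = c * g.curvature φ x i j k l := by
  have hc' : (c : ℂ) ≠ 0 := by exact_mod_cast hc.ne'
  have hinv : ((c : ℂ) • g.coeff φ x)⁻¹ = (c : ℂ)⁻¹ • (g.coeff φ x)⁻¹ :=
    Matrix.inv_smul' _ (Units.mk0 _ hc') (g.posDef φ x hx).det_pos.ne'.isUnit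
  have hbar : ∀ i j, (wirtingerBar l fun y => (c : ℂ) * g.coeff φ y i j) =
      fun x => (c : ℂ) * wirtingerBar l (fun y => g.coeff φ y i j) x :=
    fun i j => funext fun y => wirtingerBar_const_mul _ _ _ _
  simp only [curvature, scale, hinv, Matrix.smul_apply, smul_eq_mul, hbar, wirtinger_const_mul]
  rw [mul_add, Finset.mul_sum, mul_neg]
  congr 1
  refine Finset.sum_congr rfl fun p _ => ?_
  rw [Finset.mul_sum]
  refine Finset.sum_congr rfl fun q _ => ?_
  field_simp

lemma HermitianMetric.holSectCurv_scale (g : HermitianMetric 2 M) {c : ℝ} (hc : 0 < c)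
    (φ : atlas (CSpace 2) M) {x : CSpace 2} (hx : x ∈ φ.1.target) (ξ : CSpace 2) :
    (g.scale c hc).holSectCurv φ x ξ = c⁻¹ * g.holSectCurv φ x ξ := by
  have hc' : (c : ℂ) ≠ 0 := by exact_mod_cast hc.ne'
  have hnum : ∑ i, ∑ j, ∑ k, ∑ l,
      (g.scale c hc).curvature φ x i j k l * ξ i * conj (ξ j) * ξ k * conj (ξ l) =
      c * ∑ i, ∑ j, ∑ k, ∑ l,
        g.curvature φ x i j k l * ξ i * conj (ξ j) * ξ k * conj (ξ l) := by
    simp only [g.curvature_scale hc φ hx, Finset.mul_sum, mul_assoc]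
  have hden : ∑ i, ∑ j, ∑ k, ∑ l, (g.scale c hc).coeff φ x i j * (g.scale c hc).coeff φ x k l *
      ξ i * conj (ξ j) * ξ k * conj (ξ l) =
      c * c * ∑ i, ∑ j, ∑ k, ∑ l, g.coeff φ x i j * g.coeff φ x k l *
        ξ i * conj (ξ j) * ξ k * conj (ξ l) := by
    simp only [scale, Matrix.smul_apply, smul_eq_mul, Finset.mul_sum]
    refine Finset.sum_congr rfl fun i _ => Finset.sum_congr rfl fun j _ =>
      Finset.sum_congr rfl fun k _ => Finset.sum_congr rfl fun l _ => ?_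
    ring
  rw [holSectCurv, hnum, hden, holSectCurv, ← Complex.re_ofReal_mul, Complex.ofReal_inv,
    mul_left_comm 2, mul_assoc, mul_div_mul_left _ _ hc', mul_comm (c : ℂ) , ← div_div,
    div_eq_inv_mul]

open scoped Pointwise in
lemma HermitianMetric.holSectCurvValues_scale (g : HermitianMetric 2 M) {c : ℝ} (hc : 0 < c) :
    (g.scale c hc).holSectCurvValues = c⁻¹ • g.holSectCurvValues := by
  ext κ
  rw [Set.mem_smul_set]
  constructor
  · rintro ⟨φ, x, hx, ξ, hξ, rfl⟩
    exact ⟨_, ⟨φ, x, hx, ξ, hξ, rfl⟩, (g.holSectCurv_scale hc φ hx ξ).symm⟩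
  · rintro ⟨_, ⟨φ, x, hx, ξ, hξ, rfl⟩, rfl⟩
    exact ⟨φ, x, hx, ξ, hξ, (g.holSectCurv_scale hc φ hx ξ).symm⟩

/-- Pinching is invariant under scaling of the metric. -/
lemma HermitianMetric.IsPinched.scale {g : HermitianMetric 2 M} {k : ℝ} (h : g.IsPinched k)
    {c : ℝ} (hc : 0 < c) : (g.scale c hc).IsPinched k := by
  obtain ⟨h0, h1, hpos, a, b, ha, hb, hab⟩ := h
  have hc' := inv_pos.2 hc
  refine ⟨h0, h1, ?_, c⁻¹ * a, c⁻¹ * b, ?_, ?_, ?_⟩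
  · rw [HasPosHolSectCurv, holSectCurvValues_scale]
    rintro _ ⟨κ, hκ, rfl⟩
    exact mul_pos hc' (hpos κ hκ)
  · rw [holSectCurvValues_scale]
    exact (OrderIso.smulRight hc').isGLB_image'.2 ha
  · rw [holSectCurvValues_scale]
    exact (OrderIso.smulRight hc').isLUB_image'.2 hb
  · rw [mul_div_mul_left _ _ hc'.ne', hab]

end Scaling

/-! ### An open cover on which arguments of transition functions have branches. -/

section Patches

variable {n : ℕ} {c c' d : Fin 2 × Fin 2} {P Q : HirzebruchSurface n}

/-- The transition function `x_{i'} / x_i` of the pullback of `𝒪(1)` from the base. -/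
def baseRatio (c c' : Fin 2 × Fin 2) (P : HirzebruchSurface n) : ℂ :=
  P.out.1.1 c'.1 / P.out.1.1 c.1

/-- The transition function of the relative `𝒪(1)`. -/
def fibreRatio (c c' : Fin 2 × Fin 2) (P : HirzebruchSurface n) : ℂ :=
  fibre n c'.1 P.out.1 c'.2 / fibre n c.1 P.out.1 c.2

/-- The partition of unity formed by the squared norms of the homogeneous coordinates. -/
def weight (c : Fin 2 × Fin 2) (P : HirzebruchSurface n) : ℝ :=
  ‖P.out.1.1 c.1‖ ^ 2 / baseNorm P.out.1 *
    (![baseNorm P.out.1 ^ n * ‖P.out.1.2 0‖ ^ 2, ‖P.out.1.2 1‖ ^ 2] c.2 / fibreNorm n P.out.1)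

/-- The functions above use the arbitrary representative `P.out`. Since they are homogeneous of
degree zero, they can be computed from any representative. -/
lemma exists_out_mk (p : HirzebruchCone) : ∃ l u : ℂˣ,
    (∀ i, (mk n p).out.1.1 i = l * p.1.1 i) ∧ (mk n p).out.1.2 0 = u * p.1.2 0 ∧
      (mk n p).out.1.2 1 = (l : ℂ) ^ n * u * p.1.2 1 :=
  (hirzebruchSetoid n).symm (Quotient.exact (Quotient.out_eq (mk n p)))

lemma baseRatio_mk (p : HirzebruchCone) :
    baseRatio c c' (mk n p) = p.1.1 c'.1 / p.1.1 c.1 := by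
  obtain ⟨l, u, h1, -, -⟩ := exists_out_mk (n := n) p
  rw [baseRatio, h1, h1, mul_div_mul_left _ _ l.ne_zero]

lemma fibreRatio_mk (p : HirzebruchCone) :
    fibreRatio c c' (mk n p) = fibre n c'.1 p.1 c'.2 / fibre n c.1 p.1 c.2 := by
  obtain ⟨l, u, h1, h2, h3⟩ := exists_out_mk (n := n) p
  rw [fibreRatio, fibre_smul h1 h2 h3, fibre_smul h1 h2 h3,
    mul_div_mul_left _ _ (mul_ne_zero (pow_ne_zero _ l.ne_zero) u.ne_zero)]

lemma weight_mk (p : HirzebruchCone) :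
    weight c (mk n p) = ‖p.1.1 c.1‖ ^ 2 / baseNorm p.1 *
      (![baseNorm p.1 ^ n * ‖p.1.2 0‖ ^ 2, ‖p.1.2 1‖ ^ 2] c.2 / fibreNorm n p.1) := by
  obtain ⟨l, u, h1, h2, h3⟩ := exists_out_mk (n := n) p
  have hl := norm_pos_iff.2 l.ne_zero
  have hu := norm_pos_iff.2 u.ne_zero
  have hb : baseNorm (mk n p).out.1 = ‖(l : ℂ)‖ ^ 2 * baseNorm p.1 := by
    simp only [baseNorm, h1, norm_mul]; ring
  have hf : fibreNorm n (mk n p).out.1 = (‖(l : ℂ)‖ ^ n * ‖(u : ℂ)‖) ^ 2 * fibreNorm n p.1 := by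
    simp only [fibreNorm, hb, h2, h3, norm_mul, norm_pow]; ring
  have hv : ∀ j : Fin 2, (![baseNorm (mk n p).out.1 ^ n * ‖(mk n p).out.1.2 0‖ ^ 2,
      ‖(mk n p).out.1.2 1‖ ^ 2] : Fin 2 → ℝ) j = (‖(l : ℂ)‖ ^ n * ‖(u : ℂ)‖) ^ 2 *
        (![baseNorm p.1 ^ n * ‖p.1.2 0‖ ^ 2, ‖p.1.2 1‖ ^ 2] : Fin 2 → ℝ) j := by
    intro j
    fin_cases j
    · simp only [hb, h2, norm_mul, Fin.zero_eta, Matrix.cons_val_zero]; ring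
    · simp only [h3, norm_mul, norm_pow, Fin.mk_one, Matrix.cons_val_one, Matrix.cons_val_fin_one]
      ring
  rw [weight, hv, hf, hb, h1, norm_mul, mul_pow, mul_div_mul_left _ _ (by positivity),
    mul_div_mul_left _ _ (by positivity)]

lemma continuous_weight (c : Fin 2 × Fin 2) : Continuous (weight (n := n) c) := by
  rw [isQuotientMap_mk.continuous_iff]
  have h : weight c ∘ mk n = fun p => ‖p.1.1 c.1‖ ^ 2 / baseNorm p.1 *
      (![baseNorm p.1 ^ n * ‖p.1.2 0‖ ^ 2, ‖p.1.2 1‖ ^ 2] c.2 / fibreNorm n p.1) :=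
    funext weight_mk
  have hb : Continuous fun p : HirzebruchCone => baseNorm p.1 := by
    unfold baseNorm; fun_prop
  have hf : Continuous fun p : HirzebruchCone => fibreNorm n p.1 := by
    unfold fibreNorm; fun_prop
  have hv : Continuous fun p : HirzebruchCone =>
      (![baseNorm p.1 ^ n * ‖p.1.2 0‖ ^ 2, ‖p.1.2 1‖ ^ 2] : Fin 2 → ℝ) c.2 := by
    generalize c.2 = j
    fin_cases j <;> simp <;> fun_prop
  rw [h]
  exact (Continuous.div (by fun_prop) hb fun p => (baseNorm_pos p.2.1).ne').mul
    (hv.div hf fun p => (fibreNorm_pos p.2.1 p.2.2).ne')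

lemma weight_eq_zero (h : P ∉ domain n c.1 c.2) : weight c P = 0 := by
  obtain ⟨p, rfl⟩ := isQuotientMap_mk.surjective P
  rw [mk_mem_domain, not_and_or, not_not, not_not] at h
  rw [weight_mk]
  obtain ⟨i, j⟩ := c
  rcases h with h | h
  · simp only at h
    simp [h]
  · fin_cases j <;> simp only [Fin.zero_eta, Fin.mk_one, Fin.isValue] at h <;> simp [h]

lemma sum_weight (P : HirzebruchSurface n) :
    weight (0, 0) P + weight (0, 1) P + weight (1, 0) P + weight (1, 1) P = 1 := by
  obtain ⟨p, rfl⟩ := isQuotientMap_mk.surjective P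
  have hb := (baseNorm_pos p.2.1).ne'
  have hf := (fibreNorm_pos (n := n) p.2.1 p.2.2).ne'
  simp only [weight_mk, Matrix.cons_val_zero, Matrix.cons_val_one]
  field_simp
  simp only [fibreNorm]
  rw [show ∀ a : ℝ, baseNorm p.1 * a = (‖p.1.1 0‖ ^ 2 + ‖p.1.1 1‖ ^ 2) * a from fun a => rfl]
  ring

/-- Four weights add up to 1, so they cannot all be at most 1/5; any threshold in (0, 1/4) would
serve. -/
lemma exists_lt_weight (P : HirzebruchSurface n) : ∃ c, 1 / 5 < weight c P := by
  by_contra! h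
  have h1 := h (0, 0)
  have h2 := h (0, 1)
  have h3 := h (1, 0)
  have h4 := h (1, 1)
  linarith [sum_weight P]

/-- A chart in whose domain the given point lies well inside. -/
def patchIdx (P : HirzebruchSurface n) : Fin 2 × Fin 2 := (exists_lt_weight P).choose

lemma lt_weight_patchIdx (P : HirzebruchSurface n) : 1 / 5 < weight (patchIdx P) P :=
  (exists_lt_weight P).choose_spec

lemma mem_domain_of_lt_weight (h : 1 / 5 < weight c P) : P ∈ domain n c.1 c.2 := by
  by_contra h'
  rw [weight_eq_zero h'] at h
  norm_num at h

/-- The part of the domains of two charts on which the arguments of the transition functions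
differ by less than `π` from those at `P`. -/
def sector (c c' : Fin 2 × Fin 2) (P : HirzebruchSurface n) : Set (HirzebruchSurface n) :=
  (domain n c.1 c.2 ∩ domain n c'.1 c'.2) ∩
    {Q | baseRatio c c' Q / baseRatio c c' P ∈ Complex.slitPlane ∧
      fibreRatio c c' Q / fibreRatio c c' P ∈ Complex.slitPlane}

lemma continuousOn_baseRatio :
    ContinuousOn (baseRatio (n := n) c c') (domain n c.1 c.2 ∩ domain n c'.1 c'.2) := by
  rw [isQuotientMap_mk.continuousOn_isOpen_iff ((isOpen_domain _ _).inter (isOpen_domain _ _))]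
  rw [show baseRatio c c' ∘ mk n = fun p => p.1.1 c'.1 / p.1.1 c.1 from funext baseRatio_mk]
  exact ContinuousOn.div (by fun_prop) (by fun_prop) fun p hp => (mk_mem_domain.1 hp.1).1

lemma continuousOn_fibreRatio :
    ContinuousOn (fibreRatio (n := n) c c') (domain n c.1 c.2 ∩ domain n c'.1 c'.2) := by
  rw [isQuotientMap_mk.continuousOn_isOpen_iff ((isOpen_domain _ _).inter (isOpen_domain _ _))]
  rw [show fibreRatio c c' ∘ mk n = fun p => fibre n c'.1 p.1 c'.2 / fibre n c.1 p.1 c.2 from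
    funext fibreRatio_mk]
  have hf : ∀ i k, Continuous fun p : HirzebruchCone => fibre n i p.1 k := by
    intro i k
    fin_cases k
    · change Continuous fun p : HirzebruchCone => p.1.1 i ^ n * p.1.2 0
      fun_prop
    · change Continuous fun p : HirzebruchCone => p.1.2 1
      fun_prop
  exact (hf _ _).continuousOn.div (hf _ _).continuousOn fun p hp =>
    fibre_ne_zero (mk_mem_domain.1 hp.1).1 (mk_mem_domain.1 hp.1).2

lemma isOpen_sector (c c' : Fin 2 × Fin 2) (P : HirzebruchSurface n) : IsOpen (sector c c' P) := by
  have ho : IsOpen (domain n c.1 c.2 ∩ domain n c'.1 c'.2) :=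
    (isOpen_domain _ _).inter (isOpen_domain _ _)
  have h1 := (continuousOn_baseRatio (n := n) (c := c) (c' := c')).div_const (baseRatio c c' P)
  have h2 := (continuousOn_fibreRatio (n := n) (c := c) (c' := c')).div_const (fibreRatio c c' P)
  exact (h1.prodMk h2).isOpen_inter_preimage ho
    (Complex.isOpen_slitPlane.prod Complex.isOpen_slitPlane)

lemma baseRatio_ne_zero (h : P ∈ domain n c.1 c.2) (h' : P ∈ domain n c'.1 c'.2) :
    baseRatio c c' P ≠ 0 := by
  obtain ⟨p, rfl⟩ := isQuotientMap_mk.surjective P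
  rw [baseRatio_mk]
  exact div_ne_zero (mk_mem_domain.1 h').1 (mk_mem_domain.1 h).1

lemma fibreRatio_ne_zero (h : P ∈ domain n c.1 c.2) (h' : P ∈ domain n c'.1 c'.2) :
    fibreRatio c c' P ≠ 0 := by
  obtain ⟨p, rfl⟩ := isQuotientMap_mk.surjective P
  rw [fibreRatio_mk]
  rw [mk_mem_domain] at h h'
  exact div_ne_zero (fibre_ne_zero h'.1 h'.2) (fibre_ne_zero h.1 h.2)

lemma baseRatio_mul (h : P ∈ domain n c'.1 c'.2) :
    baseRatio c c' P * baseRatio c' d P = baseRatio c d P := by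
  obtain ⟨p, rfl⟩ := isQuotientMap_mk.surjective P
  rw [baseRatio_mk, baseRatio_mk, baseRatio_mk, mul_comm, div_mul_div_cancel₀]
  exact (mk_mem_domain.1 h).1

lemma fibreRatio_mul (h : P ∈ domain n c'.1 c'.2) :
    fibreRatio c c' P * fibreRatio c' d P = fibreRatio c d P := by
  obtain ⟨p, rfl⟩ := isQuotientMap_mk.surjective P
  rw [fibreRatio_mk, fibreRatio_mk, fibreRatio_mk, mul_comm, div_mul_div_cancel₀]
  exact fibre_ne_zero (mk_mem_domain.1 h).1 (mk_mem_domain.1 h).2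

lemma mem_sector_self (h : P ∈ domain n c.1 c.2) (h' : P ∈ domain n c'.1 c'.2) :
    P ∈ sector c c' P := by
  refine ⟨⟨h, h'⟩, ?_, ?_⟩
  · rw [div_self (baseRatio_ne_zero h h')]; exact Complex.one_mem_slitPlane
  · rw [div_self (fibreRatio_ne_zero h h')]; exact Complex.one_mem_slitPlane

open scoped Classical in
/-- A neighbourhood of `P` on which the arguments of all relevant transition functions have
continuous branches. -/
def patch (P : HirzebruchSurface n) : Set (HirzebruchSurface n) :=
  {Q | 1 / 5 < weight (patchIdx P) Q} ∩
    ⋂ c, if P ∈ domain n c.1 c.2 then sector (patchIdx P) c P else {Q | weight c Q < 1 / 5}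

lemma isOpen_patch (P : HirzebruchSurface n) : IsOpen (patch P) := by
  refine (isOpen_lt continuous_const (continuous_weight _)).inter (isOpen_iInter_of_finite fun c => ?_)
  split_ifs
  · exact isOpen_sector _ _ _
  · exact isOpen_lt (continuous_weight c) continuous_const

lemma mem_patch_self (P : HirzebruchSurface n) : P ∈ patch P := by
  refine ⟨lt_weight_patchIdx P, Set.mem_iInter.2 fun c => ?_⟩
  split_ifs with h
  · exact mem_sector_self (mem_domain_of_lt_weight (lt_weight_patchIdx P)) h
  · change weight c P < 1 / 5
    rw [weight_eq_zero h]
    norm_num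

lemma mem_domain_of_mem_patch (h : Q ∈ patch P) : Q ∈ domain n (patchIdx P).1 (patchIdx P).2 :=
  mem_domain_of_lt_weight h.1

/-- On the patch of P' the weight of its chart exceeds 1/5. If P were outside the domain of that
chart, the patch of P would require the same weight to be below 1/5. So P is in the domain, the
transition functions are non-zero at P, and `argBranch` based at P makes sense on the overlap. -/
lemma mem_sector_of_mem_patch {P' : HirzebruchSurface n} (h : Q ∈ patch P) (h' : Q ∈ patch P') :
    P ∈ domain n (patchIdx P').1 (patchIdx P').2 ∧ Q ∈ sector (patchIdx P) (patchIdx P') P := by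
  have h1 := Set.mem_iInter.1 h.2 (patchIdx P')
  split_ifs at h1 with h2
  · exact ⟨h2, h1⟩
  · exact absurd h'.1 (lt_asymm (Set.mem_ofPred_eq ▸ h1))

end Patches

/-! ### Branches of the argument. -/

section Hodge

variable {n : ℕ} {s : ℝ} {c c' : Fin 2 × Fin 2} {P Q : HirzebruchSurface n}

/-- The branch at `Q` of the argument of `t` that agrees with the principal one at `P`. -/
def argBranch (t : HirzebruchSurface n → ℂ) (P Q : HirzebruchSurface n) : ℝ :=
  (t Q / t P).arg + (t P).arg

lemma eq_norm_mul_exp_argBranch {t : HirzebruchSurface n → ℂ} (hP : t P ≠ 0) :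
    t Q = ‖t Q‖ * Complex.exp (Complex.I * argBranch t P Q) := by
  have h1 := Complex.norm_mul_exp_arg_mul_I (t Q / t P)
  have h2 := Complex.norm_mul_exp_arg_mul_I (t P)
  have hP' : (‖t P‖ : ℂ) ≠ 0 := by simpa using hP
  calc t Q = (t Q / t P) * t P := (div_mul_cancel₀ _ hP).symm
    _ = (‖t Q / t P‖ * Complex.exp ((t Q / t P).arg * Complex.I)) *
        (‖t P‖ * Complex.exp ((t P).arg * Complex.I)) := by rw [h1, h2]
    _ = _ := by
      rw [argBranch, Complex.ofReal_add, mul_add, Complex.exp_add, norm_div, Complex.ofReal_div,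
        mul_comm Complex.I, mul_comm Complex.I]
      field_simp

/-- Arguments add up modulo 2π under multiplication. This gives the integrality of the Čech cocycle.
-/
lemma exists_int_eq_of_mul_eq {z₁ z₂ z₃ : ℂ} {A₁ A₂ A₃ : ℝ} (h : z₁ * z₂ = z₃) (h3 : z₃ ≠ 0)
    (h₁ : z₁ = ‖z₁‖ * Complex.exp (Complex.I * A₁)) (h₂ : z₂ = ‖z₂‖ * Complex.exp (Complex.I * A₂))
    (h₃ : z₃ = ‖z₃‖ * Complex.exp (Complex.I * A₃)) :
    ∃ k : ℤ, A₂ - A₃ + A₁ = k * (2 * Real.pi) := by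
  have hn : (‖z₃‖ : ℂ) ≠ 0 := by simpa using h3
  have h4 : Complex.exp (Complex.I * (A₁ + A₂)) = Complex.exp (Complex.I * A₃) := by
    refine mul_left_cancel₀ hn ?_
    rw [← h₃, ← h, mul_add, Complex.exp_add, norm_mul, Complex.ofReal_mul]
    conv_rhs => rw [h₁, h₂]
    ring
  obtain ⟨k, hk⟩ := Complex.exp_eq_exp_iff_exists_int.1 h4
  refine ⟨k, ?_⟩
  have h5 : Complex.I * ((A₂ - A₃ + A₁ : ℝ) : ℂ) = Complex.I * ((k * (2 * Real.pi) : ℝ) : ℂ) := by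
    push_cast
    linear_combination hk
  exact_mod_cast mul_left_cancel₀ Complex.I_ne_zero h5

/-- Up to a constant, the branch is the imaginary part of log(t(Q)/t(P)), and this quotient stays in
the slit plane on a sector. -/
lemma contDiffAt_argBranch {t : HirzebruchSurface n → ℂ} {f : CSpace 2 → HirzebruchSurface n}
    {x : CSpace 2} (ht : ContDiffAt ℂ ω (t ∘ f) x) (h : t (f x) / t P ∈ Complex.slitPlane) :
    ContDiffAt ℝ ∞ (argBranch t P ∘ f) x := by
  have h1 : ContDiffAt ℝ ∞ (fun z => t (f z) / t P) x :=
    ((ht.restrict_scalars ℝ).of_le le_top).div_const _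
  have h2 : ContDiffAt ℝ ∞ (fun z => (Complex.log (t (f z) / t P)).im) x :=
    ContDiffAt.comp (f := fun z => Complex.log (t (f z) / t P)) x
      Complex.imCLM.contDiff.contDiffAt (ContDiffAt.comp (g := Complex.log) x
        ((Complex.contDiffAt_log h).restrict_scalars ℝ) h1)
  have h3 : argBranch t P ∘ f = fun z => (Complex.log (t (f z) / t P)).im + (t P).arg := by
    funext z
    rw [Function.comp_apply, argBranch, Complex.log_im]
  rw [h3]
  exact h2.add contDiffAt_const

end Hodge

/-! ### Local primitives and rationality of the class. -/

section HodgeMetric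

variable {n : ℕ} {s : ℝ} {c c' : Fin 2 × Fin 2} {P Q : HirzebruchSurface n}
  {φ ψ : atlas (CSpace 2) (HirzebruchSurface n)} {z : CSpace 2}

lemma dcForm_const_mul (a : ℝ) (f : CSpace 2 → ℝ) (z : CSpace 2) :
    dcForm (fun y => a * f y) z = a • dcForm f z := by
  ext v
  have : fderiv ℝ (fun y => a * f y) z = a • fderiv ℝ f z :=
    congrFun (fderiv_const_smul_field (𝕜 := ℝ) (f := f) a) z
  rw [ContinuousAlternatingMap.smul_apply, dcForm_apply, dcForm_apply, this]
  simp only [smul_apply, smul_eq_mul]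
  ring

lemma dcForm_add {f g : CSpace 2 → ℝ} (hf : DifferentiableAt ℝ f z)
    (hg : DifferentiableAt ℝ g z) : dcForm (fun y => f y + g y) z = dcForm f z + dcForm g z := by
  ext v
  rw [ContinuousAlternatingMap.add_apply, dcForm_apply, dcForm_apply, dcForm_apply,
    fderiv_fun_add hf hg, add_apply, mul_add]

lemma chart_symm_apply (φ : atlas (CSpace 2) (HirzebruchSurface n)) (z : CSpace 2) :
    φ.1.symm z = mk n (HirzebruchSurface.lift (chartIdx φ).1 (chartIdx φ).2 z) := by
  conv_lhs => rw [← chart_chartIdx φ]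
  rfl

lemma chart_apply (φ : atlas (CSpace 2) (HirzebruchSurface n)) (P : HirzebruchSurface n) :
    φ.1 P = coord n (chartIdx φ).1 (chartIdx φ).2 P := by
  conv_lhs => rw [← chart_chartIdx φ]
  rfl

/-- The potential of Hitchin's metric in a standard chart, as a function on the surface. -/
def localPot (s : ℝ) (c : Fin 2 × Fin 2) (P : HirzebruchSurface n) : ℝ :=
  chartPot n s c.1 c.2 (coord n c.1 c.2 P)

lemma localPot_comp_symm (φ : atlas (CSpace 2) (HirzebruchSurface n)) :
    (fun z => localPot s c (φ.1.symm z)) = fun z => chartPot n s c.1 c.2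
      (preCoord n c.1 c.2 (preLift (chartIdx φ).1 (chartIdx φ).2 z)) := by
  funext z
  rw [chart_symm_apply]
  rfl

lemma contDiffAt_localPot (h : φ.1.symm z ∈ domain n c.1 c.2) :
    ContDiffAt ℝ ∞ (fun z => localPot s c (φ.1.symm z)) z := by
  rw [chart_symm_apply, mk_mem_domain] at h
  rw [localPot_comp_symm]
  exact contDiff_chartPot.contDiffAt.comp z
    (((contDiffAt_preCoord_preLift h.1 h.2).restrict_scalars ℝ).of_le le_top)

lemma levi_localPot (hs : 0 < s) (h : φ.1.symm z ∈ domain n c.1 c.2) :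
    levi (fun z => localPot s c (φ.1.symm z)) z = (hitchinMetric n s hs).coeff φ z := by
  rw [chart_symm_apply, mk_mem_domain] at h
  rw [localPot_comp_symm, hitchinMetric_coeff,
    levi_comp_holomorphic (contDiffAt_preCoord_preLift h.1 h.2) contDiff_chartPot.contDiffAt]
  exact (levi_chartPot_compat h.1 h.2).symm

/-- The factors -1 and -s record that the metric combines the pulled-back 𝒪(1) of the base with s
times the relative 𝒪(1). They become the coefficients of the Čech cocycle. -/
lemma localPot_eq (h : Q ∈ domain n c.1 c.2) (h' : Q ∈ domain n c'.1 c'.2) :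
    localPot s c' Q = localPot s c Q + (-1 * Real.log (‖baseRatio c c' Q‖ ^ 2) +
      -s * Real.log (‖fibreRatio c c' Q‖ ^ 2)) := by
  obtain ⟨q, rfl⟩ := isQuotientMap_mk.surjective Q
  rw [mk_mem_domain] at h h'
  have h1 := fibre_ne_zero (n := n) h.1 h.2
  have h2 := fibre_ne_zero (n := n) h'.1 h'.2
  rw [localPot, localPot, coord_mk, coord_mk, chartPot_preCoord q h.1 h.2,
    chartPot_preCoord q h'.1 h'.2, baseRatio_mk, fibreRatio_mk, norm_div, norm_div, div_pow, div_pow,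
    Real.log_div (by simpa using h'.1) (by simpa using h.1),
    Real.log_div (by simpa using h2) (by simpa using h1)]
  ring

lemma contDiffAt_baseRatio (h : φ.1.symm z ∈ domain n c.1 c.2) :
    ContDiffAt ℂ ω (baseRatio c c' ∘ φ.1.symm) z := by
  rw [chart_symm_apply, mk_mem_domain] at h
  have : baseRatio c c' ∘ φ.1.symm = fun z => (preLift (chartIdx φ).1 (chartIdx φ).2 z).1 c'.1 /
      (preLift (chartIdx φ).1 (chartIdx φ).2 z).1 c.1 := by
    funext z
    rw [Function.comp_apply, chart_symm_apply, baseRatio_mk]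
    rfl
  rw [this]
  exact (contDiff_preLift_fst _).contDiffAt.div (contDiff_preLift_fst _).contDiffAt h.1

lemma contDiffAt_fibreRatio (h : φ.1.symm z ∈ domain n c.1 c.2) :
    ContDiffAt ℂ ω (fibreRatio c c' ∘ φ.1.symm) z := by
  rw [chart_symm_apply, mk_mem_domain] at h
  have : fibreRatio c c' ∘ φ.1.symm = fun z =>
      fibre n c'.1 (preLift (chartIdx φ).1 (chartIdx φ).2 z) c'.2 /
      fibre n c.1 (preLift (chartIdx φ).1 (chartIdx φ).2 z) c.2 := by
    funext z
    rw [Function.comp_apply, chart_symm_apply, fibreRatio_mk]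
    rfl
  rw [this]
  exact (contDiff_fibre_preLift _).contDiffAt.div (contDiff_fibre_preLift _).contDiffAt
    (fibre_ne_zero h.1 h.2)

lemma continuous_chart_symm (φ : atlas (CSpace 2) (HirzebruchSurface n)) :
    Continuous φ.1.symm := by
  have := φ.1.continuousOn_symm
  rwa [chart_target_eq_univ, continuousOn_univ] at this

lemma eventually_chart_symm_mem {U : Set (HirzebruchSurface n)} (hU : IsOpen U)
    (h : φ.1.symm z ∈ U) : ∀ᶠ y in 𝓝 z, φ.1.symm y ∈ U :=
  (continuous_chart_symm φ).continuousAt.eventually (hU.mem_nhds h)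

/-- The primitive on a patch of the form of Hitchin's metric, divided by `π`. -/
def hodgePrimitive (s : ℝ) (P : HirzebruchSurface n) : ChartForm 2 (HirzebruchSurface n) 1 :=
  fun φ => dcForm fun z => Real.pi⁻¹ * localPot s (patchIdx P) (φ.1.symm z)

/-- The potentials of the differences of these primitives. -/
def hodgeTransition (s : ℝ) (P P' Q : HirzebruchSurface n) : ℝ :=
  -(2 * Real.pi)⁻¹ * (argBranch (baseRatio (patchIdx P) (patchIdx P')) P Q +
    s * argBranch (fibreRatio (patchIdx P) (patchIdx P')) P Q)

lemma isSmoothFormOn_hodgePrimitive (s : ℝ) (P : HirzebruchSurface n) :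
    (hodgePrimitive s P).IsSmoothFormOn (patch P) := by
  refine ⟨fun φ z hz => ?_, fun φ ψ z hz => ?_⟩
  · exact (contDiffAt_dcForm (contDiffAt_const.mul
      (contDiffAt_localPot (mem_domain_of_mem_patch hz.2)))).contDiffWithinAt
  · set τ := φ.1.symm ≫ₕ ψ.1 with hτ
    have hsrc := hz.1.2
    have hτ' : ContDiffAt ℂ ω τ z := by
      have h : φ.1.symm z ∈ domain n (chartIdx ψ).1 (chartIdx ψ).2 := by
        have h := hsrc
        rw [← chart_chartIdx ψ] at h
        exact h
      rw [chart_symm_apply, mk_mem_domain] at h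
      have h2 : (τ : CSpace 2 → CSpace 2) = fun z => preCoord n (chartIdx ψ).1 (chartIdx ψ).2
          (preLift (chartIdx φ).1 (chartIdx φ).2 z) := by
        funext y
        rw [hτ, OpenPartialHomeomorph.trans_apply, chart_apply, chart_symm_apply]
        rfl
      rw [h2]
      exact contDiffAt_preCoord_preLift h.1 h.2
    have hev : (fun z => Real.pi⁻¹ * localPot s (patchIdx P) (φ.1.symm z)) =ᶠ[𝓝 z]
        fun y => (fun z => Real.pi⁻¹ * localPot s (patchIdx P) (ψ.1.symm z)) (τ y) := by
      filter_upwards [eventually_chart_symm_mem ψ.1.open_source hsrc] with y hy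
      simp only [hτ, OpenPartialHomeomorph.trans_apply]
      rw [ψ.1.left_inv hy]
    have hτz : ψ.1.symm (τ z) = φ.1.symm z := ψ.1.left_inv hsrc
    rw [hodgePrimitive, dcForm_congr hev, dcForm_comp_holomorphic
      (f := fun z => Real.pi⁻¹ * localPot s (patchIdx P) (ψ.1.symm z)) (hτ'.differentiableAt (by simp))]
    · rfl
    refine (contDiffAt_const.mul (contDiffAt_localPot ?_)).differentiableAt (n := ∞) (by simp)
    rw [hτz]
    exact mem_domain_of_mem_patch hz.2

lemma extDeriv_hodgePrimitive (hs : 0 < s) (h : φ.1.symm z ∈ patch P) :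
    extDeriv (hodgePrimitive s P φ) z =
      ((hitchinMetric n s hs).scale Real.pi⁻¹ (inv_pos.2 Real.pi_pos)).fundamentalForm φ z := by
  have hd := mem_domain_of_mem_patch h
  rw [hodgePrimitive, extDeriv_dcForm (contDiffAt_const.mul (contDiffAt_localPot hd)),
    levi_const_mul, levi_localPot hs hd]
  rfl

lemma contDiffAt_hodgeTransition {P' : HirzebruchSurface n} (h : φ.1.symm z ∈ patch P)
    (h' : φ.1.symm z ∈ patch P') :
    ContDiffAt ℝ ∞ (argBranch (baseRatio (patchIdx P) (patchIdx P')) P ∘ φ.1.symm) z ∧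
      ContDiffAt ℝ ∞ (argBranch (fibreRatio (patchIdx P) (patchIdx P')) P ∘ φ.1.symm) z := by
  have hd := mem_domain_of_mem_patch h
  have hs := (mem_sector_of_mem_patch h h').2.2
  exact ⟨contDiffAt_argBranch (contDiffAt_baseRatio hd) hs.1,
    contDiffAt_argBranch (contDiffAt_fibreRatio hd) hs.2⟩

/-- By `localPot_eq` the potentials differ by -log|k₁|² - s log|k₂|² for the two ratios, and
`dcForm` turns each log|k|² into half the differential of its argument. With the normalisation 1/π
this is the factor -1/(2π) in `hodgeTransition`. -/
lemma hodgePrimitive_sub {P' : HirzebruchSurface n} (h : φ.1.symm z ∈ patch P)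
    (h' : φ.1.symm z ∈ patch P') (v : Fin 1 → CSpace 2) :
    hodgePrimitive s P' φ z v - hodgePrimitive s P φ z v =
      fderiv ℝ (hodgeTransition s P P' ∘ φ.1.symm) z (v 0) := by
  set c := patchIdx P
  set c' := patchIdx P'
  have hd := mem_domain_of_mem_patch h
  have hd' := mem_domain_of_mem_patch h'
  have hP := mem_domain_of_mem_patch (mem_patch_self P)
  have hP' := (mem_sector_of_mem_patch h h').1
  obtain ⟨hA, hB⟩ := contDiffAt_hodgeTransition h h'
  have hA := hA.differentiableAt (by simp)
  have hB := hB.differentiableAt (by simp)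
  have hk1 := contDiffAt_baseRatio (c' := c') hd
  have hk2 := contDiffAt_fibreRatio (c' := c') hd
  have hk10 := baseRatio_ne_zero hd hd'
  have hk20 := fibreRatio_ne_zero hd hd'
  have hl1 := (ContDiffAt.log_norm_sq hk1 hk10).differentiableAt (by simp)
  have hl2 := (ContDiffAt.log_norm_sq hk2 hk20).differentiableAt (by simp)
  have hpot := (contDiffAt_localPot (s := s) hd).differentiableAt (by simp)
  have hev : (fun z => localPot s c' (φ.1.symm z)) =ᶠ[𝓝 z]
      fun y => localPot s c (φ.1.symm y) +
        (-1 * Real.log (‖(baseRatio c c' ∘ φ.1.symm) y‖ ^ 2) +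
          -s * Real.log (‖(fibreRatio c c' ∘ φ.1.symm) y‖ ^ 2)) := by
    filter_upwards [eventually_chart_symm_mem (isOpen_domain _ _) hd,
      eventually_chart_symm_mem (isOpen_domain _ _) hd'] with y hy hy'
    exact localPot_eq hy hy'
  have hdiff : fderiv ℝ (hodgeTransition s P P' ∘ φ.1.symm) z (v 0) = -(2 * Real.pi)⁻¹ *
      (fderiv ℝ (argBranch (baseRatio c c') P ∘ φ.1.symm) z (v 0) +
        s * fderiv ℝ (argBranch (fibreRatio c c') P ∘ φ.1.symm) z (v 0)) := by
    have := ((hA.hasFDerivAt.add (hB.hasFDerivAt.const_mul s)).const_mul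
      (-(2 * Real.pi)⁻¹)).fderiv
    rw [show hodgeTransition s P P' ∘ φ.1.symm = fun y => -(2 * Real.pi)⁻¹ *
      ((argBranch (baseRatio c c') P ∘ φ.1.symm) + fun y => s *
        (argBranch (fibreRatio c c') P ∘ φ.1.symm) y) y from rfl, this]
    rfl
  rw [hodgePrimitive, hodgePrimitive, dcForm_const_mul, dcForm_const_mul, dcForm_congr hev,
    dcForm_add hpot ((hl1.const_mul _).fun_add (hl2.const_mul _)),
    dcForm_add (hl1.const_mul _) (hl2.const_mul _), dcForm_const_mul, dcForm_const_mul, hdiff]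
  simp only [ContinuousAlternatingMap.smul_apply, ContinuousAlternatingMap.add_apply]
  rw [dcForm_log_norm_sq (hk1.differentiableAt (by simp)) hk10 hA
      (Eventually.of_forall fun y => eq_norm_mul_exp_argBranch (baseRatio_ne_zero hP hP')),
    dcForm_log_norm_sq (hk2.differentiableAt (by simp)) hk20 hB
      (Eventually.of_forall fun y => eq_norm_mul_exp_argBranch (fibreRatio_ne_zero hP hP'))]
  simp only [smul_eq_mul, mul_inv]
  ring

lemma exists_rat_hodgeTransition (q : ℚ) {P₁ P₂ P₃ : HirzebruchSurface n} (h₁ : Q ∈ patch P₁)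
    (h₂ : Q ∈ patch P₂) (h₃ : Q ∈ patch P₃) : ∃ r : ℚ, hodgeTransition q P₂ P₃ Q -
      hodgeTransition q P₁ P₃ Q + hodgeTransition q P₁ P₂ Q = r := by
  have hd₁ := mem_domain_of_mem_patch h₁
  have hd₂ := mem_domain_of_mem_patch h₂
  have hd₃ := mem_domain_of_mem_patch h₃
  have hp₁ := mem_domain_of_mem_patch (mem_patch_self P₁)
  have hp₂ := mem_domain_of_mem_patch (mem_patch_self P₂)
  have h12 := (mem_sector_of_mem_patch h₁ h₂).1
  have h13 := (mem_sector_of_mem_patch h₁ h₃).1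
  have h23 := (mem_sector_of_mem_patch h₂ h₃).1
  obtain ⟨k, hk⟩ := exists_int_eq_of_mul_eq (baseRatio_mul hd₂) (baseRatio_ne_zero hd₁ hd₃)
    (eq_norm_mul_exp_argBranch (baseRatio_ne_zero hp₁ h12))
    (eq_norm_mul_exp_argBranch (baseRatio_ne_zero hp₂ h23))
    (eq_norm_mul_exp_argBranch (baseRatio_ne_zero hp₁ h13))
  obtain ⟨l, hl⟩ := exists_int_eq_of_mul_eq (fibreRatio_mul hd₂) (fibreRatio_ne_zero hd₁ hd₃)
    (eq_norm_mul_exp_argBranch (fibreRatio_ne_zero hp₁ h12))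
    (eq_norm_mul_exp_argBranch (fibreRatio_ne_zero hp₂ h23))
    (eq_norm_mul_exp_argBranch (fibreRatio_ne_zero hp₁ h13))
  -- `k` and `l` count the multiples of 2π by which the arguments of the two kinds of ratios fail
  -- the cocycle identity.
  refine ⟨-(k + q * l), ?_⟩
  have hpi := Real.pi_ne_zero
  have : hodgeTransition q P₂ P₃ Q - hodgeTransition q P₁ P₃ Q + hodgeTransition q P₁ P₂ Q =
      -(2 * Real.pi)⁻¹ * (k * (2 * Real.pi) + q * (l * (2 * Real.pi))) := by
    rw [← hk, ← hl]
    simp only [hodgeTransition]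
    ring
  rw [this]
  push_cast
  field_simp

/-- Hitchin's metrics with rational parameter are Hodge after division by `π`. -/
lemma isHodge_hitchinMetric (q : ℚ) (hq : (0 : ℝ) < q) :
    ((hitchinMetric n (q : ℝ) hq).scale Real.pi⁻¹ (inv_pos.2 Real.pi_pos)).IsHodge := by
  -- The cover is indexed by the points of the surface themselves, one patch around each.
  refine ⟨fun φ z hz => ?_, HirzebruchSurface n, patch, hodgePrimitive q, hodgeTransition q,
    isOpen_patch, ?_, isSmoothFormOn_hodgePrimitive _, fun P φ z hz => extDeriv_hodgePrimitive hq hz.2,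
    fun P P' φ z hz => ?_, fun P P' φ z hz => hodgePrimitive_sub hz.2.1 hz.2.2,
    fun P₁ P₂ P₃ Q hQ => exists_rat_hodgeTransition q hQ.1.1 hQ.1.2 hQ.2⟩
  · have hev : ((hitchinMetric n (q : ℝ) hq).scale Real.pi⁻¹
        (inv_pos.2 Real.pi_pos)).fundamentalForm φ =
        extDeriv (dcForm fun z => Real.pi⁻¹ *
          chartPot n q (chartIdx φ).1 (chartIdx φ).2 z) := by
      funext y
      rw [extDeriv_dcForm (contDiffAt_const.mul contDiff_chartPot.contDiffAt), levi_const_mul]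
      rfl
    rw [hev]
    exact extDeriv_extDeriv_apply (contDiffAt_dcForm
      (contDiffAt_const.mul contDiff_chartPot.contDiffAt)) minSmoothness_two_le_infty
  · exact Set.eq_univ_of_forall fun P => Set.mem_iUnion.2 ⟨P, mem_patch_self P⟩
  · obtain ⟨hA, hB⟩ := contDiffAt_hodgeTransition hz.2.1 hz.2.2
    exact (contDiffAt_const.mul (hA.add (contDiffAt_const.mul hB))).contDiffWithinAt

end HodgeMetric

end

theorem theorem1p1 (n : ℕ) (hn : 1 ≤ n) :
    -- Hitchin's metrics are globally well defined on the surface and Kähler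
    (∀ s : ℝ, 0 < s → ∃ g : HermitianMetric 2 (HirzebruchSurface n), IsHitchinMetric n s g) ∧
    (∀ s : ℝ, 0 < s → ∀ g : HermitianMetric 2 (HirzebruchSurface n),
      IsHitchinMetric n s g → g.IsKahler) ∧
    -- for rational parameters they are Hodge, after normalization by `1 / π`
    (∀ q : ℚ, 0 < q → ∀ g : HermitianMetric 2 (HirzebruchSurface n),
      IsHitchinMetric n (q : ℝ) g → (g.scale Real.pi⁻¹ (inv_pos.2 Real.pi_pos)).IsHodge) ∧
    -- the smallest and the largest value of the holomorphic sectional curvature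
    (∀ s : ℝ, 0 < s → s < 1 / (n : ℝ) ^ 2 →
      ∀ g : HermitianMetric 2 (HirzebruchSurface n), IsHitchinMetric n s g →
        IsLeast g.holSectCurvValues ((4 - 4 * (n : ℝ) ^ 2 * s) / (1 + s + 2 * n * s)) ∧
        IsGreatest g.holSectCurvValues (4 / s)) ∧
    -- the range of parameters with positive curvature
    (∀ s : ℝ, 0 < s → ∀ g : HermitianMetric 2 (HirzebruchSurface n), IsHitchinMetric n s g →
      (g.HasPosHolSectCurv ↔ s < 1 / (n : ℝ) ^ 2)) ∧
    -- the metric with the best pinching constant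
    (∀ g : HermitianMetric 2 (HirzebruchSurface n),
      IsHitchinMetric n (1 / (2 * (n : ℝ) ^ 2 + n)) g →
        g.IsPinched (1 / (1 + 2 * (n : ℝ)) ^ 2) ∧
        (g.scale Real.pi⁻¹ (inv_pos.2 Real.pi_pos)).IsHodge ∧
        (g.scale Real.pi⁻¹ (inv_pos.2 Real.pi_pos)).IsPinched (1 / (1 + 2 * (n : ℝ)) ^ 2)) ∧
    -- the resulting existence statement
    (∃ g : HermitianMetric 2 (HirzebruchSurface n),
      g.IsHodge ∧ g.HasPosHolSectCurv ∧ g.IsPinched (1 / (1 + 2 * (n : ℝ)) ^ 2)) ∧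
    -- optimality within the family
    (∀ s : ℝ, 0 < s → ∀ g : HermitianMetric 2 (HirzebruchSurface n), IsHitchinMetric n s g →
      g.HasPosHolSectCurv → ∀ c : ℝ, g.IsPinched c → c ≤ 1 / (1 + 2 * (n : ℝ)) ^ 2) := by
  have hn' : (1 : ℝ) ≤ n := by exact_mod_cast hn
  have hlt : ∀ s : ℝ, s < 1 / (n : ℝ) ^ 2 ↔ s * (n : ℝ) ^ 2 < 1 := fun s =>
    lt_div_iff₀ (by positivity)
  have hs₀ : (0 : ℝ) < 1 / (2 * (n : ℝ) ^ 2 + n) := by positivity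
  have hcast : (1 / (2 * (n : ℝ) ^ 2 + n)) = ((1 / (2 * (n : ℚ) ^ 2 + n) : ℚ) : ℝ) := by
    push_cast; rfl
  have hodge : ((hitchinMetric n _ hs₀).scale Real.pi⁻¹ (inv_pos.2 Real.pi_pos)).IsHodge := by
    -- The metric depends on the proof of positivity of its parameter, so the identification with a
    -- cast rational is made for a variable, which can be substituted.
    have h : ∀ (r : ℝ) (hr : 0 < r), r = ((1 / (2 * (n : ℚ) ^ 2 + n) : ℚ) : ℝ) →
        ((hitchinMetric n r hr).scale Real.pi⁻¹ (inv_pos.2 Real.pi_pos)).IsHodge := by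
      rintro _ hr rfl
      exact isHodge_hitchinMetric _ hr
    exact h _ hs₀ hcast
  have hpinched := isPinched_hitchinMetric hn hs₀ rfl
  have hpinched' := hpinched.scale (inv_pos.2 Real.pi_pos)
  refine ⟨fun s hs => ⟨hitchinMetric n s hs, isHitchinMetric_hitchinMetric hs⟩,
    fun s hs g hg => ?_, fun q hq g hg => ?_, fun s hs h g hg => ?_, fun s hs g hg => ?_,
    fun g hg => ?_, ⟨_, hodge, hpinched'.2.2.1, hpinched'⟩, fun s hs g hg _ c hc => ?_⟩
  · rw [hg.eq_hitchinMetric hs]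
    exact isKahler_hitchinMetric hs
  · have hq' : (0 : ℝ) < q := by exact_mod_cast hq
    rw [hg.eq_hitchinMetric hq']
    exact isHodge_hitchinMetric q hq'
  · rw [hg.eq_hitchinMetric hs]
    have h' := ((hlt s).1 h).le
    exact ⟨isLeast_holSectCurvValues hs h', isGreatest_holSectCurvValues hn hs h'⟩
  · rw [hg.eq_hitchinMetric hs, hlt]
    exact hasPosHolSectCurv_hitchinMetric_iff hs
  · rw [hg.eq_hitchinMetric hs₀]
    exact ⟨hpinched, hodge, hpinched'⟩
  · rw [hg.eq_hitchinMetric hs] at hc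
    exact pinching_le hn hs hc
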